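/- Let $\ell,r$ be positive integers. Let $\Gamma$ be the lattice with $\mathbb Z$-basis $v_1,\dots,v_\ell,\theta_1,\dots,\theta_r,\Theta_1,\dots,\Theta_r$ and symmetric bilinear form given by $(v_i|v_j)=\delta_{ij}$, $(\theta_\nu|\Theta_\mu)=\delta_{\nu\mu}$, all other products of basis vectors being $0$. Let $\varepsilon:\Gamma\times\Gamma\to\{\pm1\}$ be the bi-multiplicative function with $\varepsilon(v_i,v_j)=\epsilon_{ij}$, where $\epsilon_{ij}=1$ for $i<j$ and $\epsilon_{ij}=-1$ for $i\ge j$; $\varepsilon(\theta_\nu,\Theta_\mu)=(-1)^{\delta_{\nu\mu}}$; $\varepsilon(\theta_\nu,\theta_\mu)=\varepsilon(\Theta_\nu,\Theta_\mu)=1$; $\varepsilon(v_i,\eta)=\varepsilon(\eta,v_i)=1$ for $\eta\in\{\theta_\nu,\Theta_\nu\}$; and with arbitrary values $\varepsilon(\Theta_\nu,\theta_\mu)\in\{\pm1\}$. Let $\mathfrak h=\mathbb C\otimes_{\mathbb Z}\Gamma$, let $S$ be the symmetric algebra of $\bigoplus_{j<0}\mathfrak h s^{j}$, and let $V_\Gamma=S\otimes\mathbb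 C_\varepsilon[\Gamma]$ be the space of states of the lattice vertex algebra of $\Gamma$. For $h\in\mathfrak h$ let $h_{(k)}$ act on $V_\Gamma$ as multiplication by $hs^{k}$ if $k<0$, as the scalar $(h|\beta)$ on $S\otimes e^\beta$ if $k=0$, and as the derivation of $S$ with $h's^{-n}\mapsto\delta_{k,n}\,n\,(h|h')$ if $k>0$. Put $h(z)=\sum_{m\in\mathbb Z}h_{(-m)}z^{m-1}$ and $$E^\alpha(z)=e^\alpha z^{\alpha_{(0)}}\exp\Big(\sum_{n>0}\alpha_{(-n)}\tfrac{z^n}{n}\Big)\exp\Big(\sum_{n<0}\alpha_{(-n)}\tfrac{z^n}{n}\Big),\qquad e^\alpha(g\otimes e^\beta)=\varepsilon(\alpha,\beta)\,g\otimes e^{\alpha+\beta}.$$ The state-field correspondence is $$Y\big(h_1s^{-m_1-1}\cdots h_ks^{-m_k-1}\otimes e^\alpha,z\big)=\tfrac1{m_1!\cdots m_k!}:\partial_z^{m_1}h_1(z)\cdots\partial_z^{m_k}h_k(z)\,E^\alpha(z):,$$ where the normally ordered product is expanded from right to left by $:A(z)C(z):=A(z)_{\ge0}C(z)+C(z)A(z)_{<0}$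 (non-negative and negative powers of $z$ in $A$), and the modes $a_{(m)}$ are defined by $Y(a,z)=\sum_{m}a_{(m)}z^{-m-1}$. For $m\in\mathbb Z$, $\boldsymbol p\in\mathbb Z^r$ and $\boldsymbol p\cdot\boldsymbol\theta=\sum_\nu p_\nu\theta_\nu$ put $$h_{i,m}^{\boldsymbol p}=\big((v_i-v_{i+1})s^{-1}\otimes e^{\boldsymbol p\cdot\boldsymbol\theta}\big)_{(m)}\ (1\le i\le\ell-1),\qquad e_{kl,m}^{\boldsymbol p}=\epsilon_{lk}\big(1\otimes e^{v_k-v_l+\boldsymbol p\cdot\boldsymbol\theta}\big)_{(m)}\ (1\le k\ne l\le\ell),$$ $$\kappa_{0,m}^{\boldsymbol p}=\big(1\otimes e^{\boldsymbol p\cdot\boldsymbol\theta}\big)_{(m-1)},\qquad \kappa_{\nu,m}^{\boldsymbol p}=\big(\theta_\nu s^{-1}\otimes e^{\boldsymbol p\cdot\boldsymbol\theta}\big)_{(m)}\ (1\le\nu\le r),$$ and let $\mathfrak g^{\mathrm{tor}}\subset\operatorname{End}(V_\Gamma)$ be the Lie algebra generated by all these operators under the commutator bracket. Let $\mathcal R=\mathbb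 C[t_0^{\pm1},\dots,t_r^{\pm1}]$, and let $\mathcal K$ be the quotient of $\bigoplus_{\nu=0}^r\mathcal RK_\nu$ by the span of all $\sum_{\nu}m_\nu t_0^{m_0}\cdots t_r^{m_r}K_\nu$. The toroidal Lie algebra $\mathcal L^{\mathrm{tor}}_{r+1}(\mathfrak{sl}_\ell)=(\mathfrak{sl}_\ell\otimes\mathcal R)\oplus\mathcal K$ has the bracket for which $\mathcal K$ is central and, writing $t^{\boldsymbol m}=t_0^{m_0}\cdots t_r^{m_r}$, $$[X\otimes t^{\boldsymbol m},Y\otimes t^{\boldsymbol n}]=[X,Y]\otimes t^{\boldsymbol m+\boldsymbol n}+\operatorname{tr}(XY)\sum_{\nu=0}^r m_\nu\,\overline{t^{\boldsymbol m+\boldsymbol n}K_\nu}.$$ Then there is an isomorphism of complex Lie algebras $\mathfrak g^{\mathrm{tor}}\to\mathcal L^{\mathrm{tor}}_{r+1}(\mathfrak{sl}_\ell)$ such that, for all admissible indices, $$h_{i,m}^{\boldsymbol p}\mapsto(E_{i,i}-E_{i+1,i+1})\otimes t_0^mt_1^{p_1}\cdots t_r^{p_r},\qquad e_{kl,m}^{\boldsymbol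 p}\mapsto E_{k,l}\otimes t_0^mt_1^{p_1}\cdots t_r^{p_r},\qquad \kappa_{\nu,m}^{\boldsymbol p}\mapsto\overline{t_0^mt_1^{p_1}\cdots t_r^{p_r}K_\nu}.$$ -/

import Mathlib

open scoped TensorProduct

attribute [local instance 100] LieRing.ofAssociativeRing

namespace ToroidalRealization

noncomputable section

/-! ## The lattice vertex algebra of a lattice with a given basis

The lattice is `ι → ℤ` (`ι` finite, `Pi.single i 1` the basis vectors) with Gram matrix `B`, and its
complexification is `ι → ℂ`. -/

/-- The symmetric algebra `S` on `𝔥^{<0} = ⨁_{n ≥ 0} 𝔥 s^{-(n+1)}`: polynomials in the variables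
`X (i, n) = b_i s^{-(n+1)}`, where `b_i` is the `i`-th basis vector. -/
abbrev Fock (ι : Type) : Type := MvPolynomial (ι × ℕ) ℂ

/-- The state space `S ⊗ ℂ_ε[ℤ^ι]`; the vector `g ⊗ e^β` is `Finsupp.single β g`. -/
abbrev StateSpace (ι : Type) : Type := (ι → ℤ) →₀ Fock ι

/-- The vector `g ⊗ e^β`. -/
abbrev vec {ι : Type} (g : Fock ι) (β : ι → ℤ) : StateSpace ι := Finsupp.single β g

/-- Linear operators on the state space. -/
abbrev Op (ι : Type) : Type := Module.End ℂ (StateSpace ι)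

/-- Formal distributions `∑_{n ∈ ℤ} A_n z^n` with operator coefficients, as `n ↦ A_n`. -/
abbrev Dist (ι : Type) : Type := ℤ → Op ι

/-- The sum of a family of operators which is locally finite (every vector is annihilated by all
but finitely many members), computed vector by vector. -/
def locSum {ι J : Type} (F : J → Op ι) : Op ι := by
  classical
  exact
    if hF : ∀ v, (Function.support fun j => F j v).Finite then
      { toFun := fun v => ∑ᶠ j, F j v
        map_add' := fun v w => by
          simp only [map_add]
          exact finsum_add_distrib (hF v) (hF w)
        map_smul' := fun a v => by
          simp only [map_smul, RingHom.id_apply]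
          exact (smul_finsum' a (hF v)).symm }
    else 0

/-- The bilinear form on the lattice. -/
def latForm {ι : Type} [Fintype ι] (B : ι → ι → ℤ) (α β : ι → ℤ) : ℤ :=
  ∑ i, ∑ j, B i j * α i * β j

/-- The bilinear form on the complexified lattice. -/
def form {ι : Type} [Fintype ι] (B : ι → ι → ℤ) (h h' : ι → ℂ) : ℂ :=
  ∑ i, ∑ j, (B i j : ℂ) * h i * h' j

/-- The embedding of the lattice into its complexification. -/
def cplx {ι : Type} (α : ι → ℤ) : ι → ℂ := fun i => (α i : ℂ)

/-- The element `h s^{-(n+1)}` of `S`. -/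
def neg {ι : Type} [Fintype ι] (h : ι → ℂ) (n : ℕ) : Fock ι :=
  ∑ i, MvPolynomial.C (h i) * MvPolynomial.X (i, n)

/-- The operator `h_{(k)}`: multiplication by `h s^k` for `k < 0`, the scalar `(h|β)` on
`S ⊗ e^β` for `k = 0`, and for `k > 0` the derivation of `S` that sends `h' s^{-n}` to
`δ_{k,n} n (h|h')`. -/
def heis {ι : Type} [Fintype ι] [DecidableEq ι] (B : ι → ι → ℤ) (h : ι → ℂ) : ℤ → Op ι
  | Int.negSucc n => Finsupp.mapRange.linearMap (LinearMap.mulLeft ℂ (neg h n))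
  | Int.ofNat 0 => Finsupp.lsum ℂ fun β => form B h (cplx β) • Finsupp.lsingle β
  | Int.ofNat (n + 1) => Finsupp.mapRange.linearMap
      (∑ i, (((n : ℂ) + 1) * form B h (Pi.single i 1)) •
        (MvPolynomial.pderiv (R := ℂ) (i, n)).toLinearMap)

/-- The operator `e^α : g ⊗ e^β ↦ ε(α, β) g ⊗ e^{α+β}`. -/
def expOp {ι : Type} (ε : (ι → ℤ) → (ι → ℤ) → ℤˣ) (α : ι → ℤ) : Op ι :=
  Finsupp.lsum ℂ fun β => (((ε α β : ℤˣ) : ℤ) : ℂ) • Finsupp.lsingle (α + β)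

/-- The coefficient of `z^k` in `z^{α_{(0)}}`: the projection onto `⨁_{(α|β) = k} S ⊗ e^β`. -/
def zPow {ι : Type} [Fintype ι] (B : ι → ι → ℤ) (α : ι → ℤ) (k : ℤ) : Op ι :=
  Finsupp.lsum ℂ fun β => if latForm B α β = k then Finsupp.lsingle β else 0

/-- The coefficient of `x^N` in `exp f = ∑_k f^k / k!`, for a power series `f` in `x` with zero
constant term (so that only `k ≤ N` contributes) and operator coefficients. -/
def expCoeff {ι : Type} (f : PowerSeries (Op ι)) (N : ℕ) : Op ι :=
  ∑ k ∈ Finset.range (N + 1), ((k.factorial : ℂ)⁻¹) • PowerSeries.coeff N (f ^ k)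

/-- `∑_{n > 0} α_{(-n)} z^n / n`, as a power series in `z`. -/
def creation {ι : Type} [Fintype ι] [DecidableEq ι] (B : ι → ι → ℤ) (α : ι → ℤ) :
    PowerSeries (Op ι) :=
  PowerSeries.mk fun n => if n = 0 then 0 else ((n : ℂ)⁻¹) • heis B (cplx α) (-(n : ℤ))

/-- `∑_{n < 0} α_{(-n)} z^n / n = -∑_{n > 0} α_{(n)} z^{-n} / n`, as a power series in `z⁻¹`. -/
def annihilation {ι : Type} [Fintype ι] [DecidableEq ι] (B : ι → ι → ℤ) (α : ι → ℤ) :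
    PowerSeries (Op ι) :=
  PowerSeries.mk fun n => if n = 0 then 0 else (-(n : ℂ)⁻¹) • heis B (cplx α) (n : ℤ)

/-- The vertex operator
`E^α(z) = e^α z^{α_{(0)}} exp(∑_{n>0} α_{(-n)} z^n / n) exp(∑_{n<0} α_{(-n)} z^n / n)`;
`z^a` is taken from the first and `z^{-b}` from the second exponential. -/
def vertexOp {ι : Type} [Fintype ι] [DecidableEq ι] (B : ι → ι → ℤ)
    (ε : (ι → ℤ) → (ι → ℤ) → ℤˣ) (α : ι → ℤ) : Dist ι := fun N =>
  locSum fun ab : ℕ × ℕ =>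
    expOp ε α * zPow B α (N - ab.1 + ab.2) *
      expCoeff (creation B α) ab.1 * expCoeff (annihilation B α) ab.2

/-- The field `h(z) = ∑_m h_{(-m)} z^{m-1}`. -/
def heisField {ι : Type} [Fintype ι] [DecidableEq ι] (B : ι → ι → ℤ) (h : ι → ℂ) : Dist ι :=
  fun n => heis B h (-n - 1)

/-- The derivative `∂_z`. -/
def dz {ι : Type} (A : Dist ι) : Dist ι := fun n => ((n : ℂ) + 1) • A (n + 1)

/-- The normally ordered product `:A(z) C(z): = A(z)_{≥0} C(z) + C(z) A(z)_{<0}`. -/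
def nop {ι : Type} (A C : Dist ι) : Dist ι := fun N =>
  locSum fun t : ℤ => if 0 ≤ t then A t * C (N - t) else C (N - t) * A t

/-- The field `∏ 1/(m_1! ⋯ m_k!) :∂^{m_1} h_1(z) ⋯ ∂^{m_k} h_k(z) E^α(z):` of the basis vector
`h_1 s^{-m_1-1} ⋯ h_k s^{-m_k-1} ⊗ e^α`, all `h_i` being basis vectors of the lattice. The products
are nested from the right to the left; the order of the factors is immaterial. -/
def monomialField {ι : Type} [Fintype ι] [DecidableEq ι] (B : ι → ι → ℤ)
    (ε : (ι → ℤ) → (ι → ℤ) → ℤˣ) (α : ι → ℤ) (s : ι × ℕ →₀ ℕ) : Dist ι :=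
  (Finsupp.toMultiset s).toList.foldr
    (fun x C => nop (((x.2.factorial : ℂ)⁻¹) • dz^[x.2] (heisField B (Pi.single x.1 1))) C)
    (vertexOp B ε α)

/-- The state-field correspondence `a ↦ Y(a, z)`. -/
def stateField {ι : Type} [Fintype ι] [DecidableEq ι] (B : ι → ι → ℤ)
    (ε : (ι → ℤ) → (ι → ℤ) → ℤˣ) : StateSpace ι →ₗ[ℂ] Dist ι :=
  Finsupp.lsum ℂ fun α =>
    (MvPolynomial.basisMonomials (ι × ℕ) ℂ).constr ℂ (monomialField B ε α)

/-- The mode `a_{(m)}`, where `Y(a, z) = ∑_m a_{(m)} z^{-m-1}`. -/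
def mode {ι : Type} [Fintype ι] [DecidableEq ι] (B : ι → ι → ℤ)
    (ε : (ι → ℤ) → (ι → ℤ) → ℤˣ) (a : StateSpace ι) (m : ℤ) : Op ι :=
  stateField B ε a (-m - 1)

/-- The bi-multiplicative function with prescribed values on pairs of basis vectors. -/
def bimult {ι : Type} [Fintype ι] (c : ι → ι → ℤˣ) (α β : ι → ℤ) : ℤˣ :=
  ∏ i, ∏ j, c i j ^ (α i * β j)

/-! ## The lattice `Γ` and the operators that generate `𝔤^tor` -/

/-- Indices of the basis `v_1, …, v_ℓ, θ_1, …, θ_r, Θ_1, …, Θ_r` of `Γ`. -/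
abbrev Idx (ℓ r : ℕ) : Type := Fin ℓ ⊕ (Fin r ⊕ Fin r)

/-- The Gram matrix of `Γ`. -/
def gram (ℓ r : ℕ) : Idx ℓ r → Idx ℓ r → ℤ
  | .inl i, .inl j => if i = j then 1 else 0
  | .inr (.inl ν), .inr (.inr μ) => if ν = μ then 1 else 0
  | .inr (.inr ν), .inr (.inl μ) => if ν = μ then 1 else 0
  | _, _ => 0

/-- The sign `ε_{ij}`: `1` if `i < j`, and `-1` if `i ≥ j`. -/
def sgn {ℓ : ℕ} (i j : Fin ℓ) : ℤˣ := if i < j then 1 else -1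

/-- The values of `ε` on basis vectors of `Γ`; `c ν μ` is the value `ε(Θ_ν, θ_μ)`. -/
def signTable (ℓ r : ℕ) (c : Fin r → Fin r → ℤˣ) : Idx ℓ r → Idx ℓ r → ℤˣ
  | .inl i, .inl j => sgn i j
  | .inr (.inl ν), .inr (.inr μ) => if ν = μ then -1 else 1
  | .inr (.inr ν), .inr (.inl μ) => c ν μ
  | _, _ => 1

/-- The lattice vector `v_i`. -/
def v {ℓ : ℕ} (r : ℕ) (i : Fin ℓ) : Idx ℓ r → ℤ := Pi.single (.inl i) 1

/-- The lattice vector `θ_ν`. -/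
def theta (ℓ : ℕ) {r : ℕ} (ν : Fin r) : Idx ℓ r → ℤ := Pi.single (.inr (.inl ν)) 1

/-- The lattice vector `p · θ`. -/
def dotTheta (ℓ : ℕ) {r : ℕ} (p : Fin r → ℤ) : Idx ℓ r → ℤ := ∑ ν, p ν • theta ℓ ν

/-- The modes `a_{(m)}` of the lattice vertex algebra `V_Γ`. -/
def modeΓ (ℓ r : ℕ) (c : Fin r → Fin r → ℤˣ) (a : StateSpace (Idx ℓ r)) (m : ℤ) : Op (Idx ℓ r) :=
  mode (gram ℓ r) (bimult (signTable ℓ r c)) a m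

/-- `((v_i - v_j) s⁻¹ ⊗ e^{p·θ})_{(m)}`; for `j = i + 1` this is `h_{i,m}^p`. -/
def hMode {ℓ r : ℕ} (c : Fin r → Fin r → ℤˣ) (i j : Fin ℓ) (m : ℤ) (p : Fin r → ℤ) :
    Op (Idx ℓ r) :=
  modeΓ ℓ r c (vec (neg (cplx (v r i - v r j)) 0) (dotTheta ℓ p)) m

/-- `e_{kl,m}^p = ε_{lk} (1 ⊗ e^{v_k - v_l + p·θ})_{(m)}`, used for `k ≠ l`. -/
def eMode {ℓ r : ℕ} (c : Fin r → Fin r → ℤˣ) (k l : Fin ℓ) (m : ℤ) (p : Fin r → ℤ) :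
    Op (Idx ℓ r) :=
  (((sgn l k : ℤˣ) : ℤ) : ℂ) • modeΓ ℓ r c (vec 1 (v r k - v r l + dotTheta ℓ p)) m

/-- `κ_{0,m}^p = (1 ⊗ e^{p·θ})_{(m-1)}` and `κ_{ν,m}^p = (θ_ν s⁻¹ ⊗ e^{p·θ})_{(m)}` for
`1 ≤ ν ≤ r`. -/
def kMode (ℓ : ℕ) {r : ℕ} (c : Fin r → Fin r → ℤˣ) (ν : Fin (r + 1)) (m : ℤ) (p : Fin r → ℤ) :
    Op (Idx ℓ r) :=
  Fin.cases (modeΓ ℓ r c (vec 1 (dotTheta ℓ p)) (m - 1))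
    (fun μ => modeΓ ℓ r c (vec (neg (cplx (theta ℓ μ)) 0) (dotTheta ℓ p)) m) ν

/-- The set of all operators `h_{i,m}^p`, `e_{kl,m}^p`, `κ_{ν,m}^p`. -/
def generators (ℓ r : ℕ) (c : Fin r → Fin r → ℤˣ) : Set (Op (Idx ℓ r)) :=
  {x | ∃ (i j : Fin ℓ) (_ : (i : ℕ) + 1 = j) (m : ℤ) (p : Fin r → ℤ), x = hMode c i j m p} ∪
  {x | ∃ (k l : Fin ℓ) (_ : k ≠ l) (m : ℤ) (p : Fin r → ℤ), x = eMode c k l m p} ∪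
  {x | ∃ (ν : Fin (r + 1)) (m : ℤ) (p : Fin r → ℤ), x = kMode ℓ c ν m p}

/-- The Lie algebra `𝔤^tor` of operators on `V_Γ` (with the commutator bracket) generated by the
modes. -/
def gTor (ℓ r : ℕ) (c : Fin r → Fin r → ℤˣ) : LieSubalgebra ℂ (Op (Idx ℓ r)) :=
  LieSubalgebra.lieSpan ℂ (Op (Idx ℓ r)) (generators ℓ r c)

/-- `h_{i,m}^p` (where `j = i + 1`) as an element of `𝔤^tor`. -/
def hElt {ℓ r : ℕ} (c : Fin r → Fin r → ℤˣ) (i j : Fin ℓ) (hij : (i : ℕ) + 1 = j) (m : ℤ)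
    (p : Fin r → ℤ) : gTor ℓ r c :=
  ⟨hMode c i j m p, LieSubalgebra.subset_lieSpan (Or.inl (Or.inl ⟨i, j, hij, m, p, rfl⟩))⟩

/-- `e_{kl,m}^p` as an element of `𝔤^tor`. -/
def eElt {ℓ r : ℕ} (c : Fin r → Fin r → ℤˣ) (k l : Fin ℓ) (hkl : k ≠ l) (m : ℤ)
    (p : Fin r → ℤ) : gTor ℓ r c :=
  ⟨eMode c k l m p, LieSubalgebra.subset_lieSpan (Or.inl (Or.inr ⟨k, l, hkl, m, p, rfl⟩))⟩

/-- `κ_{ν,m}^p` as an element of `𝔤^tor`. -/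
def kElt (ℓ : ℕ) {r : ℕ} (c : Fin r → Fin r → ℤˣ) (ν : Fin (r + 1)) (m : ℤ)
    (p : Fin r → ℤ) : gTor ℓ r c :=
  ⟨kMode ℓ c ν m p, LieSubalgebra.subset_lieSpan (Or.inr ⟨ν, m, p, rfl⟩)⟩

/-! ## Toroidal Lie algebras -/

/-- A Lie algebra together with a symmetric invariant bilinear form. -/
structure InvariantForm (g : Type) [LieRing g] [LieAlgebra ℂ g] where
  /-- The bilinear form. -/
  toForm : LinearMap.BilinForm ℂ g
  symm : ∀ x y, toForm x y = toForm y x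
  invariant : ∀ x y z, toForm ⁅x, y⁆ z = toForm x ⁅y, z⁆

/-- The Laurent polynomials `ℂ[t_0^{±1}, …, t_r^{±1}]`; `t^m` is `AddMonoidAlgebra.single m 1`. -/
abbrev Laurent (r : ℕ) : Type := AddMonoidAlgebra ℂ (Fin (r + 1) → ℤ)

/-- The monomial `t^m = t_0^{m_0} ⋯ t_r^{m_r}`. -/
def tPow {r : ℕ} (m : Fin (r + 1) → ℤ) : Laurent r := AddMonoidAlgebra.single m 1

/-- The subspace of `⨁_ν R K_ν` spanned by the elements `∑_ν m_ν t^m K_ν`. -/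
def relations (r : ℕ) : Submodule ℂ (Fin (r + 1) → Laurent r) :=
  Submodule.span ℂ (Set.range fun m : Fin (r + 1) → ℤ => fun ν => (m ν : ℂ) • tPow m)

/-- The space `𝒦 = (⨁_ν R K_ν) / span {∑_ν m_ν t^m K_ν}`. -/
abbrev Centre (r : ℕ) : Type := (Fin (r + 1) → Laurent r) ⧸ relations r

/-- The class of `t^m K_ν` in `𝒦`. -/
def kClass {r : ℕ} (ν : Fin (r + 1)) (m : Fin (r + 1) → ℤ) : Centre r :=
  (relations r).mkQ (Pi.single ν (tPow m))

/-- The linear map `R → ⨁_ν R K_ν`, `t^m ↦ ∑_ν m_ν t^m K_ν`. -/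
def euler (r : ℕ) : Laurent r →ₗ[ℂ] (Fin (r + 1) → Laurent r) :=
  (AddMonoidAlgebra.basis (Fin (r + 1) → ℤ) ℂ).constr ℂ fun m => fun ν => (m ν : ℂ) • tPow m

/-- The bilinear map `R × R → 𝒦` with `(t^m, t^n) ↦ ∑_ν m_ν [t^{m+n} K_ν]`. -/
def omega (r : ℕ) : Laurent r →ₗ[ℂ] Laurent r →ₗ[ℂ] Centre r :=
  LinearMap.mk₂ ℂ (fun a b => (relations r).mkQ fun ν => euler r a ν * b)
    (fun a a' b => by
      rw [← map_add]; congr 1; funext ν; simp [add_mul])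
    (fun s a b => by
      rw [← map_smul]; congr 1; funext ν; simp)
    (fun a b b' => by
      rw [← map_add]; congr 1; funext ν; simp [mul_add])
    (fun s a b => by
      rw [← map_smul]; congr 1; funext ν; simp)

lemma mk_euler {r : ℕ} (f : Laurent r) : (relations r).mkQ (euler r f) = 0 := by
  have h : (relations r).mkQ ∘ₗ euler r = 0 := by
    refine (AddMonoidAlgebra.basis (Fin (r + 1) → ℤ) ℂ).ext fun m => ?_
    simp only [LinearMap.comp_apply, euler, Module.Basis.constr_basis, LinearMap.zero_apply,
      Submodule.mkQ_apply, Submodule.Quotient.mk_eq_zero]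
    exact Submodule.subset_span ⟨m, rfl⟩
  exact LinearMap.congr_fun h f

lemma euler_tPow {r : ℕ} (m : Fin (r + 1) → ℤ) :
    euler r (tPow m) = fun ν => (m ν : ℂ) • tPow m := by
  have := (AddMonoidAlgebra.basis (Fin (r + 1) → ℤ) ℂ).constr_basis ℂ
    (fun m => fun ν => (m ν : ℂ) • tPow m : (Fin (r + 1) → ℤ) → (Fin (r + 1) → Laurent r)) m
  simpa [euler, tPow] using this

lemma tPow_mul {r : ℕ} (m n : Fin (r + 1) → ℤ) : tPow m * tPow n = tPow (m + n) := by
  simp [tPow, AddMonoidAlgebra.single_mul_single]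

/-- The value of `omega` on monomials, as in the definition of the bracket. -/
lemma omega_tPow {r : ℕ} (m n : Fin (r + 1) → ℤ) :
    omega r (tPow m) (tPow n) = ∑ ν, (m ν : ℂ) • kClass ν (m + n) := by
  simp only [omega, LinearMap.mk₂_apply, kClass, ← map_smul, ← map_sum, euler_tPow]
  congr 1
  funext μ
  simp [Finset.sum_apply, Pi.single_apply, tPow_mul]

lemma euler_mul {r : ℕ} (a b : Laurent r) (ν : Fin (r + 1)) :
    euler r (a * b) ν = euler r a ν * b + euler r b ν * a := by
  have key : ∀ m n : Fin (r + 1) → ℤ, euler r (tPow m * tPow n) ν =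
      euler r (tPow m) ν * tPow n + euler r (tPow n) ν * tPow m := by
    intro m n
    rw [tPow_mul, euler_tPow, euler_tPow, euler_tPow]
    simp only [smul_mul_assoc, tPow_mul, add_comm n m, Pi.add_apply, Int.cast_add, add_smul]
  have hs : ∀ (m : Fin (r + 1) → ℤ) (s : ℂ), AddMonoidAlgebra.single m s = s • tPow m := by
    intro m s; simp [tPow]
  induction a using AddMonoidAlgebra.induction_linear with
  | zero => simp
  | add f g hf hg => simp only [add_mul, map_add, Pi.add_apply, hf, hg, mul_add]; ring
  | single m s =>
    induction b using AddMonoidAlgebra.induction_linear with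
    | zero => simp
    | add f g hf hg => simp only [add_mul, map_add, Pi.add_apply, hf, hg, mul_add]; ring
    | single n u =>
      rw [hs, hs]
      simp only [smul_mul_assoc, mul_smul_comm, map_smul, Pi.smul_apply, key, smul_add]
      rw [smul_comm u s (euler r (tPow n) ν * tPow m)]

lemma omega_antisymm {r : ℕ} (a b : Laurent r) : omega r a b + omega r b a = 0 := by
  simp only [omega, LinearMap.mk₂_apply, ← map_add]
  rw [← mk_euler (a * b)]
  congr 1
  funext ν
  simp [euler_mul]

lemma omega_cyclic {r : ℕ} (a b d : Laurent r) :
    omega r (a * b) d + omega r (b * d) a + omega r (d * a) b = 0 := by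
  simp only [omega, LinearMap.mk₂_apply, ← map_add]
  have h : (relations r).mkQ ((2 : ℂ) • euler r (a * b * d)) = 0 := by
    rw [map_smul, mk_euler, smul_zero]
  rw [← h]
  congr 1
  funext ν
  simp only [Pi.add_apply, Pi.smul_apply, euler_mul, two_smul]
  ring

/-- The bilinear map on `R ⊗ g` with `(a ⊗ X, b ⊗ Y) ↦ (X|Y) omega (a, b)`. -/
def cocycle {g : Type} [LieRing g] [LieAlgebra ℂ g] (φ : InvariantForm g) (r : ℕ) :
    (Laurent r ⊗[ℂ] g) →ₗ[ℂ] (Laurent r ⊗[ℂ] g) →ₗ[ℂ] Centre r :=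
  (LinearMap.BilinMap.tensorDistrib ℂ ℂ (omega r ⊗ₜ[ℂ] φ.toForm)).compr₂
    (TensorProduct.rid ℂ (Centre r)).toLinearMap

@[simp]
lemma cocycle_tmul {g : Type} [LieRing g] [LieAlgebra ℂ g] (φ : InvariantForm g) (r : ℕ)
    (a b : Laurent r) (X Y : g) :
    cocycle φ r (a ⊗ₜ X) (b ⊗ₜ Y) = φ.toForm X Y • omega r a b := by
  simp [cocycle]

lemma cocycle_antisymm {g : Type} [LieRing g] [LieAlgebra ℂ g] (φ : InvariantForm g) (r : ℕ)
    (x y : Laurent r ⊗[ℂ] g) : cocycle φ r x y + cocycle φ r y x = 0 := by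
  induction x using TensorProduct.induction_on with
  | zero => simp
  | add x x' hx hx' =>
    simp only [map_add, LinearMap.add_apply]
    rw [add_add_add_comm, hx, hx', add_zero]
  | tmul a X =>
    induction y using TensorProduct.induction_on with
    | zero => simp
    | add y y' hy hy' =>
      simp only [map_add, LinearMap.add_apply]
      rw [add_add_add_comm, hy, hy', add_zero]
    | tmul b Y =>
      rw [cocycle_tmul, cocycle_tmul, φ.symm Y X, ← smul_add, omega_antisymm, smul_zero]

lemma cocycle_self {g : Type} [LieRing g] [LieAlgebra ℂ g] (φ : InvariantForm g) (r : ℕ)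
    (x : Laurent r ⊗[ℂ] g) : cocycle φ r x x = 0 := by
  have h := cocycle_antisymm φ r x x
  rw [← two_smul ℂ] at h
  exact (smul_eq_zero.mp h).resolve_left two_ne_zero

section Loop

variable {g : Type} [LieRing g] [LieAlgebra ℂ g] {r : ℕ}

lemma loop_add_lie (x y z : Laurent r ⊗[ℂ] g) : ⁅x + y, z⁆ = ⁅x, z⁆ + ⁅y, z⁆ :=
  LieRing.add_lie x y z

lemma loop_lie_add (x y z : Laurent r ⊗[ℂ] g) : ⁅x, y + z⁆ = ⁅x, y⁆ + ⁅x, z⁆ :=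
  LieRing.lie_add x y z

lemma loop_lie_self (x : Laurent r ⊗[ℂ] g) : ⁅x, x⁆ = 0 :=
  LieRing.lie_self x

lemma loop_lie_smul (s : ℂ) (x y : Laurent r ⊗[ℂ] g) : ⁅x, s • y⁆ = s • ⁅x, y⁆ :=
  LieAlgebra.lie_smul s x y

lemma loop_leibniz (x y z : Laurent r ⊗[ℂ] g) : ⁅x, ⁅y, z⁆⁆ = ⁅⁅x, y⁆, z⁆ + ⁅y, ⁅x, z⁆⁆ :=
  LieRing.leibniz_lie x y z

lemma loop_zero_lie (x : Laurent r ⊗[ℂ] g) : ⁅(0 : Laurent r ⊗[ℂ] g), x⁆ = 0 := by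
  simpa using loop_add_lie 0 0 x

lemma loop_lie_zero (x : Laurent r ⊗[ℂ] g) : ⁅x, (0 : Laurent r ⊗[ℂ] g)⁆ = 0 := by
  simpa using loop_lie_add x 0 0

end Loop

lemma cocycle_jacobi {g : Type} [LieRing g] [LieAlgebra ℂ g] (φ : InvariantForm g) (r : ℕ)
    (x y z : Laurent r ⊗[ℂ] g) :
    cocycle φ r x ⁅y, z⁆ = cocycle φ r ⁅x, y⁆ z + cocycle φ r y ⁅x, z⁆ := by
  induction x using TensorProduct.induction_on with
  | zero => simp [loop_zero_lie]
  | add x x' hx hx' =>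
    simp only [map_add, LinearMap.add_apply, loop_add_lie, hx, hx']
    abel
  | tmul a X =>
    induction y using TensorProduct.induction_on with
    | zero => simp [loop_zero_lie, loop_lie_zero]
    | add y y' hy hy' =>
      simp only [map_add, LinearMap.add_apply, loop_add_lie, loop_lie_add, hy, hy']
      abel
    | tmul b Y =>
      induction z using TensorProduct.induction_on with
      | zero => simp [loop_lie_zero]
      | add z z' hz hz' =>
        simp only [map_add, loop_lie_add, hz, hz']
        abel
      | tmul d Z =>
        simp only [LieAlgebra.ExtendScalars.bracket_tmul, cocycle_tmul]
        have h1 : φ.toForm X ⁅Y, Z⁆ = φ.toForm ⁅X, Y⁆ Z := (φ.invariant X Y Z).symm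
        have h2 : φ.toForm Y ⁅X, Z⁆ = -φ.toForm ⁅X, Y⁆ Z := by
          rw [← φ.invariant, ← lie_skew, map_neg, LinearMap.neg_apply]
        have e1 : omega r a (b * d) = -omega r (b * d) a :=
          eq_neg_of_add_eq_zero_left (omega_antisymm _ _)
        have e2 : omega r b (a * d) = -omega r (d * a) b := by
          rw [mul_comm a d]; exact eq_neg_of_add_eq_zero_left (omega_antisymm _ _)
        have e3 : omega r (a * b) d = -(omega r (b * d) a + omega r (d * a) b) :=
          eq_neg_of_add_eq_zero_left (by rw [← add_assoc]; exact omega_cyclic a b d)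
        rw [h1, h2, e1, e2, e3]
        module

/-- The toroidal Lie algebra `(g ⊗ R) ⊕ 𝒦` with `r + 1` parameters attached to a Lie algebra `g`
with an invariant form. The tensor product is written with the factor `R` on the left. -/
@[ext]
structure Toroidal {g : Type} [LieRing g] [LieAlgebra ℂ g] (φ : InvariantForm g) (r : ℕ) where
  /-- The component in `g ⊗ R`. -/
  loop : Laurent r ⊗[ℂ] g
  /-- The component in `𝒦`. -/
  centre : Centre r

namespace Toroidal

variable {g : Type} [LieRing g] [LieAlgebra ℂ g] {φ : InvariantForm g} {r : ℕ}

/-- The underlying space as a direct sum. -/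
def equivProd (φ : InvariantForm g) (r : ℕ) :
    Toroidal φ r ≃ (Laurent r ⊗[ℂ] g) × Centre r where
  toFun x := (x.loop, x.centre)
  invFun x := ⟨x.1, x.2⟩
  left_inv _ := rfl
  right_inv _ := rfl

instance : AddCommGroup (Toroidal φ r) := (equivProd φ r).addCommGroup

instance : Module ℂ (Toroidal φ r) := (equivProd φ r).module ℂ

@[simp] lemma loop_zero : (0 : Toroidal φ r).loop = 0 := rfl
@[simp] lemma centre_zero : (0 : Toroidal φ r).centre = 0 := rfl
@[simp] lemma loop_add (x y : Toroidal φ r) : (x + y).loop = x.loop + y.loop := rfl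
@[simp] lemma centre_add (x y : Toroidal φ r) : (x + y).centre = x.centre + y.centre := rfl
@[simp] lemma loop_smul (s : ℂ) (x : Toroidal φ r) : (s • x).loop = s • x.loop := rfl
@[simp] lemma centre_smul (s : ℂ) (x : Toroidal φ r) : (s • x).centre = s • x.centre := rfl

/-- The bracket: `𝒦` is central, and
`[X ⊗ t^m, Y ⊗ t^n] = [X, Y] ⊗ t^{m+n} + (X|Y) ∑_ν m_ν [t^{m+n} K_ν]`. -/
instance : Bracket (Toroidal φ r) (Toroidal φ r) where
  bracket x y := ⟨⁅x.loop, y.loop⁆, cocycle φ r x.loop y.loop⟩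

@[simp] lemma loop_lie (x y : Toroidal φ r) : ⁅x, y⁆.loop = ⁅x.loop, y.loop⁆ := rfl
@[simp] lemma centre_lie (x y : Toroidal φ r) :
    ⁅x, y⁆.centre = cocycle φ r x.loop y.loop := rfl

instance : LieRing (Toroidal φ r) where
  add_lie x y z := by ext1 <;> simp [loop_add_lie]
  lie_add x y z := by ext1 <;> simp [loop_lie_add]
  lie_self x := by ext1 <;> simp [cocycle_self]
  leibniz_lie x y z := by
    ext1
    · simpa using loop_leibniz x.loop y.loop z.loop
    · simpa using cocycle_jacobi φ r x.loop y.loop z.loop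

instance : LieAlgebra ℂ (Toroidal φ r) where
  lie_smul s x y := by ext1 <;> simp [loop_lie_smul]

/-- The element `X ⊗ t^m`. -/
def ofLoop (φ : InvariantForm g) {r : ℕ} (X : g) (m : Fin (r + 1) → ℤ) : Toroidal φ r :=
  ⟨tPow m ⊗ₜ[ℂ] X, 0⟩

/-- The class of `t^m K_ν`. -/
def ofCentre (φ : InvariantForm g) {r : ℕ} (ν : Fin (r + 1)) (m : Fin (r + 1) → ℤ) :
    Toroidal φ r :=
  ⟨0, kClass ν m⟩

/-- The projection to the loop component. -/
def loopHom (φ : InvariantForm g) (r : ℕ) : Toroidal φ r →ₗ[ℂ] Laurent r ⊗[ℂ] g where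
  toFun := loop
  map_add' := loop_add
  map_smul' := loop_smul

/-- The projection to the central component. -/
def centreHom (φ : InvariantForm g) (r : ℕ) : Toroidal φ r →ₗ[ℂ] Centre r where
  toFun := centre
  map_add' := centre_add
  map_smul' := centre_smul

/-- The defining formula of the bracket. -/
lemma lie_ofLoop (X Y : g) (m n : Fin (r + 1) → ℤ) :
    ⁅ofLoop φ X m, ofLoop φ Y n⁆ =
      ofLoop φ ⁅X, Y⁆ (m + n) + φ.toForm X Y • ∑ ν, (m ν : ℂ) • ofCentre φ ν (m + n) := by
  have hl : (∑ ν, (m ν : ℂ) • ofCentre φ ν (m + n)).loop = 0 := by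
    change loopHom φ r _ = 0
    rw [map_sum]
    exact Finset.sum_eq_zero fun ν _ => smul_zero _
  have hc : (∑ ν, (m ν : ℂ) • ofCentre φ ν (m + n)).centre =
      ∑ ν, (m ν : ℂ) • kClass ν (m + n) := by
    change centreHom φ r _ = _
    rw [map_sum]
    rfl
  ext1
  · rw [loop_add, loop_smul, hl]
    simp [ofLoop, tPow_mul]
  · rw [centre_add, centre_smul, hc]
    simp [ofLoop, omega_tPow]

/-- `𝒦` is central. -/
lemma lie_ofCentre (x : Toroidal φ r) (ν : Fin (r + 1)) (m : Fin (r + 1) → ℤ) :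
    ⁅x, ofCentre φ ν m⁆ = 0 := by
  ext1 <;> simp [ofCentre, loop_lie_zero]

end Toroidal

/-- The Lie algebra `sl_ℓ` with the trace form `(X|Y) = tr(XY)`. -/
def slForm (ℓ : ℕ) : InvariantForm (LieAlgebra.SpecialLinear.sl (Fin ℓ) ℂ) where
  toForm := LinearMap.mk₂ ℂ (fun X Y => Matrix.trace (X.val * Y.val))
    (by intro X Y Z; simp [add_mul]) (by intro s X Y; simp)
    (by intro X Y Z; simp [mul_add]) (by intro s X Y; simp)
  symm X Y := by simp [Matrix.trace_mul_comm X.val Y.val]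
  invariant X Y Z := by
    simp only [LinearMap.mk₂_apply, LieAlgebra.SpecialLinear.sl_bracket, sub_mul, mul_sub,
      Matrix.trace_sub, mul_assoc]
    rw [← mul_assoc X.val Z.val, Matrix.trace_mul_comm (X.val * Z.val) Y.val]

end

end ToroidalRealization

/-!
The isomorphism is constructed in the opposite direction, as a representation `toroidalRep` of the
toroidal Lie algebra on the state space that sends `E_{kl} ⊗ t^M` and `t^M K_ν` to the operators
`unitOp` and `centreOp`. For this representation it has to be shown that it is well defined, that
it respects brackets, that its image is `𝔤^tor` and that it is injective.

The first two points come down to relations between coefficients of the fields `E^α(z)` and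
`:h(z) E^α(z):` (`vertexOp` and `current`). They are not derived from the operator product
expansion, but from a uniqueness principle. The form is nondegenerate, so a vector killed by all
`h_{(k)}`, `k > 0`, and without vacuum component is zero, and the state space is generated from
the vectors `e^γ` by the `h_{(k)}`. Hence a doubly indexed family of operators is determined by
its commutators with all `h_{(k)}`, provided these lead back to the same family, and by its vacuum
expectations `⟨e^γ', A e^γ⟩` (`family_ext`). The commutators of the two fields with `h_{(k)}` are
`heis_vertexOp` and `heis_current`.

The principle gives `∂_z E^α(z) = :α(z) E^α(z):` (`deriv_vertexOp`). For `α = p·θ` these are the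
relations that define `𝒦` (`sum_centreOp_self`). For general `α` the equation is the differential
equation that determines the two-point functions: `⟨e^γ', E^α(z) E^β(w) e^γ⟩` is a multiple of the
expansion of `(z - w)^{(α|β)}` in powers of `w / z` (`two_point`). Exchanging the factors produces
the expansion in powers of `z / w`, and the difference of the two is zero for `(α|β) ≥ 0`, a delta
function for `(α|β) = -1` and a derivative of a delta function for `(α|β) = -2`. All pairs of
roots `v_k - v_l + p·θ` are covered by `-2 ≤ (α|β) ≤ 2`, and the signs `ε` are those for which the
result is the bracket of matrix units (`unitOp_comm`). In the case `(α|β) = -2`, and for two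
currents, the derivative of the delta function contributes the cocycle `∑_ν M_ν t^{M+N} K_ν`.

The image is `𝔤^tor` because `sl_ℓ` is spanned by the matrices `E_{kl}`, `k ≠ l`, and
`E_{ii} - E_{i+1,i+1}` (`range_toroidalRep`).

For injectivity, suppose that `∑_M (X_M ⊗ t^M + ∑_ν a_{M,ν} t^M K_ν)` acts by zero. The
off-diagonal entries of the `X_M` are, up to sign, matrix coefficients between vacuum vectors. The
remaining coefficients at `t^M` enter matrix coefficients between `e^γ` and `e^{p·θ+γ}`, where
`M = (m, p)`, of the operator itself (if `m = -(p·θ|γ)`) and of its commutators with `h_{(k)}` for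
`k = -m - (p·θ|γ)`. With `h = v_i` these show that the diagonal entries of `X_M` vanish, and with
`h = Θ_μ` that the vector `(a_{M,ν})_ν` is proportional to `M`, which makes `∑_ν a_{M,ν} t^M K_ν`
zero in `𝒦` (`centre_proportional`).
-/

namespace ToroidalRealization

noncomputable section

/-! ### The bilinear form -/

section Form

variable {ι : Type} [Fintype ι] (B : ι → ι → ℤ)

lemma form_add_left (h h' k : ι → ℂ) : form B (h + h') k = form B h k + form B h' k := by
  simp [form, mul_add, add_mul, Finset.sum_add_distrib]

lemma form_add_right (h k k' : ι → ℂ) : form B h (k + k') = form B h k + form B h k' := by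
  simp [form, mul_add, Finset.sum_add_distrib]

lemma form_smul_left (s : ℂ) (h k : ι → ℂ) : form B (s • h) k = s * form B h k := by
  simp only [form, Finset.mul_sum, Pi.smul_apply, smul_eq_mul]
  exact Finset.sum_congr rfl fun i _ => Finset.sum_congr rfl fun j _ => by ring

lemma form_smul_right (s : ℂ) (h k : ι → ℂ) : form B h (s • k) = s * form B h k := by
  simp only [form, Finset.mul_sum, Pi.smul_apply, smul_eq_mul]
  exact Finset.sum_congr rfl fun i _ => Finset.sum_congr rfl fun j _ => by ring

/-- The form as a bilinear map. -/
def formₗ : (ι → ℂ) →ₗ[ℂ] (ι → ℂ) →ₗ[ℂ] ℂ :=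
  LinearMap.mk₂ ℂ (form B) (form_add_left B) (form_smul_left B) (form_add_right B)
    (form_smul_right B)

lemma formₗ_apply (h k : ι → ℂ) : formₗ B h k = form B h k := rfl

lemma form_eq_sum_right [DecidableEq ι] (h k : ι → ℂ) :
    form B h k = ∑ i, k i * form B h (Pi.single i 1) := by
  conv_lhs => rw [pi_eq_sum_univ' k, ← formₗ_apply, map_sum]
  exact Finset.sum_congr rfl fun i _ => by
    rw [formₗ_apply, ← form_smul_right]

variable {B} in
lemma form_comm (hB : ∀ i j, B i j = B j i) (h k : ι → ℂ) : form B h k = form B k h := by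
  unfold form
  rw [Finset.sum_comm]
  exact Finset.sum_congr rfl fun i _ => Finset.sum_congr rfl fun j _ => by rw [hB]; ring

lemma form_cplx (α β : ι → ℤ) : form B (cplx α) (cplx β) = (latForm B α β : ℂ) := by
  simp [form, latForm, cplx]

lemma cplx_add {ι : Type} (α β : ι → ℤ) : cplx (α + β) = cplx α + cplx β := by
  ext; simp [cplx]

lemma cplx_sub {ι : Type} (α β : ι → ℤ) : cplx (α - β) = cplx α - cplx β := by
  ext; simp [cplx]

lemma latForm_add_left (α α' β : ι → ℤ) :
    latForm B (α + α') β = latForm B α β + latForm B α' β := by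
  simp [latForm, mul_add, add_mul, Finset.sum_add_distrib]

lemma latForm_add_right (α β β' : ι → ℤ) :
    latForm B α (β + β') = latForm B α β + latForm B α β' := by
  simp [latForm, mul_add, Finset.sum_add_distrib]

variable {B} in
lemma latForm_comm (hB : ∀ i j, B i j = B j i) (α β : ι → ℤ) :
    latForm B α β = latForm B β α := by
  unfold latForm
  rw [Finset.sum_comm]
  exact Finset.sum_congr rfl fun i _ => Finset.sum_congr rfl fun j _ => by rw [hB]; ring

end Form

/-! ### The Heisenberg algebra -/

/-- Operators on the state space agree if they agree on the vectors `g ⊗ e^β`. -/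
lemma op_ext {ι : Type} {A A' : Op ι} (H : ∀ g β, A (vec g β) = A' (vec g β)) : A = A' :=
  Finsupp.lhom_ext fun β g => H g β

section Heisenberg

variable {ι : Type} [Fintype ι] [DecidableEq ι] (B : ι → ι → ℤ)

/-- The derivation `h_{(n+1)}` of the symmetric algebra. -/
def annDer (h : ι → ℂ) (n : ℕ) : Fock ι →ₗ[ℂ] Fock ι :=
  ∑ i, (((n : ℂ) + 1) * form B h (Pi.single i 1)) •
        (MvPolynomial.pderiv (R := ℂ) (i, n)).toLinearMap

lemma annDer_apply (h : ι → ℂ) (n : ℕ) (g : Fock ι) : annDer B h n g =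
    ∑ i, (((n : ℂ) + 1) * form B h (Pi.single i 1)) • MvPolynomial.pderiv (i, n) g := by
  simp [annDer, LinearMap.sum_apply]

lemma heis_neg (h : ι → ℂ) (n : ℕ) (g : Fock ι) (β : ι → ℤ) :
    heis B h (-(n + 1 : ℤ)) (vec g β) = vec (neg h n * g) β := by
  rw [← Int.negSucc_eq]
  simp [heis, vec]

lemma heis_zero (h : ι → ℂ) (g : Fock ι) (β : ι → ℤ) :
    heis B h 0 (vec g β) = form B h (cplx β) • vec g β := by
  change heis B h (Int.ofNat 0) _ = _
  simp [heis, vec]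

lemma heis_pos (h : ι → ℂ) (n : ℕ) (g : Fock ι) (β : ι → ℤ) :
    heis B h ((n : ℤ) + 1) (vec g β) = vec (annDer B h n g) β := by
  change heis B h (Int.ofNat (n + 1)) _ = _
  simp [heis, vec, annDer]

lemma annDer_mul (h : ι → ℂ) (n : ℕ) (f g : Fock ι) :
    annDer B h n (f * g) = annDer B h n f * g + f * annDer B h n g := by
  simp only [annDer_apply, MvPolynomial.pderiv_mul, Finset.sum_mul, Finset.mul_sum, smul_add,
    Finset.sum_add_distrib, smul_mul_assoc, mul_smul_comm]

lemma annDer_neg (h h' : ι → ℂ) (n m : ℕ) :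
    annDer B h n (neg h' m) =
      if n = m then MvPolynomial.C (((n : ℂ) + 1) * form B h h') else 0 := by
  have key : ∀ i, MvPolynomial.pderiv (i, n) (neg h' m) =
      if n = m then MvPolynomial.C (h' i) else 0 := by
    intro i
    simp only [neg, map_sum, MvPolynomial.pderiv_C_mul, MvPolynomial.pderiv_X, Pi.single_apply,
      Prod.mk.injEq]
    by_cases h : n = m
    · subst h; simp
    · simp [h, Ne.symm h]
  simp only [annDer_apply, key]
  split_ifs with hnm
  · rw [form_eq_sum_right, Finset.mul_sum, map_sum]
    exact Finset.sum_congr rfl fun i _ => by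
      rw [MvPolynomial.smul_eq_C_mul, ← map_mul]; congr 1; ring
  · simp

lemma pderiv_comm {σ : Type} (i j : σ) (p : MvPolynomial σ ℂ) :
    MvPolynomial.pderiv i (MvPolynomial.pderiv j p) =
      MvPolynomial.pderiv j (MvPolynomial.pderiv i p) := by
  classical
  ext m
  simp only [MvPolynomial.coeff_pderiv, Finsupp.add_apply, Finsupp.single_apply]
  rw [add_right_comm]
  by_cases h : i = j
  · subst h; ring
  · simp [h, Ne.symm h]; ring

lemma annDer_comm (h h' : ι → ℂ) (n m : ℕ) (g : Fock ι) :
    annDer B h n (annDer B h' m g) = annDer B h' m (annDer B h n g) := by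
  simp only [annDer_apply, map_sum, Derivation.map_smul]
  rw [Finset.sum_comm]
  exact Finset.sum_congr rfl fun i _ => Finset.sum_congr rfl fun j _ => by
    rw [smul_comm, pderiv_comm]

lemma int_trichotomy (k : ℤ) : (∃ n : ℕ, k = -(n + 1 : ℤ)) ∨ k = 0 ∨ ∃ n : ℕ, k = (n : ℤ) + 1 := by
  rcases lt_trichotomy k 0 with h | h | h
  · exact Or.inl ⟨(-k - 1).toNat, by omega⟩
  · exact Or.inr (Or.inl h)
  · exact Or.inr (Or.inr ⟨(k - 1).toNat, by omega⟩)

/-- The commutation relations of the Heisenberg algebra. -/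
lemma heis_comm (hB : ∀ i j, B i j = B j i) (h h' : ι → ℂ) (j k : ℤ) (u : StateSpace ι) :
    heis B h j (heis B h' k u) = heis B h' k (heis B h j u) +
      (if j + k = 0 then (j : ℂ) * form B h h' else 0) • u := by
  rw [← sub_eq_iff_eq_add']
  suffices H : heis B h j * heis B h' k - heis B h' k * heis B h j =
      (if j + k = 0 then (j : ℂ) * form B h h' else 0) • 1 from LinearMap.congr_fun H u
  refine op_ext fun g β => ?_
  simp only [LinearMap.sub_apply, Module.End.mul_apply, LinearMap.smul_apply, Module.End.one_apply]
  rcases int_trichotomy j with ⟨n, rfl⟩ | rfl | ⟨n, rfl⟩ <;>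
  rcases int_trichotomy k with ⟨m, rfl⟩ | rfl | ⟨m, rfl⟩
  · simp only [heis_neg]
    rw [if_neg (by omega), mul_left_comm, sub_self, zero_smul]
  · simp only [heis_neg, heis_zero, map_smul]
    rw [if_neg (by omega)]; simp
  · simp only [heis_neg, heis_pos, annDer_mul, annDer_neg]
    by_cases hnm : m = n
    · subst hnm
      rw [if_pos rfl, if_pos (by omega), form_comm hB h' h, ← Finsupp.single_sub]
      simp only [vec, Finsupp.smul_single, MvPolynomial.smul_eq_C_mul, Int.cast_neg, Int.cast_add,
        Int.cast_natCast, Int.cast_one]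
      congr 1
      simp only [map_mul, map_neg]
      ring
    · rw [if_neg hnm, if_neg (by omega)]; simp
  · simp only [heis_neg, heis_zero, map_smul]
    rw [if_neg (by omega)]; simp
  · simp only [heis_zero, map_smul, smul_comm (form B h (cplx β))]; simp
  · simp only [heis_pos, heis_zero, map_smul]
    rw [if_neg (by omega)]; simp
  · simp only [heis_neg, heis_pos, annDer_mul, annDer_neg]
    by_cases hnm : n = m
    · subst hnm
      rw [if_pos rfl, if_pos (by omega), ← Finsupp.single_sub]
      simp only [vec, Finsupp.smul_single, MvPolynomial.smul_eq_C_mul, Int.cast_add,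
        Int.cast_natCast, Int.cast_one]
      congr 1
      ring
    · rw [if_neg hnm, if_neg (by omega)]; simp
  · simp only [heis_pos, heis_zero, map_smul]
    rw [if_neg (by omega)]; simp
  · simp only [heis_pos]
    rw [if_neg (by omega), annDer_comm, sub_self, zero_smul]

lemma heis_add (h h' : ι → ℂ) (k : ℤ) : heis B (h + h') k = heis B h k + heis B h' k := by
  refine op_ext fun g β => ?_
  rw [LinearMap.add_apply]
  rcases int_trichotomy k with ⟨n, rfl⟩ | rfl | ⟨n, rfl⟩
  · simp only [heis_neg, ← Finsupp.single_add]
    simp [neg, add_mul, Finset.sum_add_distrib]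
  · simp [heis_zero, form_add_left, add_smul]
  · simp only [heis_pos, ← Finsupp.single_add]
    simp [annDer_apply, form_add_left, mul_add, add_smul, Finset.sum_add_distrib]

lemma heis_smul (s : ℂ) (h : ι → ℂ) (k : ℤ) : heis B (s • h) k = s • heis B h k := by
  refine op_ext fun g β => ?_
  rw [LinearMap.smul_apply]
  rcases int_trichotomy k with ⟨n, rfl⟩ | rfl | ⟨n, rfl⟩
  · simp only [heis_neg, Finsupp.smul_single]
    simp [neg, Finset.smul_sum, MvPolynomial.smul_eq_C_mul, mul_assoc, Finset.sum_mul]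
  · simp [heis_zero, form_smul_left, mul_smul]
  · simp only [heis_pos, Finsupp.smul_single]
    simp [annDer_apply, form_smul_left, Finset.smul_sum, smul_smul, mul_left_comm]

/-- `h_{(k)}` as a linear function of `h`. -/
def heisₗ (k : ℤ) : (ι → ℂ) →ₗ[ℂ] Op ι where
  toFun h := heis B h k
  map_add' h h' := heis_add B h h' k
  map_smul' s h := heis_smul B s h k

lemma heis_eq_sum (h : ι → ℂ) (k : ℤ) :
    heis B h k = ∑ i, h i • heis B (Pi.single i 1) k := by
  conv_lhs => rw [pi_eq_sum_univ' h]
  change heisₗ B k _ = _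
  rw [map_sum]
  exact Finset.sum_congr rfl fun i _ => by
    rw [← heis_smul]; rfl

lemma heis_pos_vacuum (h : ι → ℂ) {k : ℤ} (hk : 0 < k) (β : ι → ℤ) :
    heis B h k (vec 1 β) = 0 := by
  obtain ⟨n, rfl⟩ : ∃ n : ℕ, k = (n : ℤ) + 1 := ⟨(k - 1).toNat, by omega⟩
  simp [heis_pos, annDer_apply]

/-- The state space is generated from the vectors `e^β` by the operators `h_{(-n)}`, `n > 0`. -/
lemma state_induction {P : StateSpace ι → Prop} (zero : P 0)
    (add : ∀ u w, P u → P w → P (u + w)) (smul : ∀ (s : ℂ) u, P u → P (s • u))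
    (vacuum : ∀ β, P (vec 1 β))
    (create : ∀ i (k : ℤ) u, k < 0 → P u → P (heis B (Pi.single i 1) k u)) : ∀ u, P u := by
  have key : ∀ g β, P (vec g β) := by
    intro g β
    induction g using MvPolynomial.induction_on with
    | C a =>
      have := smul a _ (vacuum β)
      rwa [Finsupp.smul_single, MvPolynomial.smul_eq_C_mul, mul_one] at this
    | add f g hf hg => rw [vec, Finsupp.single_add]; exact add _ _ hf hg
    | mul_X f x hf =>
      have := create x.1 (-(x.2 + 1 : ℤ)) _ (by omega) hf
      rw [heis_neg] at this
      have e : neg (Pi.single x.1 (1 : ℂ)) x.2 = MvPolynomial.X (R := ℂ) x := by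
        simp [neg, Pi.single_apply, apply_ite MvPolynomial.C, ite_mul]
      rwa [e, mul_comm] at this
  intro u
  induction u using Finsupp.induction_linear with
  | zero => exact zero
  | add u w hu hw => exact add u w hu hw
  | single β g => exact key g β

/-- Every vector is annihilated by `h_{(k)}` for all large `k`. -/
lemma heis_eventually_zero (hB : ∀ i j, B i j = B j i) (h : ι → ℂ) (u : StateSpace ι) :
    ∃ K : ℕ, ∀ k : ℤ, K ≤ k → heis B h k u = 0 := by
  refine state_induction B (P := fun u => ∃ K : ℕ, ∀ k : ℤ, K ≤ k → heis B h k u = 0)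
    ⟨0, by simp⟩ ?_ ?_ ?_ ?_ u
  · rintro u w ⟨K, hK⟩ ⟨L, hL⟩
    exact ⟨max K L, fun k hk => by
      rw [map_add, hK k (by omega), hL k (by omega), add_zero]⟩
  · rintro s u ⟨K, hK⟩
    exact ⟨K, fun k hk => by rw [map_smul, hK k hk, smul_zero]⟩
  · exact fun β => ⟨1, fun k hk => heis_pos_vacuum B h (by omega) β⟩
  · rintro i j u hj ⟨K, hK⟩
    refine ⟨max K (j.natAbs + 1), fun k hk => ?_⟩
    rw [heis_comm B hB, if_neg (by omega), hK k (by omega), map_zero, zero_smul, add_zero]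

end Heisenberg

/-! ### Exponentials of power series with operator coefficients -/

section ExpCoeff

lemma coeff_pow_eq_zero {A : Type} [Ring A] (f : PowerSeries A)
    (hf : PowerSeries.coeff 0 f = 0) (j n : ℕ) (h : n < j) : PowerSeries.coeff n (f ^ j) = 0 := by
  induction j generalizing n with
  | zero => omega
  | succ j ih =>
    rw [pow_succ, PowerSeries.coeff_mul]
    refine Finset.sum_eq_zero fun ab hab => ?_
    rw [Finset.HasAntidiagonal.mem_antidiagonal] at hab
    rcases Nat.eq_zero_or_pos ab.2 with h0 | h0
    · rw [h0, hf, mul_zero]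
    · rw [ih _ (by omega), zero_mul]

variable {A : Type} [Ring A] [Algebra ℂ A]

/-- The coefficient of `x^N` in `exp f`, over an arbitrary algebra of coefficients. -/
def expSum (f : PowerSeries A) (N : ℕ) : A :=
  ∑ k ∈ Finset.range (N + 1), ((k.factorial : ℂ)⁻¹) • PowerSeries.coeff N (f ^ k)

lemma expSum_zero (f : PowerSeries A) : expSum f 0 = 1 := by
  simp [expSum]

lemma expSum_eq_sum (f : PowerSeries A) (hf : PowerSeries.coeff 0 f = 0) {N K : ℕ}
    (h : N ≤ K) : expSum f N =
      ∑ k ∈ Finset.range (K + 1), ((k.factorial : ℂ)⁻¹) • PowerSeries.coeff N (f ^ k) := by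
  refine Finset.sum_subset (Finset.range_mono (by omega)) fun k _ hk => ?_
  rw [coeff_pow_eq_zero f hf k N (by simpa using hk), smul_zero]

/-- The coefficients of `exp f`, extended by zero to negative indices. -/
def expSumZ (f : PowerSeries A) (N : ℤ) : A :=
  if 0 ≤ N then expSum f N.toNat else 0

lemma expSumZ_natCast (f : PowerSeries A) (N : ℕ) : expSumZ f N = expSum f N := by
  simp [expSumZ]

lemma expSumZ_neg (f : PowerSeries A) {N : ℤ} (h : N < 0) : expSumZ f N = 0 := by
  rw [expSumZ, if_neg (by omega)]

/-- If `[H, f] = c x^k`, then `[H, exp f] = c x^k exp f`. -/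
lemma expSum_comm (f : PowerSeries A) (hf : PowerSeries.coeff 0 f = 0) (H : A) (c : ℂ)
    {k : ℕ}
    (hH : ∀ n, H * PowerSeries.coeff n f - PowerSeries.coeff n f * H =
      (if n = k then c else 0) • 1) (N : ℕ) :
    H * expSum f N - expSum f N * H = c • expSumZ f ((N : ℤ) - k) := by
  have h1 : PowerSeries.C H * f - f * PowerSeries.C H = c • (PowerSeries.X ^ k) := by
    ext1 n
    rw [map_sub, PowerSeries.coeff_C_mul, PowerSeries.coeff_mul_C, hH, PowerSeries.coeff_smul,
      PowerSeries.coeff_X_pow]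
    split_ifs <;> simp
  have h2 : ∀ j : ℕ, PowerSeries.C H * f ^ (j + 1) - f ^ (j + 1) * PowerSeries.C H =
      (((j : ℂ) + 1) * c) • (PowerSeries.X ^ k * f ^ j) := by
    intro j
    induction j with
    | zero => simp [h1]
    | succ j ih =>
      have e : PowerSeries.C H * f ^ (j + 1 + 1) - f ^ (j + 1 + 1) * PowerSeries.C H =
          (PowerSeries.C H * f ^ (j + 1) - f ^ (j + 1) * PowerSeries.C H) * f +
            f ^ (j + 1) * (PowerSeries.C H * f - f * PowerSeries.C H) := by
        simp only [pow_succ f (j + 1), mul_sub, sub_mul, mul_assoc]; abel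
      rw [e, ih, h1, smul_mul_assoc, mul_assoc, ← pow_succ, mul_smul_comm,
        ← (PowerSeries.commute_X_pow (f ^ (j + 1)) k).eq, ← add_smul]
      push_cast
      congr 1; ring
  have h3 : ∀ j : ℕ, H * PowerSeries.coeff N (f ^ (j + 1)) - PowerSeries.coeff N (f ^ (j + 1)) * H =
      (((j : ℂ) + 1) * c) • (if k ≤ N then PowerSeries.coeff (N - k) (f ^ j) else 0) := by
    intro j
    have := congrArg (PowerSeries.coeff N) (h2 j)
    rwa [map_sub, PowerSeries.coeff_C_mul, PowerSeries.coeff_mul_C, PowerSeries.coeff_smul,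
      PowerSeries.coeff_X_pow_mul'] at this
  rw [expSum_eq_sum f hf (Nat.le_succ N), Finset.mul_sum, Finset.sum_mul,
    ← Finset.sum_sub_distrib, Finset.sum_range_succ']
  have e0 : H * (((0 : ℕ).factorial : ℂ)⁻¹ • PowerSeries.coeff N (f ^ 0)) -
      (((0 : ℕ).factorial : ℂ)⁻¹ • PowerSeries.coeff N (f ^ 0)) * H = 0 := by
    by_cases hN : N = 0 <;> simp [PowerSeries.coeff_one, hN]
  rw [e0, add_zero]
  have e1 : ∀ j : ℕ, H * (((j + 1).factorial : ℂ)⁻¹ • PowerSeries.coeff N (f ^ (j + 1))) -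
      (((j + 1).factorial : ℂ)⁻¹ • PowerSeries.coeff N (f ^ (j + 1))) * H =
      c • ((j.factorial : ℂ)⁻¹ • (if k ≤ N then PowerSeries.coeff (N - k) (f ^ j) else 0)) := by
    intro j
    rw [mul_smul_comm, smul_mul_assoc, ← smul_sub, h3, smul_smul, smul_smul]
    congr 1
    rw [Nat.factorial_succ]
    have : (j.factorial : ℂ) ≠ 0 := by exact_mod_cast j.factorial_ne_zero
    have : (j : ℂ) + 1 ≠ 0 := by exact_mod_cast j.succ_ne_zero
    push_cast
    field_simp
  simp only [e1, ← Finset.smul_sum]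
  congr 1
  by_cases h : k ≤ N
  · simp only [h, if_true]
    rw [show (N : ℤ) - k = ((N - k : ℕ) : ℤ) by omega, expSumZ_natCast,
      expSum_eq_sum f hf (Nat.sub_le N k)]
  · rw [expSumZ_neg f (by omega)]
    simp [h]

lemma expSumZ_comm (f : PowerSeries A) (hf : PowerSeries.coeff 0 f = 0) (H : A) (c : ℂ)
    {k : ℕ}
    (hH : ∀ n, H * PowerSeries.coeff n f - PowerSeries.coeff n f * H =
      (if n = k then c else 0) • 1) (N : ℤ) :
    H * expSumZ f N - expSumZ f N * H = c • expSumZ f (N - k) := by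
  rcases lt_or_ge N 0 with h | h
  · rw [expSumZ_neg f h, expSumZ_neg f (by omega)]; simp
  · lift N to ℕ using h
    rw [expSumZ_natCast, expSum_comm f hf H c hH]

lemma expSumZ_comm_add (f : PowerSeries A) (hf : PowerSeries.coeff 0 f = 0) (H : A) (c : ℂ)
    {k : ℕ} (hH : ∀ n, H * PowerSeries.coeff n f = PowerSeries.coeff n f * H +
      (if n = k then c else 0) • 1) (N : ℤ) :
    H * expSumZ f N = expSumZ f N * H + c • expSumZ f (N - k) := by
  rw [← sub_eq_iff_eq_add']
  exact expSumZ_comm f hf H c (fun n => by rw [hH, add_sub_cancel_left]) N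

lemma expSum_comm_of_comm (f : PowerSeries A) (H : A)
    (hH : ∀ n, H * PowerSeries.coeff n f = PowerSeries.coeff n f * H) (N : ℕ) :
    H * expSum f N = expSum f N * H := by
  have h1 : Commute (PowerSeries.C H) f := by
    change _ = _
    ext1 n
    rw [PowerSeries.coeff_C_mul, PowerSeries.coeff_mul_C, hH]
  rw [expSum, Finset.mul_sum, Finset.sum_mul]
  refine Finset.sum_congr rfl fun j _ => ?_
  have := congrArg (PowerSeries.coeff N) (h1.pow_right j).eq
  rw [PowerSeries.coeff_C_mul, PowerSeries.coeff_mul_C] at this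
  rw [mul_smul_comm, smul_mul_assoc, this]

lemma expSumZ_comm_of_comm (f : PowerSeries A) (H : A)
    (hH : ∀ n, H * PowerSeries.coeff n f = PowerSeries.coeff n f * H) (N : ℤ) :
    H * expSumZ f N = expSumZ f N * H := by
  unfold expSumZ
  split_ifs
  · exact expSum_comm_of_comm f H hH _
  · simp

end ExpCoeff

section OpExp

variable {ι : Type}

lemma op_expSumZ_comm (f : PowerSeries (Op ι)) (hf : PowerSeries.coeff 0 f = 0) (H : Op ι) (c : ℂ)
    (k : ℕ) (hH : ∀ n w, H (PowerSeries.coeff n f w) = PowerSeries.coeff n f (H w) +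
      (if n = k then c else 0) • w) (N : ℤ) (u : StateSpace ι) :
    H (expSumZ f N u) = expSumZ f N (H u) + c • expSumZ f (N - k) u := by
  have h := expSumZ_comm_add (A := Op ι) f hf H c (k := k)
    (fun n => LinearMap.ext fun w => hH n w) N
  exact LinearMap.congr_fun h u

lemma op_expSumZ_comm_of_comm (f : PowerSeries (Op ι)) (H : Op ι)
    (hH : ∀ n w, H (PowerSeries.coeff n f w) = PowerSeries.coeff n f (H w)) (N : ℤ)
    (u : StateSpace ι) : H (expSumZ f N u) = expSumZ f N (H u) :=
  LinearMap.congr_fun (expSumZ_comm_of_comm (A := Op ι) f H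
    (fun n => LinearMap.ext fun w => hH n w) N) u

lemma expCoeff_apply_eq_zero (f : PowerSeries (Op ι)) (u : StateSpace ι)
    (hu : ∀ n, PowerSeries.coeff n f u = 0) {N : ℕ} (hN : 0 < N) : expCoeff f N u = 0 := by
  rw [expCoeff, LinearMap.sum_apply]
  refine Finset.sum_eq_zero fun j _ => ?_
  rw [LinearMap.smul_apply]
  cases j with
  | zero => simp [PowerSeries.coeff_one, hN.ne']
  | succ j =>
    rw [pow_succ, PowerSeries.coeff_mul, LinearMap.sum_apply, Finset.sum_eq_zero, smul_zero]
    intro ab _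
    rw [Module.End.mul_apply, hu, map_zero]

lemma functional_expCoeff_eq_zero (f : PowerSeries (Op ι)) (φ : StateSpace ι →ₗ[ℂ] ℂ)
    (hφ : ∀ n u, φ (PowerSeries.coeff n f u) = 0) {N : ℕ} (hN : 0 < N) (u : StateSpace ι) :
    φ (expCoeff f N u) = 0 := by
  rw [expCoeff, LinearMap.sum_apply, map_sum]
  refine Finset.sum_eq_zero fun j _ => ?_
  rw [LinearMap.smul_apply, map_smul]
  cases j with
  | zero => simp [PowerSeries.coeff_one, hN.ne']
  | succ j =>
    rw [pow_succ', PowerSeries.coeff_mul, LinearMap.sum_apply, map_sum, Finset.sum_eq_zero,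
      smul_zero]
    intro ab _
    rw [Module.End.mul_apply, hφ]

end OpExp

/-! ### Vertex operators -/

/-- A symmetric lattice with a bimultiplicative sign. Nondegeneracy is encoded by `dual`: every
coordinate function is the product with some vector of the complexification. -/
structure IsSignedLattice {ι : Type} [Fintype ι] [DecidableEq ι] (B : ι → ι → ℤ)
    (ε : (ι → ℤ) → (ι → ℤ) → ℤˣ) : Prop where
  symm : ∀ i j, B i j = B j i
  dual : ∀ i, ∃ h : ι → ℂ, ∀ j, form B h (Pi.single j 1) = if j = i then 1 else 0
  add_left : ∀ α β γ, ε (α + β) γ = ε α γ * ε β γ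
  add_right : ∀ α β γ, ε α (β + γ) = ε α β * ε α γ

section VertexOp

variable {ι : Type} [Fintype ι] [DecidableEq ι] {B : ι → ι → ℤ}
  {ε : (ι → ℤ) → (ι → ℤ) → ℤˣ}

lemma coeff_creation (α : ι → ℤ) (n : ℕ) : PowerSeries.coeff n (creation B α) =
    if n = 0 then 0 else ((n : ℂ)⁻¹) • heis B (cplx α) (-(n : ℤ)) :=
  PowerSeries.coeff_mk _ _

lemma coeff_annihilation (α : ι → ℤ) (n : ℕ) : PowerSeries.coeff n (annihilation B α) =
    if n = 0 then 0 else (-(n : ℂ)⁻¹) • heis B (cplx α) (n : ℤ) :=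
  PowerSeries.coeff_mk _ _

variable (B) in
/-- The coefficients of the creation part of `E^α(z)`, extended by zero to negative indices. -/
def cre (α : ι → ℤ) (N : ℤ) : Op ι := expSumZ (creation B α) N

variable (B) in
/-- The coefficients of the annihilation part of `E^α(z)`, extended by zero to negative indices. -/
def ann (α : ι → ℤ) (N : ℤ) : Op ι := expSumZ (annihilation B α) N

lemma cre_natCast (α : ι → ℤ) (n : ℕ) : cre B α n = expCoeff (creation B α) n :=
  expSumZ_natCast _ n

lemma ann_natCast (α : ι → ℤ) (n : ℕ) : ann B α n = expCoeff (annihilation B α) n :=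
  expSumZ_natCast _ n

lemma cre_of_neg (α : ι → ℤ) {n : ℤ} (h : n < 0) : cre B α n = 0 := expSumZ_neg _ h

lemma ann_of_neg (α : ι → ℤ) {n : ℤ} (h : n < 0) : ann B α n = 0 := expSumZ_neg _ h

lemma cre_zero (α : ι → ℤ) : cre B α 0 = 1 := by
  rw [← Nat.cast_zero, cre_natCast]
  exact expSum_zero (A := Op ι) (creation B α)

lemma ann_zero (α : ι → ℤ) : ann B α 0 = 1 := by
  rw [← Nat.cast_zero, ann_natCast]
  exact expSum_zero (A := Op ι) (annihilation B α)

/-- The creation part of `E^α(z)` is multiplied by `(h|α) z^k` under the commutator with `h_{(k)}`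
for `k > 0`, and commutes with it for `k ≤ 0`. -/
lemma heis_cre (hL : IsSignedLattice B ε) (h : ι → ℂ) (α : ι → ℤ) (k N : ℤ) (u : StateSpace ι) :
    heis B h k (cre B α N u) = cre B α N (heis B h k u) +
      (if 0 < k then form B h (cplx α) else 0) • cre B α (N - k) u := by
  split_ifs with hk
  · lift k to ℕ using hk.le
    refine op_expSumZ_comm (creation B α) (coeff_creation α 0) (heis B h k) (form B h (cplx α)) k
      ?_ N u
    · intro n w
      rw [coeff_creation]
      split_ifs with h0 h1 h1
      · omega
      · simp
      · subst h1
        have : (n : ℂ) ≠ 0 := by exact_mod_cast h0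
        rw [LinearMap.smul_apply, LinearMap.smul_apply, map_smul, heis_comm B hL.symm,
          if_pos (by omega), smul_add, smul_smul]
        congr 2
        push_cast
        field_simp
      · rw [LinearMap.smul_apply, LinearMap.smul_apply, map_smul, heis_comm B hL.symm,
          if_neg (by omega)]
        simp
  · rw [zero_smul, add_zero]
    refine op_expSumZ_comm_of_comm (creation B α) (heis B h k) (fun n w => ?_) N u
    rw [coeff_creation]
    split_ifs with h0
    · simp
    · rw [LinearMap.smul_apply, LinearMap.smul_apply, map_smul, heis_comm B hL.symm,
        if_neg (by omega)]
      simp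

/-- The annihilation part of `E^α(z)` is multiplied by `(h|α) z^k` under the commutator with
`h_{(k)}` for `k < 0`, and commutes with it for `k ≥ 0`. -/
lemma heis_ann (hL : IsSignedLattice B ε) (h : ι → ℂ) (α : ι → ℤ) (k N : ℤ) (u : StateSpace ι) :
    heis B h k (ann B α N u) = ann B α N (heis B h k u) +
      (if k < 0 then form B h (cplx α) else 0) • ann B α (N + k) u := by
  split_ifs with hk
  · obtain ⟨j, rfl⟩ : ∃ j : ℕ, k = -(j : ℤ) := ⟨k.natAbs, by omega⟩
    refine op_expSumZ_comm (annihilation B α) (coeff_annihilation α 0) (heis B h (-(j : ℤ)))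
      (form B h (cplx α)) j ?_ N u
    · intro n w
      rw [coeff_annihilation]
      split_ifs with h0 h1 h1
      · omega
      · simp
      · subst h1
        have : (n : ℂ) ≠ 0 := by exact_mod_cast h0
        rw [LinearMap.smul_apply, LinearMap.smul_apply, map_smul, heis_comm B hL.symm,
          if_pos (by omega), smul_add, smul_smul]
        congr 2
        push_cast
        field_simp
      · rw [LinearMap.smul_apply, LinearMap.smul_apply, map_smul, heis_comm B hL.symm,
          if_neg (by omega)]
        simp
  · rw [zero_smul, add_zero]
    refine op_expSumZ_comm_of_comm (annihilation B α) (heis B h k) (fun n w => ?_) N u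
    rw [coeff_annihilation]
    split_ifs with h0
    · simp
    · rw [LinearMap.smul_apply, LinearMap.smul_apply, map_smul, heis_comm B hL.symm,
        if_neg (by omega)]
      simp

lemma expOp_vec {ι : Type} (ε : (ι → ℤ) → (ι → ℤ) → ℤˣ) (α : ι → ℤ) (g : Fock ι) (β : ι → ℤ) :
    expOp ε α (vec g β) = (((ε α β : ℤˣ) : ℤ) : ℂ) • vec g (α + β) := by
  simp [expOp, vec]

lemma zPow_vec {ι : Type} [Fintype ι] {B : ι → ι → ℤ} (α : ι → ℤ) (k : ℤ) (g : Fock ι) (β : ι → ℤ) :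
    zPow B α k (vec g β) = if latForm B α β = k then vec g β else 0 := by
  simp only [zPow, vec, Finsupp.lsum_single]
  split_ifs <;> simp

/-- The operators `h_{(k)}` preserve the charge `β` of a vector. -/
lemma heis_vec (h : ι → ℂ) (k : ℤ) (g : Fock ι) (β : ι → ℤ) :
    ∃ g', heis B h k (vec g β) = vec g' β := by
  rcases int_trichotomy k with ⟨n, rfl⟩ | rfl | ⟨n, rfl⟩
  · exact ⟨_, heis_neg B h n g β⟩
  · exact ⟨form B h (cplx β) • g, by rw [heis_zero, vec, Finsupp.smul_single]⟩
  · exact ⟨_, heis_pos B h n g β⟩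

lemma heis_expOp (h : ι → ℂ) (k : ℤ) (α : ι → ℤ) (u : StateSpace ι) :
    heis B h k (expOp ε α u) = expOp ε α (heis B h k u) +
      (if k = 0 then form B h (cplx α) else 0) • expOp ε α u := by
  induction u using Finsupp.induction_linear with
  | zero => simp
  | add u w hu hw => simp only [map_add, hu, hw, smul_add]; abel
  | single β g =>
    rcases int_trichotomy k with ⟨n, rfl⟩ | rfl | ⟨n, rfl⟩
    · rw [if_neg (by omega), zero_smul, add_zero, expOp_vec, map_smul, heis_neg, heis_neg,
        expOp_vec]
    · rw [if_pos rfl, expOp_vec, map_smul, heis_zero, heis_zero, map_smul, expOp_vec, cplx_add,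
        form_add_right]
      module
    · rw [if_neg (by omega), zero_smul, add_zero, expOp_vec, map_smul, heis_pos, heis_pos,
        expOp_vec]

lemma zPow_heis (h : ι → ℂ) (k j : ℤ) (α : ι → ℤ) (u : StateSpace ι) :
    zPow B α j (heis B h k u) = heis B h k (zPow B α j u) := by
  induction u using Finsupp.induction_linear with
  | zero => simp
  | add u w hu hw => simp only [map_add, hu, hw]
  | single β g =>
    obtain ⟨g', hg'⟩ := heis_vec (B := B) h k g β
    rw [hg', zPow_vec, zPow_vec]
    split_ifs
    · rw [hg']
    · simp

lemma zPow_cre (α : ι → ℤ) (j N : ℤ) (u : StateSpace ι) :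
    zPow B α j (cre B α N u) = cre B α N (zPow B α j u) := by
  refine op_expSumZ_comm_of_comm (creation B α) (zPow B α j) (fun n w => ?_) N u
  rw [coeff_creation]
  split_ifs
  · simp
  · simp [zPow_heis]

lemma zPow_ann (α : ι → ℤ) (j N : ℤ) (u : StateSpace ι) :
    zPow B α j (ann B α N u) = ann B α N (zPow B α j u) := by
  refine op_expSumZ_comm_of_comm (annihilation B α) (zPow B α j) (fun n w => ?_) N u
  rw [coeff_annihilation]
  split_ifs
  · simp
  · simp [zPow_heis]

lemma ann_vacuum (α : ι → ℤ) {N : ℤ} (hN : 0 < N) (β : ι → ℤ) : ann B α N (vec 1 β) = 0 := by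
  lift N to ℕ using hN.le
  rw [ann_natCast]
  refine expCoeff_apply_eq_zero _ _ (fun n => ?_) (by omega)
  rw [coeff_annihilation]
  split_ifs with h0
  · simp
  · rw [LinearMap.smul_apply, heis_pos_vacuum B _ (by omega), smul_zero]

lemma ann_eventually_zero (hL : IsSignedLattice B ε) (α : ι → ℤ) (u : StateSpace ι) :
    ∃ M : ℕ, ∀ b : ℤ, M ≤ b → ann B α b u = 0 := by
  refine state_induction B (P := fun u => ∃ M : ℕ, ∀ b : ℤ, M ≤ b → ann B α b u = 0)
    ⟨0, by simp⟩ ?_ ?_ ?_ ?_ u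
  · rintro u w ⟨K, hK⟩ ⟨L, hL⟩
    exact ⟨max K L, fun k hk => by
      rw [map_add, hK k (by omega), hL k (by omega), add_zero]⟩
  · rintro s u ⟨K, hK⟩
    exact ⟨K, fun k hk => by rw [map_smul, hK k hk, smul_zero]⟩
  · exact fun β => ⟨1, fun k hk => ann_vacuum α (by omega) β⟩
  · rintro i j u hj ⟨K, hK⟩
    refine ⟨K + j.natAbs, fun k hk => ?_⟩
    have := heis_ann hL (Pi.single i 1) α j k u
    rw [hK k (by omega), hK (k + j) (by omega), map_zero, smul_zero, add_zero] at this
    exact this.symm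

/-- Evaluation of a locally finite sum of operators. -/
lemma locSum_apply {ι J : Type} (F : J → Op ι)
    (hF : ∀ u, (Function.support fun j => F j u).Finite) (u : StateSpace ι) :
    locSum F u = ∑ᶠ j, F j u := by
  rw [locSum, dif_pos hF]; rfl

lemma vertexOp_term (α : ι → ℤ) (N : ℤ) (ab : ℕ × ℕ) (g : Fock ι) (β : ι → ℤ) :
    (expOp ε α * zPow B α (N - ab.1 + ab.2) * expCoeff (creation B α) ab.1 *
      expCoeff (annihilation B α) ab.2) (vec g β) =
    if latForm B α β = N - ab.1 + ab.2 then
      expOp ε α (cre B α ab.1 (ann B α ab.2 (vec g β))) else 0 := by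
  rw [← cre_natCast, ← ann_natCast]
  simp only [Module.End.mul_apply]
  rw [zPow_cre, zPow_ann, zPow_vec]
  split_ifs <;> simp

lemma vertexOp_support (α : ι → ℤ) (N : ℤ) (g : Fock ι) (β : ι → ℤ)
    (M : ℕ) (hM : ∀ b : ℤ, M ≤ b → ann B α b (vec g β) = 0) :
    (Function.support fun ab : ℕ × ℕ => (expOp ε α * zPow B α (N - ab.1 + ab.2) *
      expCoeff (creation B α) ab.1 * expCoeff (annihilation B α) ab.2) (vec g β)) ⊆
    ((Finset.range M).image fun b : ℕ => ((N + b - latForm B α β).toNat, b) : Finset (ℕ × ℕ)) := by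
  rintro ⟨a, b⟩ hab
  rw [Function.mem_support, vertexOp_term] at hab
  split_ifs at hab with h
  · have hb : b < M := by
      by_contra hb
      rw [hM b (by omega)] at hab
      simp at hab
    simp only [Finset.coe_image, Set.mem_image, Finset.coe_range, Set.mem_Iio, Prod.mk.injEq]
    exact ⟨b, hb, by simp only at h; omega, rfl⟩
  · exact absurd rfl hab

lemma vertexOp_locallyFinite (hL : IsSignedLattice B ε) (α : ι → ℤ) (N : ℤ) (u : StateSpace ι) :
    (Function.support fun ab : ℕ × ℕ => (expOp ε α * zPow B α (N - ab.1 + ab.2) *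
      expCoeff (creation B α) ab.1 * expCoeff (annihilation B α) ab.2) u).Finite := by
  induction u using Finsupp.induction_linear with
  | zero => simp
  | add u w hu hw =>
    refine (hu.union hw).subset fun ab hab => ?_
    by_contra hn
    simp only [Set.mem_union, Function.mem_support, not_or, not_not] at hn
    exact hab (by simp only [map_add]; rw [hn.1, hn.2, add_zero])
  | single β g =>
    obtain ⟨M, hM⟩ := ann_eventually_zero hL α (vec g β)
    exact (Finset.finite_toSet _).subset (vertexOp_support α N g β M hM)

/-- The action of the vertex operator on `g ⊗ e^β` as a finite sum over the degree `b` of the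
annihilation part; the degree of the creation part is then determined. -/
lemma vertexOp_vec (hL : IsSignedLattice B ε) (α : ι → ℤ) (N : ℤ) (g : Fock ι) (β : ι → ℤ)
    (M : ℕ) (hM : ∀ b : ℤ, M ≤ b → ann B α b (vec g β) = 0) :
    vertexOp B ε α N (vec g β) = ∑ b ∈ Finset.range M,
      expOp ε α (cre B α (N - latForm B α β + b) (ann B α b (vec g β))) := by
  rw [vertexOp, locSum_apply _ (vertexOp_locallyFinite hL α N),
    finsum_eq_sum_of_support_subset _ (vertexOp_support α N g β M hM),
    Finset.sum_image (fun b _ b' _ h => congrArg Prod.snd h)]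
  refine Finset.sum_congr rfl fun b _ => ?_
  rw [vertexOp_term]
  simp only
  split_ifs with h
  · congr 3; omega
  · rw [cre_of_neg α (by omega)]; simp

/-- `[h_{(k)}, E^α(z)] = (h|α) z^k E^α(z)`. -/
lemma heis_vertexOp (hL : IsSignedLattice B ε) (h : ι → ℂ) (k : ℤ) (α : ι → ℤ) (N : ℤ)
    (u : StateSpace ι) :
    heis B h k (vertexOp B ε α N u) = vertexOp B ε α N (heis B h k u) +
      form B h (cplx α) • vertexOp B ε α (N - k) u := by
  induction u using Finsupp.induction_linear with
  | zero => simp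
  | add u w hu hw => simp only [map_add, hu, hw, smul_add]; abel
  | single β g =>
    obtain ⟨M₀, hM₀⟩ := ann_eventually_zero hL α (vec g β)
    obtain ⟨M₁, hM₁⟩ := ann_eventually_zero hL α (heis B h k (vec g β))
    obtain ⟨g', hg'⟩ := heis_vec (B := B) h k g β
    obtain ⟨M, hM0, hM1⟩ : ∃ M : ℕ, M₀ ≤ M ∧ M₁ ≤ M + k.natAbs := ⟨M₀ + M₁, by omega, by omega⟩
    have hM : ∀ b : ℤ, (M : ℤ) ≤ b → ann B α b (vec g β) = 0 := fun b hb => hM₀ b (by omega)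
    rw [vertexOp_vec hL α (N - k) g β M hM, hg',
      vertexOp_vec hL α N g' β (M + k.natAbs) (fun b hb => hg' ▸ hM₁ b (by omega)), ← hg',
      vertexOp_vec hL α N g β (M + k.natAbs) (fun b hb => hM₀ b (by omega))]
    simp only [map_sum, heis_expOp, heis_cre hL, heis_ann hL, map_add, map_smul,
      Finset.sum_add_distrib, add_assoc]
    refine congrArg (_ + ·) ?_
    rw [← Finset.smul_sum, ← Finset.smul_sum, ← Finset.smul_sum]
    -- exactly one of the three factors of the vertex operator fails to commute with `h_{(k)}`:
    -- the annihilation part for `k < 0`, `e^α` for `k = 0` and the creation part for `k > 0`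
    rcases lt_trichotomy k 0 with hk | rfl | hk
    · rw [if_pos hk, if_neg (by omega), if_neg (by omega), zero_smul, zero_smul, add_zero, add_zero,
        add_comm M, Finset.sum_range_add, Finset.sum_eq_zero, zero_add]
      · refine congrArg (form B h (cplx α) • ·) (Finset.sum_congr rfl fun b _ => ?_)
        have hK : ((k.natAbs : ℕ) : ℤ) = -k := by omega
        rw [Nat.cast_add, hK, show -k + (b : ℤ) + k = b by ring,
          show N - latForm B α β + (-k + b) = N - k - latForm B α β + b by ring]
      · intro b hb
        rw [Finset.mem_range] at hb
        rw [ann_of_neg α (by omega)]; simp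
    · simp
    · rw [if_neg (by omega), if_pos hk, if_neg (by omega), zero_smul, zero_smul, zero_add, add_zero,
        Finset.sum_range_add]
      rw [Finset.sum_eq_zero (s := Finset.range k.natAbs), add_zero]
      · refine congrArg (form B h (cplx α) • ·) (Finset.sum_congr rfl fun b _ => ?_)
        rw [show N - latForm B α β + b - k = N - k - latForm B α β + b by ring]
      · intro b _
        rw [hM _ (by push_cast; omega)]; simp

/-- Every vector is annihilated by the coefficients of `E^α(z)` of sufficiently low degree. -/
lemma vertexOp_eventually_zero (hL : IsSignedLattice B ε) (α : ι → ℤ) (u : StateSpace ι) :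
    ∃ K : ℕ, ∀ N : ℤ, N ≤ -K → vertexOp B ε α N u = 0 := by
  induction u using Finsupp.induction_linear with
  | zero => exact ⟨0, by simp⟩
  | add u w hu hw =>
    obtain ⟨K, hK⟩ := hu
    obtain ⟨L, hL⟩ := hw
    exact ⟨max K L, fun N hN => by
      rw [map_add, hK N (by omega), hL N (by omega), add_zero]⟩
  | single β g =>
    obtain ⟨M, hM⟩ := ann_eventually_zero hL α (vec g β)
    refine ⟨M + (latForm B α β).natAbs, fun N hN => ?_⟩
    rw [vertexOp_vec hL α N g β M hM]
    refine Finset.sum_eq_zero fun b hb => ?_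
    rw [Finset.mem_range] at hb
    rw [cre_of_neg α (by omega)]; simp

lemma vertexOp_vacuum (hL : IsSignedLattice B ε) (α : ι → ℤ) (N : ℤ) (β : ι → ℤ) :
    vertexOp B ε α N (vec 1 β) = expOp ε α (cre B α (N - latForm B α β) (vec 1 β)) := by
  rw [vertexOp_vec hL α N 1 β 1 (fun b hb => ann_vacuum α (by omega) β)]
  simp [ann_zero]

lemma vertexOp_vacuum_of_lt (hL : IsSignedLattice B ε) (α : ι → ℤ) {N : ℤ} {β : ι → ℤ}
    (h : N < latForm B α β) : vertexOp B ε α N (vec 1 β) = 0 := by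
  rw [vertexOp_vacuum hL, cre_of_neg α (by omega)]; simp

lemma vertexOp_vacuum_self (hL : IsSignedLattice B ε) (α β : ι → ℤ) :
    vertexOp B ε α (latForm B α β) (vec 1 β) = (((ε α β : ℤˣ) : ℤ) : ℂ) • vec 1 (α + β) := by
  rw [vertexOp_vacuum hL, sub_self, cre_zero, Module.End.one_apply, expOp_vec]

/-- The coefficient of `1 ⊗ e^γ`. -/
def vac {ι : Type} (γ : ι → ℤ) : StateSpace ι →ₗ[ℂ] ℂ :=
  (MvPolynomial.aeval (R := ℂ) (fun _ : ι × ℕ => (0 : ℂ))).toLinearMap ∘ₗ Finsupp.lapply γ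

lemma vac_apply {ι : Type} (γ : ι → ℤ) (u : StateSpace ι) :
    vac γ u = MvPolynomial.constantCoeff (u γ) := by
  simp [vac, MvPolynomial.constantCoeff_eq]

lemma vac_vec {ι : Type} [DecidableEq (ι → ℤ)] (γ : ι → ℤ) (g : Fock ι) (β : ι → ℤ) :
    vac γ (vec g β) = if β = γ then MvPolynomial.constantCoeff g else 0 := by
  rw [vac_apply, vec, Finsupp.single_apply]
  split_ifs <;> simp

lemma vac_heis_neg (γ : ι → ℤ) (h : ι → ℂ) {k : ℤ} (hk : k < 0) (u : StateSpace ι) :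
    vac γ (heis B h k u) = 0 := by
  obtain ⟨n, rfl⟩ : ∃ n : ℕ, k = -(n + 1 : ℤ) := ⟨(-k - 1).toNat, by omega⟩
  induction u using Finsupp.induction_linear with
  | zero => simp
  | add u w hu hw => rw [map_add, map_add, hu, hw, add_zero]
  | single β g =>
    rw [heis_neg, vac_vec]
    simp [neg]

lemma vac_cre (γ α : ι → ℤ) {N : ℤ} (hN : N ≠ 0) (u : StateSpace ι) :
    vac γ (cre B α N u) = 0 := by
  rcases lt_or_gt_of_ne hN with h | h
  · rw [cre_of_neg α h]; simp
  · lift N to ℕ using h.le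
    rw [cre_natCast]
    refine functional_expCoeff_eq_zero _ _ (fun n w => ?_) (by omega) u
    rw [coeff_creation]
    split_ifs with h0
    · simp
    · rw [LinearMap.smul_apply, map_smul, vac_heis_neg γ _ (by omega), smul_zero]

lemma vac_expOp {ι : Type} {ε : (ι → ℤ) → (ι → ℤ) → ℤˣ} (γ α : ι → ℤ) (u : StateSpace ι) :
    vac γ (expOp ε α u) = (((ε α (γ - α) : ℤˣ) : ℤ) : ℂ) * vac (γ - α) u := by
  classical
  induction u using Finsupp.induction_linear with
  | zero => simp
  | add u w hu hw => simp [map_add, hu, hw, mul_add]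
  | single β g =>
    rw [expOp_vec, map_smul, vac_vec, vac_vec]
    by_cases h : α + β = γ
    · rw [if_pos h, if_pos (eq_sub_of_add_eq' h), ← eq_sub_of_add_eq' h, smul_eq_mul]
    · rw [if_neg h, if_neg (fun h' => h (by rw [h']; abel))]; simp

variable (ε) in
/-- The vacuum expectation value of `e^α` between `e^γ` and `e^γ'`. -/
def sgnVac (α γ γ' : ι → ℤ) : ℂ := if α + γ = γ' then (((ε α γ : ℤˣ) : ℤ) : ℂ) else 0

/-- The one-point function `⟨e^γ', E^α(z) e^γ⟩`. -/
lemma vac_vertexOp (hL : IsSignedLattice B ε) (γ' α : ι → ℤ) (N : ℤ) (γ : ι → ℤ) :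
    vac γ' (vertexOp B ε α N (vec 1 γ)) =
      if N = latForm B α γ then sgnVac ε α γ γ' else 0 := by
  split_ifs with h
  · rw [h, vertexOp_vacuum_self hL, map_smul, vac_vec, sgnVac]
    split_ifs <;> simp
  · rw [vertexOp_vacuum hL, vac_expOp, vac_cre _ _ (by omega), mul_zero]

end VertexOp

/-! ### The fields `:h(z) E^α(z):` -/

section Current

variable {ι : Type} [Fintype ι] [DecidableEq ι] {B : ι → ι → ℤ}
  {ε : (ι → ℤ) → (ι → ℤ) → ℤˣ}

variable (B ε) in
/-- The field `:h(z) E^α(z):`. It is defined by linearity from the basis vectors of the lattice, as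
the state-field correspondence is. -/
def current (h : ι → ℂ) (α : ι → ℤ) : Dist ι := fun N =>
  ∑ i, h i • nop (heisField B (Pi.single i 1)) (vertexOp B ε α) N

variable (B ε) in
/-- The `t`-th term in the normally ordered product `:h(z) E^α(z):`. -/
def currentTerm (h : ι → ℂ) (α : ι → ℤ) (N t : ℤ) : Op ι :=
  if 0 ≤ t then heis B h (-t - 1) * vertexOp B ε α (N - t)
  else vertexOp B ε α (N - t) * heis B h (-t - 1)

lemma currentTerm_eventually_zero (hL : IsSignedLattice B ε) (h : ι → ℂ) (α : ι → ℤ) (N : ℤ)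
    (u : StateSpace ι) : ∃ K : ℕ, ∀ t : ℤ, (K ≤ t ∨ t < -K) → currentTerm B ε h α N t u = 0 := by
  obtain ⟨K, hK⟩ := vertexOp_eventually_zero hL α u
  obtain ⟨M, hM⟩ := heis_eventually_zero B hL.symm h u
  refine ⟨K + M + N.natAbs, fun t ht => ?_⟩
  unfold currentTerm
  split_ifs with h0
  · rw [Module.End.mul_apply, hK _ (by omega), map_zero]
  · rw [Module.End.mul_apply, hM _ (by omega), map_zero]

lemma sum_Ico_neg {V : Type} [AddCommMonoid V] (f : ℤ → V) (K : ℕ) :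
    ∑ t ∈ Finset.Ico (-(K : ℤ)) K, f t =
      ∑ j ∈ Finset.range K, f j + ∑ j ∈ Finset.range K, f (-(j : ℤ) - 1) := by
  induction K with
  | zero => simp
  | succ K ih =>
    have e : Finset.Ico (-((K + 1 : ℕ) : ℤ)) ((K + 1 : ℕ) : ℤ) =
        insert (K : ℤ) (insert (-(K : ℤ) - 1) (Finset.Ico (-(K : ℤ)) K)) := by
      ext t; simp only [Finset.mem_Ico, Finset.mem_insert]; omega
    rw [e, Finset.sum_insert (by simp only [Finset.mem_Ico, Finset.mem_insert]; omega),
      Finset.sum_insert (by simp), ih, Finset.sum_range_succ, Finset.sum_range_succ]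
    abel

/-- The action of `:h(z) E^α(z):` as a finite sum. -/
lemma current_apply (hL : IsSignedLattice B ε) (h : ι → ℂ) (α : ι → ℤ) (N : ℤ)
    (u : StateSpace ι) : ∃ K₀ : ℕ, ∀ K : ℕ, K₀ ≤ K → current B ε h α N u =
      ∑ j ∈ Finset.range K, heis B h (-(j : ℤ) - 1) (vertexOp B ε α (N - j) u) +
      ∑ j ∈ Finset.range K, vertexOp B ε α (N + 1 + j) (heis B h j u) := by
  choose K hK using fun i => currentTerm_eventually_zero hL (Pi.single i 1) α N
  refine ⟨Finset.univ.sup fun i => K i u, fun L hL' => ?_⟩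
  have hnop : ∀ i, nop (heisField B (Pi.single i 1)) (vertexOp B ε α) N u =
      ∑ t ∈ Finset.Ico (-(L : ℤ)) L, currentTerm B ε (Pi.single i 1) α N t u := by
    intro i
    have hi : K i u ≤ L := (Finset.le_sup (f := fun i => K i u) (Finset.mem_univ i)).trans hL'
    have hsub : ∀ (w : StateSpace ι) (M : ℕ), K i w ≤ M →
        (Function.support fun t : ℤ => currentTerm B ε (Pi.single i 1) α N t w) ⊆
          (Finset.Ico (-(M : ℤ)) M : Finset ℤ) := by
      intro w M hM t ht
      by_contra hn
      simp only [Finset.coe_Ico, Set.mem_Ico, not_and_or, not_le, not_lt] at hn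
      exact ht (hK i w t (by omega))
    exact (locSum_apply (currentTerm B ε (Pi.single i 1) α N)
      (fun w => (Finset.finite_toSet _).subset (hsub w _ le_rfl)) u).trans
      (finsum_eq_sum_of_support_subset _ (hsub u L hi))
  have hsum : ∀ t, ∑ i, h i • currentTerm B ε (Pi.single i 1) α N t u =
      currentTerm B ε h α N t u := by
    intro t
    unfold currentTerm
    rw [heis_eq_sum B h]
    split_ifs
    · simp only [Module.End.mul_apply, LinearMap.sum_apply, LinearMap.smul_apply]
    · simp only [Module.End.mul_apply, LinearMap.sum_apply, LinearMap.smul_apply, map_sum, map_smul]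
  simp only [current, LinearMap.sum_apply, LinearMap.smul_apply, hnop, Finset.smul_sum]
  rw [Finset.sum_comm]
  simp only [hsum]
  rw [sum_Ico_neg]
  refine congrArg₂ (· + ·) (Finset.sum_congr rfl fun j _ => ?_) (Finset.sum_congr rfl fun j _ => ?_)
  · rw [currentTerm, if_pos (by omega), Module.End.mul_apply]
  · rw [currentTerm, if_neg (by omega), Module.End.mul_apply,
      show N - (-(j : ℤ) - 1) = N + 1 + j by ring, show -(-(j : ℤ) - 1) - 1 = j by ring]

lemma sum_ite_natCast_eq {V : Type} [AddCommMonoid V] (f : ℤ → V) (K : ℕ) (k : ℤ) :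
    ∑ j ∈ Finset.range K, (if (j : ℤ) = k then f j else 0) =
      if 0 ≤ k ∧ k < K then f k else 0 := by
  split_ifs with h
  · lift k to ℕ using h.1
    rw [Finset.sum_eq_single k]
    · simp
    · intro j _ hj; rw [if_neg (by omega)]
    · intro hk; exact absurd (Finset.mem_range.2 (by omega)) hk
  · refine Finset.sum_eq_zero fun j hj => ?_
    rw [Finset.mem_range] at hj
    rw [if_neg (by omega)]

/-- `[h'_{(k)}, :h(z) E^α(z):] = k (h'|h) z^{k-1} E^α(z) + (h'|α) z^k :h(z) E^α(z):`. -/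
lemma heis_current (hL : IsSignedLattice B ε) (h' h : ι → ℂ) (k : ℤ) (α : ι → ℤ) (N : ℤ)
    (u : StateSpace ι) :
    heis B h' k (current B ε h α N u) = current B ε h α N (heis B h' k u) +
      form B h' (cplx α) • current B ε h α (N - k) u +
      ((k : ℂ) * form B h' h) • vertexOp B ε α (N - k + 1) u := by
  obtain ⟨K₁, hK₁⟩ := current_apply hL h α N u
  obtain ⟨K₂, hK₂⟩ := current_apply hL h α N (heis B h' k u)
  obtain ⟨K₃, hK₃⟩ := current_apply hL h α (N - k) u
  obtain ⟨K, h1, h2, h3, hk⟩ : ∃ K : ℕ, K₁ ≤ K ∧ K₂ ≤ K ∧ K₃ ≤ K ∧ k.natAbs < K :=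
    ⟨K₁ + K₂ + K₃ + k.natAbs + 1, by omega, by omega, by omega, by omega⟩
  rw [hK₁ K h1, hK₂ K h2, hK₃ K h3]
  have t1 : ∀ j : ℕ, heis B h' k (heis B h (-(j : ℤ) - 1) (vertexOp B ε α (N - j) u)) =
      heis B h (-(j : ℤ) - 1) (vertexOp B ε α (N - j) (heis B h' k u)) +
      form B h' (cplx α) • heis B h (-(j : ℤ) - 1) (vertexOp B ε α (N - k - j) u) +
      (if (j : ℤ) = k - 1 then ((k : ℂ) * form B h' h) • vertexOp B ε α (N - j) u else 0) := by
    intro j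
    rw [heis_comm B hL.symm, heis_vertexOp hL, map_add, map_smul, sub_right_comm]
    by_cases hj : (j : ℤ) = k - 1
    · rw [if_pos (by omega), if_pos hj]
    · rw [if_neg (by omega), if_neg hj, zero_smul]
  have t2 : ∀ j : ℕ, heis B h' k (vertexOp B ε α (N + 1 + j) (heis B h j u)) =
      vertexOp B ε α (N + 1 + j) (heis B h j (heis B h' k u)) +
      form B h' (cplx α) • vertexOp B ε α (N - k + 1 + j) (heis B h j u) +
      (if (j : ℤ) = -k then ((k : ℂ) * form B h' h) • vertexOp B ε α (N + 1 + j) u else 0) := by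
    intro j
    rw [heis_vertexOp hL, heis_comm B hL.symm, map_add, map_smul,
      show N + 1 + (j : ℤ) - k = N - k + 1 + j by ring]
    by_cases hj : (j : ℤ) = -k
    · rw [if_pos (by omega), if_pos hj]; abel
    · rw [if_neg (by omega), if_neg hj, zero_smul]; abel
  rw [map_add, map_sum, map_sum, Finset.sum_congr rfl fun j _ => t1 j,
    Finset.sum_congr rfl fun j _ => t2 j]
  simp only [Finset.sum_add_distrib, ← Finset.smul_sum, smul_add]
  rw [sum_ite_natCast_eq (fun j => ((k : ℂ) * form B h' h) • vertexOp B ε α (N - j) u),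
    sum_ite_natCast_eq (fun j => ((k : ℂ) * form B h' h) • vertexOp B ε α (N + 1 + j) u)]
  have t3 : (if 0 ≤ k - 1 ∧ k - 1 < (K : ℤ) then
        ((k : ℂ) * form B h' h) • vertexOp B ε α (N - (k - 1)) u else 0) +
      (if 0 ≤ -k ∧ -k < (K : ℤ) then
        ((k : ℂ) * form B h' h) • vertexOp B ε α (N + 1 + -k) u else 0) =
      ((k : ℂ) * form B h' h) • vertexOp B ε α (N - k + 1) u := by
    by_cases h0 : 0 < k
    · rw [if_pos (by omega), if_neg (by omega), add_zero, show N - (k - 1) = N - k + 1 by ring]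
    · rw [if_neg (by omega), if_pos (by omega), zero_add, show N + 1 + -k = N - k + 1 by ring]
  rw [← t3]
  abel

/-- The action of `:h(z) E^α(z):` on a vacuum vector. -/
lemma current_vacuum (hL : IsSignedLattice B ε) (h : ι → ℂ) (α : ι → ℤ) (N : ℤ) (γ : ι → ℤ)
    (T : ℕ) (hT : N < latForm B α γ + T) : current B ε h α N (vec 1 γ) =
      ∑ j ∈ Finset.range T, heis B h (-(j : ℤ) - 1) (vertexOp B ε α (N - j) (vec 1 γ)) +
      form B h (cplx γ) • vertexOp B ε α (N + 1) (vec 1 γ) := by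
  obtain ⟨K, hK⟩ := current_apply hL h α N (vec 1 γ)
  rw [hK (T + K + 1) (by omega)]
  refine congrArg₂ (· + ·) ?_ ?_
  · refine (Finset.sum_subset (Finset.range_mono (by omega)) fun j _ hj => ?_).symm
    rw [Finset.mem_range] at hj
    rw [vertexOp_vacuum_of_lt hL α (by omega), map_zero]
  · rw [Finset.sum_range_succ', Finset.sum_eq_zero, zero_add, Nat.cast_zero, heis_zero, map_smul,
      add_zero]
    intro j _
    rw [heis_pos_vacuum B h (by omega), map_zero]

/-- Vacuum expectations of `:h(z) E^α(z):` only see the annihilation part of `h(z)`. -/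
lemma vac_current (hL : IsSignedLattice B ε) (h : ι → ℂ) (α : ι → ℤ) (N : ℤ) (γ' : ι → ℤ)
    (u : StateSpace ι) : ∃ K₀ : ℕ, ∀ K : ℕ, K₀ ≤ K → vac γ' (current B ε h α N u) =
      ∑ j ∈ Finset.range K, vac γ' (vertexOp B ε α (N + 1 + j) (heis B h j u)) := by
  obtain ⟨K₀, hK₀⟩ := current_apply hL h α N u
  refine ⟨K₀, fun K hK => ?_⟩
  rw [hK₀ K hK, map_add, map_sum, map_sum, Finset.sum_eq_zero, zero_add]
  intro j _
  exact vac_heis_neg γ' h (by omega) _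

lemma vac_current_vacuum (hL : IsSignedLattice B ε) (h : ι → ℂ) (α : ι → ℤ) (N : ℤ)
    (γ γ' : ι → ℤ) : vac γ' (current B ε h α N (vec 1 γ)) =
      if N + 1 = latForm B α γ then form B h (cplx γ) * sgnVac ε α γ γ' else 0 := by
  rw [current_vacuum hL h α N γ (N - latForm B α γ + 1).natAbs (by omega), map_add, map_sum,
    Finset.sum_eq_zero fun j _ => vac_heis_neg γ' h (by omega) _, zero_add, map_smul,
    vac_vertexOp hL]
  split_ifs <;> simp

end Current

/-! ### Operators are determined by vacuum expectations -/

section Criterion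

variable {ι : Type} [Fintype ι] [DecidableEq ι] {B : ι → ι → ℤ}
  {ε : (ι → ℤ) → (ι → ℤ) → ℤˣ}

/-- A polynomial with zero constant term all of whose derivatives lie in a family of such
polynomials (up to linear combinations) vanishes. -/
lemma poly_eq_zero {σ J : Type} (P : J → MvPolynomial σ ℂ)
    (h0 : ∀ j, MvPolynomial.constantCoeff (P j) = 0)
    (hd : ∀ x j, MvPolynomial.pderiv x (P j) ∈ Submodule.span ℂ (Set.range P)) (j : J) :
    P j = 0 := by
  have key : ∀ (d : ℕ) (s : σ →₀ ℕ), s.degree = d → ∀ j, MvPolynomial.coeff s (P j) = 0 := by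
    intro d
    induction d with
    | zero =>
      intro s hs j
      rw [Finsupp.degree_eq_zero_iff] at hs
      rw [hs, ← MvPolynomial.constantCoeff_eq, h0]
    | succ d ih =>
      intro s hs j
      obtain ⟨x, hx⟩ : ∃ x, s x ≠ 0 := by
        by_contra hn
        push Not at hn
        have : s = 0 := Finsupp.ext hn
        rw [this, map_zero] at hs
        omega
      classical
      obtain ⟨s', rfl⟩ : ∃ s', s = s' + Finsupp.single x 1 :=
        ⟨s - Finsupp.single x 1, (tsub_add_cancel_of_le (by
          rw [Finsupp.single_le_iff]; omega)).symm⟩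
      have hs' : s'.degree = d := by
        rw [map_add, Finsupp.degree_single] at hs
        omega
      have hz : MvPolynomial.coeff s' (MvPolynomial.pderiv x (P j)) = 0 := by
        have : Submodule.span ℂ (Set.range P) ≤ LinearMap.ker (MvPolynomial.lcoeff ℂ s') := by
          rw [Submodule.span_le]
          rintro _ ⟨i, rfl⟩
          exact ih s' hs' i
        exact this (hd x j)
      rw [MvPolynomial.coeff_pderiv] at hz
      refine (mul_eq_zero.1 hz).resolve_right ?_
      exact_mod_cast Nat.succ_ne_zero (s' x)
  ext s
  rw [key _ s rfl j, MvPolynomial.coeff_zero]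

/-- Two families of operators with the same commutation relations with the Heisenberg algebra
(`X` stands for terms common to both) and the same vacuum expectations are equal. -/
lemma family_ext (hL : IsSignedLattice B ε) (C C' : ℤ → ℤ → Op ι) (a b : (ι → ℂ) → ℂ)
    (X : (ι → ℂ) → ℤ → ℤ → ℤ → StateSpace ι → StateSpace ι)
    (hC : ∀ h k m n u, heis B h k (C m n u) =
      C m n (heis B h k u) + a h • C (m - k) n u + b h • C m (n - k) u + X h k m n u)
    (hC' : ∀ h k m n u, heis B h k (C' m n u) =
      C' m n (heis B h k u) + a h • C' (m - k) n u + b h • C' m (n - k) u + X h k m n u)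
    (hv : ∀ m n γ γ', vac γ' (C m n (vec 1 γ)) = vac γ' (C' m n (vec 1 γ))) (m n : ℤ) :
    C m n = C' m n := by
  set D : ℤ → ℤ → StateSpace ι → StateSpace ι := fun m n u => C m n u - C' m n u with hD
  have hDC : ∀ h k m n u, heis B h k (D m n u) =
      D m n (heis B h k u) + a h • D (m - k) n u + b h • D m (n - k) u := by
    intro h k m n u
    simp only [hD, map_sub, hC, hC', smul_sub]
    abel
  have hvac : ∀ γ m n, D m n (vec 1 γ) = 0 := by
    intro γ m n
    ext1 γ'
    refine poly_eq_zero (fun p : ℤ × ℤ => D p.1 p.2 (vec 1 γ) γ') ?_ ?_ (m, n)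
    · rintro ⟨m, n⟩
      have := hv m n γ γ'
      rw [← sub_eq_zero, ← map_sub] at this
      exact (vac_apply γ' (D m n (vec 1 γ))).symm.trans this
    · rintro ⟨i, k⟩ ⟨m, n⟩
      -- the partial derivative for the variable `(i, k)` is a multiple of `h_{(k+1)}`, where `h` is
      -- dual to `b_i`
      obtain ⟨h, hh⟩ := hL.dual i
      have h1 : ∀ u : StateSpace ι, (heis B h ((k : ℤ) + 1) u) γ' =
          ((k : ℂ) + 1) • MvPolynomial.pderiv (i, k) (u γ') := by
        intro u
        induction u using Finsupp.induction_linear with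
        | zero => simp
        | add u w hu hw => rw [map_add, Finsupp.add_apply, hu, hw, Finsupp.add_apply, map_add,
            smul_add]
        | single β g =>
          rw [heis_pos, vec, Finsupp.single_apply, Finsupp.single_apply]
          split_ifs
          · simp [annDer_apply, hh]
          · simp
      have h2 := congrArg (fun u : StateSpace ι => u γ') (hDC h ((k : ℤ) + 1) m n (vec 1 γ))
      have hD0 : D m n 0 = 0 := by simp [hD]
      rw [h1, heis_pos_vacuum B h (by omega), hD0, zero_add] at h2
      have hk : (k : ℂ) + 1 ≠ 0 := by exact_mod_cast k.succ_ne_zero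
      have h3 : MvPolynomial.pderiv (i, k) (D m n (vec 1 γ) γ') = ((k : ℂ) + 1)⁻¹ •
          (a h • D (m - (k + 1)) n (vec 1 γ) γ' + b h • D m (n - (k + 1)) (vec 1 γ) γ') := by
        rw [eq_inv_smul_iff₀ hk, h2]; rfl
      rw [h3]
      exact Submodule.smul_mem _ _ (Submodule.add_mem _
        (Submodule.smul_mem _ _ (Submodule.subset_span ⟨(m - (k + 1), n), rfl⟩))
        (Submodule.smul_mem _ _ (Submodule.subset_span ⟨(m, n - (k + 1)), rfl⟩)))
  refine LinearMap.ext fun u => ?_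
  rw [← sub_eq_zero]
  refine state_induction B (P := fun u => ∀ m n, D m n u = 0) ?_ ?_ ?_ hvac ?_ u m n
  · intro m n; simp [hD]
  · intro u w hu hw m n
    have e : D m n (u + w) = D m n u + D m n w := by simp only [hD, map_add]; abel
    rw [e, hu, hw, add_zero]
  · intro s u hu m n
    have e : D m n (s • u) = s • D m n u := by simp only [hD, map_smul, smul_sub]
    rw [e, hu, smul_zero]
  · intro i k u _ hu m n
    have := hDC (Pi.single i 1) k m n u
    rw [hu, hu, hu, map_zero, smul_zero, smul_zero, add_zero, add_zero] at this
    exact this.symm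

/-- `∂_z E^α(z) = :α(z) E^α(z):`. -/
lemma deriv_vertexOp (hL : IsSignedLattice B ε) (α : ι → ℤ) (n : ℤ) (u : StateSpace ι) :
    (n : ℂ) • vertexOp B ε α n u = current B ε (cplx α) α (n - 1) u := by
  have := family_ext hL (fun _ n => (n : ℂ) • vertexOp B ε α n)
    (fun _ n => current B ε (cplx α) α (n - 1)) 0 (fun h => form B h (cplx α))
    (fun h k _ n u => ((k : ℂ) * form B h (cplx α)) • vertexOp B ε α (n - k) u) ?_ ?_ ?_ 0 n
  · exact LinearMap.congr_fun this u
  · intro h k _ n u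
    simp only [LinearMap.smul_apply, map_smul, heis_vertexOp hL, Pi.zero_apply, zero_smul]
    push_cast
    module
  · intro h k _ n u
    rw [heis_current hL, Pi.zero_apply, zero_smul, add_zero, sub_right_comm, sub_add_cancel]
  · intro _ n γ γ'
    rw [LinearMap.smul_apply, map_smul, vac_vertexOp hL, vac_current_vacuum hL, sub_add_cancel,
      form_cplx]
    split_ifs with h
    · rw [h]; simp
    · simp

end Criterion

/-! ### Two-point functions -/

/-- The function `c` gives the coefficients of the expansion of `(1 - x)^a` in powers of `x`; they
are characterized by the differential equation `(1 - x) f' = -a f`. -/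
structure IsBinomialSeries (a : ℤ) (c : ℤ → ℂ) : Prop where
  neg : ∀ x < 0, c x = 0
  zero : c 0 = 1
  succ : ∀ x : ℕ, ((x : ℂ) + 1) * c (x + 1) = -a * ∑ j ∈ Finset.range (x + 1), c j

lemma isBinomialSeries_zero : IsBinomialSeries 0 fun x => if x = 0 then 1 else 0 where
  neg x hx := if_neg hx.ne
  zero := if_pos rfl
  succ x := by rw [if_neg (by omega)]; simp

lemma isBinomialSeries_one :
    IsBinomialSeries 1 fun x => if x = 0 then 1 else if x = 1 then -1 else 0 where
  neg x hx := by rw [if_neg (by omega), if_neg (by omega)]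
  zero := if_pos rfl
  succ x := by
    have h : ∑ j ∈ Finset.range (x + 1), (if (j : ℤ) = 0 then (1 : ℂ) else
        if (j : ℤ) = 1 then -1 else 0) = if x = 0 then 1 else 0 := by
      induction x with
      | zero => simp
      | succ x ih =>
        rw [Finset.sum_range_succ, ih]
        rcases x with _ | x
        · simp
        · rw [if_neg (by omega), if_neg (by omega), if_neg (by omega), if_neg (by omega), add_zero]
    rw [h]
    rcases x with _ | x
    · simp
    · rw [if_neg (by omega), if_neg (by omega), if_neg (by omega)]; simp

lemma isBinomialSeries_two : IsBinomialSeries 2 fun x =>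
    if x = 0 then 1 else if x = 1 then -2 else if x = 2 then 1 else 0 where
  neg x hx := by rw [if_neg (by omega), if_neg (by omega), if_neg (by omega)]
  zero := if_pos rfl
  succ x := by
    have h : ∑ j ∈ Finset.range (x + 1), (if (j : ℤ) = 0 then (1 : ℂ) else
        if (j : ℤ) = 1 then -2 else if (j : ℤ) = 2 then 1 else 0) =
        if x = 0 then 1 else if x = 1 then -1 else 0 := by
      induction x with
      | zero => simp
      | succ x ih =>
        rw [Finset.sum_range_succ, ih]
        rcases x with _ | _ | x
        · norm_num
        · norm_num
        · rw [if_neg (by omega), if_neg (by omega), if_neg (by omega), if_neg (by omega),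
            if_neg (by omega), if_neg (by omega), if_neg (by omega), add_zero]
    rw [h]
    rcases x with _ | _ | x
    · norm_num
    · norm_num
    · rw [if_neg (by omega), if_neg (by omega), if_neg (by omega), if_neg (by omega),
        if_neg (by omega)]; simp

lemma isBinomialSeries_neg_one : IsBinomialSeries (-1) fun x => if 0 ≤ x then 1 else 0 where
  neg x hx := if_neg (by omega)
  zero := if_pos le_rfl
  succ x := by
    rw [if_pos (by omega), Finset.sum_congr rfl fun j _ => if_pos (by omega)]
    simp

lemma isBinomialSeries_neg_two :
    IsBinomialSeries (-2) fun x => if 0 ≤ x then (x : ℂ) + 1 else 0 where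
  neg x hx := if_neg (by omega)
  zero := by simp
  succ x := by
    rw [if_pos (by omega), Finset.sum_congr rfl fun j _ => if_pos (by omega)]
    have h : ∑ j ∈ Finset.range (x + 1), (((j : ℤ) : ℂ) + 1) = ((x : ℂ) + 1) * (x + 2) / 2 := by
      induction x with
      | zero => simp
      | succ x ih => rw [Finset.sum_range_succ, ih]; push_cast; ring
    rw [h]; push_cast; ring

section TwoPoint

variable {ι : Type} [Fintype ι] [DecidableEq ι] {B : ι → ι → ℤ}
  {ε : (ι → ℤ) → (ι → ℤ) → ℤˣ}

lemma sgnVac_mul (hL : IsSignedLattice B ε) (α β γ γ' : ι → ℤ) :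
    (((ε β γ : ℤˣ) : ℤ) : ℂ) * sgnVac ε α (β + γ) γ' =
      (((ε α β : ℤˣ) : ℤ) : ℂ) * sgnVac ε (α + β) γ γ' := by
  simp only [sgnVac, add_assoc, hL.add_left, hL.add_right]
  split_ifs
  · push_cast; ring
  · simp

/-- The two-point function `⟨e^γ', E^α(z) E^β(w) e^γ⟩`, which is a multiple of
`z^{(α|γ)} w^{(β|γ)} (z - w)^{(α|β)}` expanded in powers of `w / z`. -/
lemma two_point (hL : IsSignedLattice B ε) (α β : ι → ℤ) {c : ℤ → ℂ}
    (hc : IsBinomialSeries (latForm B α β) c) (m n : ℤ) (γ γ' : ι → ℤ) :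
    vac γ' (vertexOp B ε α m (vertexOp B ε β n (vec 1 γ))) =
      if m + n = latForm B α γ + latForm B β γ + latForm B α β then
        (((ε α β : ℤˣ) : ℤ) : ℂ) * sgnVac ε (α + β) γ γ' * c (n - latForm B β γ) else 0 := by
  rcases lt_or_ge n (latForm B β γ) with hn | hn
  · rw [vertexOp_vacuum_of_lt hL β hn, hc.neg _ (by omega)]; simp
  obtain ⟨x, rfl⟩ : ∃ x : ℕ, n = latForm B β γ + x := ⟨(n - latForm B β γ).toNat, by omega⟩
  clear hn
  induction x using Nat.strong_induction_on generalizing m with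
  | _ x ih =>
  rcases x with _ | x
  · rw [Nat.cast_zero, add_zero, vertexOp_vacuum_self hL, map_smul, map_smul, vac_vertexOp hL,
      sub_self, hc.zero, latForm_add_right]
    by_cases h : m = latForm B α β + latForm B α γ
    · rw [if_pos h, if_pos (by omega), smul_eq_mul, mul_one, sgnVac_mul hL]
    · rw [if_neg h, if_neg (by omega), smul_zero]
  · have hx : (x : ℂ) + 1 ≠ 0 := by exact_mod_cast x.succ_ne_zero
    set n : ℤ := latForm B β γ + ((x + 1 : ℕ) : ℤ) with hn
    -- `∂_w E^β(w) = :β(w) E^β(w):` expresses the coefficient at `x + 1` by the preceding ones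
    have h1 := deriv_vertexOp hL β n (vec 1 γ)
    rw [current_vacuum hL (cplx β) β (n - 1) γ (x + 1) (by rw [hn]; push_cast; omega), form_cplx,
      sub_add_cancel, ← sub_eq_iff_eq_add, ← sub_smul] at h1
    have h2 : (n : ℂ) - (latForm B β γ : ℂ) = (x : ℂ) + 1 := by rw [hn]; push_cast; ring
    rw [h2] at h1
    have h3 := congrArg (fun u => vac γ' (vertexOp B ε α m u)) h1
    simp only [map_smul, map_sum] at h3
    have h4 : ∀ j ∈ Finset.range (x + 1), vac γ' (vertexOp B ε α m (heis B (cplx β) (-(j : ℤ) - 1)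
        (vertexOp B ε β (n - 1 - j) (vec 1 γ)))) = -(latForm B α β : ℂ) *
        (if m + n = latForm B α γ + latForm B β γ + latForm B α β then
          (((ε α β : ℤˣ) : ℤ) : ℂ) * sgnVac ε (α + β) γ γ' * c ((x + 1 - 1 - j : ℕ) : ℤ)
          else 0) := by
      intro j hj
      rw [Finset.mem_range] at hj
      have e := congrArg (vac γ') (heis_vertexOp hL (cplx β) (-(j : ℤ) - 1) α m
        (vertexOp B ε β (n - 1 - j) (vec 1 γ)))
      rw [vac_heis_neg γ' _ (by omega), map_add, map_smul, form_cplx] at e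
      rw [eq_neg_of_add_eq_zero_left e.symm, smul_eq_mul, latForm_comm hL.symm β α, ← neg_mul,
        show n - 1 - (j : ℤ) = latForm B β γ + ((x + 1 - 1 - j : ℕ) : ℤ) by omega,
        ih (x + 1 - 1 - j) (by omega)]
      congr 1
      by_cases h : m + n = latForm B α γ + latForm B β γ + latForm B α β
      · rw [if_pos h, if_pos (by omega), add_sub_cancel_left]
      · rw [if_neg h, if_neg (by omega)]
    rw [Finset.sum_congr rfl h4, ← Finset.mul_sum] at h3
    rw [← mul_right_inj' hx]
    refine h3.trans ?_
    split_ifs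
    · rw [← Finset.mul_sum, Finset.sum_range_reflect (fun j : ℕ => c (j : ℤ)), mul_left_comm, hn,
        add_sub_cancel_left, Nat.cast_add, Nat.cast_one, mul_left_comm _ _ (c _), hc.succ]
    · simp

end TwoPoint

/-! ### Commutators of vertex operators -/

section Commutator

variable {ι : Type} [Fintype ι] [DecidableEq ι] {B : ι → ι → ℤ}
  {ε : (ι → ℤ) → (ι → ℤ) → ℤˣ}

/-- The commutator of `E^α(z)` and `E^β(w)` is the field `R` if `R` has the commutators with
`h_{(k)}` that are forced by the derivation property and the vacuum expectations given by the
difference `ρ` of the two expansions of `(z - w)^{(α|β)}`. -/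
lemma comm_vertexOp (hL : IsSignedLattice B ε) (α β : ι → ℤ) {a : ℤ} (ha : latForm B α β = a)
    {c ρ : ℤ → ℂ} {σ : ℂ} (hc : IsBinomialSeries a c)
    (hσ : (((ε β α : ℤˣ) : ℤ) : ℂ) = σ * (((ε α β : ℤˣ) : ℤ) : ℂ))
    (hρ : ∀ x y, x + y = a → c x = σ * c y + ρ x) (R : ℤ → ℤ → Op ι)
    (hR : ∀ h k m n u, heis B h k (R m n u) = R m n (heis B h k u) +
      form B h (cplx α) • R (m - k) n u + form B h (cplx β) • R m (n - k) u)
    (hvR : ∀ m n γ γ', vac γ' (R m n (vec 1 γ)) =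
      if m + n = latForm B α γ + latForm B β γ + a then
        (((ε α β : ℤˣ) : ℤ) : ℂ) * sgnVac ε (α + β) γ γ' * ρ (n - latForm B β γ) else 0)
    (m n : ℤ) (u : StateSpace ι) :
    vertexOp B ε α m (vertexOp B ε β n u) = vertexOp B ε β n (vertexOp B ε α m u) + R m n u := by
  subst ha
  have := family_ext hL (fun m n => vertexOp B ε α m * vertexOp B ε β n)
    (fun m n => vertexOp B ε β n * vertexOp B ε α m + R m n)
    (fun h => form B h (cplx α)) (fun h => form B h (cplx β)) (fun _ _ _ _ _ => 0) ?_ ?_ ?_ m n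
  · exact LinearMap.congr_fun this u
  · intro h k m n u
    simp only [Module.End.mul_apply, heis_vertexOp hL, map_add, map_smul]
    module
  · intro h k m n u
    simp only [LinearMap.add_apply, Module.End.mul_apply, heis_vertexOp hL, map_add, map_smul, hR]
    module
  · intro m n γ γ'
    have hc' : IsBinomialSeries (latForm B β α) c := by rwa [latForm_comm hL.symm]
    rw [LinearMap.add_apply, Module.End.mul_apply, Module.End.mul_apply, map_add,
      two_point hL α β hc, two_point hL β α hc', hvR, latForm_comm hL.symm β α, add_comm β α, hσ]
    by_cases h : m + n = latForm B α γ + latForm B β γ + latForm B α β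
    · rw [if_pos h, if_pos h, if_pos (by omega),
        hρ (n - latForm B β γ) (m - latForm B α γ) (by omega)]
      ring
    · rw [if_neg h, if_neg h, if_neg (by omega), add_zero]

/-- Vertex operators whose two-point function has no pole commute. -/
lemma comm_vertexOp_of_regular (hL : IsSignedLattice B ε) (α β : ι → ℤ) {a : ℤ}
    (ha : latForm B α β = a) {c : ℤ → ℂ} {σ : ℂ} (hc : IsBinomialSeries a c)
    (hσ : (((ε β α : ℤˣ) : ℤ) : ℂ) = σ * (((ε α β : ℤˣ) : ℤ) : ℂ))
    (hρ : ∀ x y, x + y = a → c x = σ * c y) (m n : ℤ) (u : StateSpace ι) :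
    vertexOp B ε α m (vertexOp B ε β n u) = vertexOp B ε β n (vertexOp B ε α m u) := by
  have := comm_vertexOp hL α β ha (ρ := 0) hc hσ (fun x y h => by simpa using hρ x y h) 0
    (by simp) (by simp) m n u
  simpa using this

lemma comm_vertexOp_zero (hL : IsSignedLattice B ε) (α β : ι → ℤ) (ha : latForm B α β = 0)
    (hσ : ε β α = ε α β) (m n : ℤ) (u : StateSpace ι) :
    vertexOp B ε α m (vertexOp B ε β n u) = vertexOp B ε β n (vertexOp B ε α m u) :=
  comm_vertexOp_of_regular hL α β ha (σ := 1) isBinomialSeries_zero (by simp [hσ])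
    (fun x y h => by
      by_cases hx : x = 0
      · rw [if_pos hx, if_pos (by omega), one_mul]
      · rw [if_neg hx, if_neg (by omega), mul_zero]) m n u

lemma comm_vertexOp_one (hL : IsSignedLattice B ε) (α β : ι → ℤ) (ha : latForm B α β = 1)
    (hσ : ε β α = -ε α β) (m n : ℤ) (u : StateSpace ι) :
    vertexOp B ε α m (vertexOp B ε β n u) = vertexOp B ε β n (vertexOp B ε α m u) :=
  comm_vertexOp_of_regular hL α β ha (σ := -1) isBinomialSeries_one (by simp [hσ])
    (fun x y h => by
      obtain rfl : y = 1 - x := by omega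
      by_cases h0 : x = 0
      · subst h0; norm_num
      · by_cases h1 : x = 1
        · subst h1; norm_num
        · rw [if_neg h0, if_neg h1, if_neg (by omega), if_neg (by omega), mul_zero]) m n u

lemma comm_vertexOp_two (hL : IsSignedLattice B ε) (α β : ι → ℤ) (ha : latForm B α β = 2)
    (hσ : ε β α = ε α β) (m n : ℤ) (u : StateSpace ι) :
    vertexOp B ε α m (vertexOp B ε β n u) = vertexOp B ε β n (vertexOp B ε α m u) :=
  comm_vertexOp_of_regular hL α β ha (σ := 1) isBinomialSeries_two (by simp [hσ])
    (fun x y h => by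
      obtain rfl : y = 2 - x := by omega
      by_cases h0 : x = 0
      · subst h0; norm_num
      · by_cases h1 : x = 1
        · subst h1; norm_num
        · by_cases h2 : x = 2
          · subst h2; norm_num
          · rw [if_neg h0, if_neg h1, if_neg h2, if_neg (by omega), if_neg (by omega),
              if_neg (by omega), mul_zero]) m n u

/-- `[E^α(z), E^β(w)] = ε(α, β) E^{α+β}(w) δ(z, w)` when `(α|β) = -1`. -/
lemma comm_vertexOp_neg_one (hL : IsSignedLattice B ε) (α β : ι → ℤ) (ha : latForm B α β = -1)
    (hσ : ε β α = -ε α β) (m n : ℤ) (u : StateSpace ι) :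
    vertexOp B ε α m (vertexOp B ε β n u) = vertexOp B ε β n (vertexOp B ε α m u) +
      (((ε α β : ℤˣ) : ℤ) : ℂ) • vertexOp B ε (α + β) (m + n + 1) u := by
  refine comm_vertexOp hL α β ha (ρ := fun _ => 1) (σ := -1) isBinomialSeries_neg_one
    (by simp [hσ]) (fun x y h => ?_)
    (fun m n => (((ε α β : ℤˣ) : ℤ) : ℂ) • vertexOp B ε (α + β) (m + n + 1)) ?_ ?_ m n u
  · by_cases hx : 0 ≤ x
    · rw [if_pos hx, if_neg (by omega)]; norm_num
    · rw [if_neg hx, if_pos (by omega)]; norm_num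
  · intro h k m n u
    simp only [LinearMap.smul_apply, map_smul, heis_vertexOp hL, cplx_add, form_add_right]
    rw [show m - k + n + 1 = m + n + 1 - k by ring, show m + (n - k) + 1 = m + n + 1 - k by ring]
    module
  · intro m n γ γ'
    rw [LinearMap.smul_apply, map_smul, vac_vertexOp hL, latForm_add_left]
    by_cases h : m + n = latForm B α γ + latForm B β γ + -1
    · rw [if_pos h, if_pos (by omega), smul_eq_mul, mul_one]
    · rw [if_neg h, if_neg (by omega), smul_zero]

variable (B ε) in
/-- The coefficient of `z^m w^n` in `∂_wδ(z, w) E^α(z) E^β(w)` for commuting `E^α(z)`, `E^β(w)`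
with `(α|β) = 0`, or in the commutator of `E^α(z)`, `E^β(w)` with `(α|β) = -2`; in both cases up to
the sign `ε(α, β)`. -/
def anomaly (α β : ι → ℤ) (m n : ℤ) : Op ι :=
  ((n : ℂ) + 1) • vertexOp B ε (α + β) (m + n + 2) +
    (-1 : ℂ) • current B ε (cplx β) (α + β) (m + n + 1)

lemma heis_anomaly (hL : IsSignedLattice B ε) (α β : ι → ℤ) (h : ι → ℂ) (k m n : ℤ)
    (u : StateSpace ι) : heis B h k (anomaly B ε α β m n u) = anomaly B ε α β m n (heis B h k u) +
      form B h (cplx α) • anomaly B ε α β (m - k) n u +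
      form B h (cplx β) • anomaly B ε α β m (n - k) u := by
  simp only [anomaly, LinearMap.add_apply, LinearMap.smul_apply, map_add, map_smul,
    heis_vertexOp hL, heis_current hL, cplx_add, form_add_right]
  rw [show m - k + n + 2 = m + n + 2 - k by ring, show m + (n - k) + 2 = m + n + 2 - k by ring,
    show m - k + n + 1 = m + n + 1 - k by ring, show m + (n - k) + 1 = m + n + 1 - k by ring,
    show m + n + 1 - k + 1 = m + n + 2 - k by ring]
  push_cast
  module

lemma vac_anomaly (hL : IsSignedLattice B ε) (α β : ι → ℤ) (m n : ℤ) (γ γ' : ι → ℤ) :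
    vac γ' (anomaly B ε α β m n (vec 1 γ)) =
      if m + n + 2 = latForm B α γ + latForm B β γ then
        sgnVac ε (α + β) γ γ' * ((n - latForm B β γ : ℤ) + 1) else 0 := by
  rw [anomaly, LinearMap.add_apply, LinearMap.smul_apply, LinearMap.smul_apply, map_add, map_smul,
    map_smul, vac_vertexOp hL, vac_current_vacuum hL, latForm_add_left, form_cplx]
  by_cases h : m + n + 2 = latForm B α γ + latForm B β γ
  · rw [if_pos h, if_pos h, if_pos (by omega), smul_eq_mul, smul_eq_mul]
    push_cast; ring
  · rw [if_neg h, if_neg h, if_neg (by omega)]; simp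

lemma comm_vertexOp_neg_two (hL : IsSignedLattice B ε) (α β : ι → ℤ) (ha : latForm B α β = -2)
    (hσ : ε β α = ε α β) (m n : ℤ) (u : StateSpace ι) :
    vertexOp B ε α m (vertexOp B ε β n u) = vertexOp B ε β n (vertexOp B ε α m u) +
      (((ε α β : ℤˣ) : ℤ) : ℂ) • anomaly B ε α β m n u := by
  refine comm_vertexOp hL α β ha (ρ := fun x => (x : ℂ) + 1) (σ := 1) isBinomialSeries_neg_two
    (by simp [hσ]) (fun x y h => ?_)
    (fun m n => (((ε α β : ℤˣ) : ℤ) : ℂ) • anomaly B ε α β m n) ?_ ?_ m n u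
  · by_cases hx : 0 ≤ x
    · rw [if_pos hx, if_neg (by omega)]; norm_num
    · rw [if_neg hx]
      split_ifs
      · obtain rfl : y = -2 - x := by omega
        push_cast; ring
      · obtain rfl : x = -1 := by omega
        norm_num
  · intro h k m n u
    simp only [LinearMap.smul_apply, map_smul, heis_anomaly hL]
    module
  · intro m n γ γ'
    rw [LinearMap.smul_apply, map_smul, vac_anomaly hL]
    by_cases h : m + n = latForm B α γ + latForm B β γ + -2
    · rw [if_pos h, if_pos (by omega), smul_eq_mul, mul_assoc]
    · rw [if_neg h, if_neg (by omega), smul_zero]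

lemma heis_vacuum (h : ι → ℂ) (j : ℕ) (γ : ι → ℤ) :
    heis B h (j : ℤ) (vec 1 γ) = (if (j : ℤ) = 0 then form B h (cplx γ) else 0) • vec 1 γ := by
  split_ifs with hj
  · rw [hj, heis_zero]
  · rw [heis_pos_vacuum B h (by omega), zero_smul]

/-- `[:h(z) E^δ(z):, E^β(w)] = (h|β) ε(δ, β) E^{δ+β}(w) δ(z, w)` when `(δ|β) = 0`. -/
lemma comm_current_vertexOp (hL : IsSignedLattice B ε) (h : ι → ℂ) (δ β : ι → ℤ)
    (hδβ : latForm B δ β = 0) (hσ : ε β δ = ε δ β)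
    (m n : ℤ) (u : StateSpace ι) :
    current B ε h δ m (vertexOp B ε β n u) = vertexOp B ε β n (current B ε h δ m u) +
      (form B h (cplx β) * (((ε δ β : ℤˣ) : ℤ) : ℂ)) • vertexOp B ε (δ + β) (m + n + 1) u := by
  have := family_ext hL (fun m n => current B ε h δ m * vertexOp B ε β n)
    (fun m n => vertexOp B ε β n * current B ε h δ m +
      (form B h (cplx β) * (((ε δ β : ℤˣ) : ℤ) : ℂ)) • vertexOp B ε (δ + β) (m + n + 1))
    (fun h' => form B h' (cplx δ)) (fun h' => form B h' (cplx β))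
    (fun h' k m n u => ((k : ℂ) * form B h' h) •
      vertexOp B ε δ (m - k + 1) (vertexOp B ε β n u)) ?_ ?_ ?_ m n
  · exact LinearMap.congr_fun this u
  · intro h' k m n u
    simp only [Module.End.mul_apply, heis_vertexOp hL, heis_current hL, map_add, map_smul]
    module
  · intro h' k m n u
    simp only [LinearMap.add_apply, LinearMap.smul_apply, Module.End.mul_apply, heis_vertexOp hL,
      heis_current hL, map_add, map_smul, cplx_add, form_add_right,
      comm_vertexOp_zero hL δ β hδβ hσ]
    rw [show m - k + n + 1 = m + n + 1 - k by ring, show m + (n - k) + 1 = m + n + 1 - k by ring]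
    module
  · intro m n γ γ'
    have hβδ : latForm B β δ = 0 := by rw [latForm_comm hL.symm, hδβ]
    have tp := fun m n => two_point hL δ β (hδβ.symm ▸ isBinomialSeries_zero) m n γ γ'
    have tp' := fun m n => two_point hL β δ (hβδ.symm ▸ isBinomialSeries_zero) m n γ γ'
    rw [hδβ] at tp
    rw [hβδ, hσ, add_comm β δ] at tp'
    rw [LinearMap.add_apply, Module.End.mul_apply, Module.End.mul_apply, LinearMap.smul_apply,
      map_add, map_smul, vac_vertexOp hL, latForm_add_left]
    set s : ℂ := (((ε δ β : ℤˣ) : ℤ) : ℂ)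
    set S : ℂ := sgnVac ε (δ + β) γ γ'
    obtain ⟨K₀, hK₀⟩ := vac_current hL h δ m γ' (vertexOp B ε β n (vec 1 γ))
    rw [hK₀ (K₀ + (n - latForm B β γ).natAbs + 1) (by omega),
      current_vacuum hL h δ m γ ((m - latForm B δ γ).natAbs + 1) (by omega), map_add, map_smul,
      map_add, map_smul, map_sum, map_sum]
    have t1 : ∀ j : ℕ, vac γ' (vertexOp B ε δ (m + 1 + j) (heis B h j (vertexOp B ε β n (vec 1 γ))))
        = (if (j : ℤ) = 0 then form B h (cplx γ) *
            vac γ' (vertexOp B ε δ (m + 1 + j) (vertexOp B ε β n (vec 1 γ))) else 0) +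
          form B h (cplx β) * (if (j : ℤ) = n - latForm B β γ then
            if m + n + 1 = latForm B δ γ + latForm B β γ then s * S else 0 else 0) := by
      intro j
      rw [heis_vertexOp hL, map_add, map_smul, map_add, map_smul, heis_vacuum, map_smul, map_smul,
        map_smul, tp _ (n - j), smul_eq_mul, smul_eq_mul]
      congr 1
      · split_ifs <;> simp
      · congr 1
        by_cases hj : (j : ℤ) = n - latForm B β γ
        · rw [if_pos hj, if_pos (by omega : n - (j : ℤ) - latForm B β γ = 0), mul_one]
          congr 1; simp only [eq_iff_iff]; omega
        · rw [if_neg hj, if_neg (by omega : ¬n - (j : ℤ) - latForm B β γ = 0), mul_zero, ite_self]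
    have t2 : ∀ j : ℕ, vac γ' (vertexOp B ε β n (heis B h (-(j : ℤ) - 1)
        (vertexOp B ε δ (m - j) (vec 1 γ)))) = -form B h (cplx β) *
          (if (j : ℤ) = m - latForm B δ γ then
            if m + n + 1 = latForm B δ γ + latForm B β γ then s * S else 0 else 0) := by
      intro j
      have e := congrArg (vac γ') (heis_vertexOp hL h (-(j : ℤ) - 1) β n
        (vertexOp B ε δ (m - j) (vec 1 γ)))
      rw [vac_heis_neg γ' _ (by omega), map_add, map_smul, tp', smul_eq_mul] at e
      rw [eq_neg_of_add_eq_zero_left e.symm, neg_mul]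
      congr 2
      by_cases hj : (j : ℤ) = m - latForm B δ γ
      · rw [if_pos hj, if_pos (by omega : m - (j : ℤ) - latForm B δ γ = 0), mul_one]
        congr 1; simp only [eq_iff_iff]; omega
      · rw [if_neg hj, if_neg (by omega : ¬m - (j : ℤ) - latForm B δ γ = 0), mul_zero, ite_self]
    rw [Finset.sum_congr rfl fun j _ => t1 j, Finset.sum_congr rfl fun j _ => t2 j,
      Finset.sum_add_distrib, ← Finset.mul_sum, ← Finset.mul_sum,
      sum_ite_natCast_eq (fun j => form B h (cplx γ) *
        vac γ' (vertexOp B ε δ (m + 1 + j) (vertexOp B ε β n (vec 1 γ)))),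
      sum_ite_natCast_eq (fun _ => if m + n + 1 = latForm B δ γ + latForm B β γ then s * S else 0),
      sum_ite_natCast_eq (fun _ => if m + n + 1 = latForm B δ γ + latForm B β γ then s * S else 0),
      if_pos (by omega), tp, tp']
    by_cases hT : m + n + 1 = latForm B δ γ + latForm B β γ
    · simp only [if_pos hT]
      rw [if_pos (by omega : m + 1 + 0 + n = _), if_pos (by omega : n + (m + 1) = _)]
      have e1 : (if m + 1 - latForm B δ γ = 0 then (1 : ℂ) else 0) =
          if n - latForm B β γ = 0 then 1 else 0 := by
        congr 1; simp only [eq_iff_iff]; omega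
      rw [e1]
      by_cases hx : 0 ≤ n - latForm B β γ
      · rw [if_pos (by omega : 0 ≤ n - latForm B β γ ∧ _),
          if_neg (by omega : ¬(0 ≤ m - latForm B δ γ ∧ _)), smul_eq_mul, smul_eq_mul]
        ring
      · rw [if_neg (by omega : ¬(0 ≤ n - latForm B β γ ∧ _)),
          if_pos (by omega : (0 ≤ m - latForm B δ γ ∧ _)), smul_eq_mul, smul_eq_mul]
        ring
    · simp only [if_neg hT]
      rw [if_neg (by omega : ¬m + 1 + 0 + n = _), if_neg (by omega : ¬n + (m + 1) = _)]
      simp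

end Commutator

/-! ### Commutators of currents -/

section CurrentCommutator

variable {ι : Type} [Fintype ι] [DecidableEq ι] {B : ι → ι → ℤ}
  {ε : (ι → ℤ) → (ι → ℤ) → ℤˣ}

/-- The two-point function of two currents. -/
lemma two_point_current (hL : IsSignedLattice B ε) (h h' : ι → ℂ) (δ δ' : ι → ℤ)
    (hδ : latForm B δ δ' = 0) (h1 : form B h (cplx δ') = 0) (h2 : form B h' (cplx δ) = 0)
    (m n : ℤ) (γ γ' : ι → ℤ) :
    vac γ' (current B ε h δ m (current B ε h' δ' n (vec 1 γ))) =
      if m + n + 2 = latForm B δ γ + latForm B δ' γ then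
        (((ε δ δ' : ℤˣ) : ℤ) : ℂ) * sgnVac ε (δ + δ') γ γ' *
          ((if n + 1 = latForm B δ' γ then form B h (cplx γ) * form B h' (cplx γ) else 0) +
            form B h h' * (if 0 ≤ n + 1 - latForm B δ' γ then
              ((n + 1 - latForm B δ' γ : ℤ) : ℂ) else 0)) else 0 := by
  have tp := fun m n => two_point hL δ δ' (hδ.symm ▸ isBinomialSeries_zero) m n γ γ'
  rw [hδ] at tp
  set s : ℂ := (((ε δ δ' : ℤˣ) : ℤ) : ℂ)
  set S : ℂ := sgnVac ε (δ + δ') γ γ'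
  have tp1 : vac γ' (vertexOp B ε δ (m + 1) (current B ε h' δ' n (vec 1 γ))) =
      form B h' (cplx γ) * if m + n + 2 = latForm B δ γ + latForm B δ' γ then
        if n + 1 = latForm B δ' γ then s * S else 0 else 0 := by
    rw [current_vacuum hL h' δ' n γ ((n - latForm B δ' γ).natAbs + 1) (by omega), map_add,
      map_smul, map_add, map_smul, map_sum, map_sum, Finset.sum_eq_zero, zero_add, tp, smul_eq_mul]
    · congr 1
      by_cases h : m + n + 2 = latForm B δ γ + latForm B δ' γ
      · rw [if_pos h, if_pos (by omega : m + 1 + (n + 1) = _)]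
        by_cases h' : n + 1 = latForm B δ' γ
        · rw [if_pos h', if_pos (by omega), mul_one]
        · rw [if_neg h', if_neg (by omega), mul_zero]
      · rw [if_neg h, if_neg (by omega)]
    · intro j _
      have e := congrArg (vac γ') (heis_vertexOp hL h' (-(j : ℤ) - 1) δ (m + 1)
        (vertexOp B ε δ' (n - j) (vec 1 γ)))
      rw [vac_heis_neg γ' _ (by omega), map_add, h2, zero_smul, map_zero, add_zero] at e
      exact e.symm
  obtain ⟨K₀, hK₀⟩ := vac_current hL h δ m γ' (current B ε h' δ' n (vec 1 γ))
  rw [hK₀ (K₀ + (n + 1 - latForm B δ' γ).natAbs + 1) (by omega)]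
  have t1 : ∀ j : ℕ, vac γ' (vertexOp B ε δ (m + 1 + j)
      (heis B h j (current B ε h' δ' n (vec 1 γ)))) =
      (if (j : ℤ) = 0 then form B h (cplx γ) * vac γ' (vertexOp B ε δ (m + 1)
        (current B ε h' δ' n (vec 1 γ))) else 0) +
      form B h h' * (if (j : ℤ) = n + 1 - latForm B δ' γ then
        if m + n + 2 = latForm B δ γ + latForm B δ' γ then
          (((n + 1 - latForm B δ' γ : ℤ) : ℂ)) * (s * S) else 0 else 0) := by
    intro j
    rw [heis_current hL, h1, zero_smul, add_zero, heis_vacuum, map_smul, map_add, map_smul,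
      map_smul, map_add, map_smul, map_smul, tp, smul_eq_mul, smul_eq_mul]
    congr 1
    · by_cases hj : (j : ℤ) = 0
      · rw [if_pos hj, if_pos hj, hj, add_zero]
      · rw [if_neg hj, if_neg hj, zero_mul]
    · rw [mul_comm _ (form B h h'), mul_assoc]
      congr 1
      by_cases hj : (j : ℤ) = n + 1 - latForm B δ' γ
      · rw [if_pos hj, if_pos (by omega : n - (j : ℤ) + 1 - latForm B δ' γ = 0), mul_one, ← hj]
        by_cases h : m + n + 2 = latForm B δ γ + latForm B δ' γ
        · rw [if_pos h, if_pos (by omega)]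
        · rw [if_neg h, if_neg (by omega), mul_zero]
      · rw [if_neg hj, if_neg (by omega : ¬n - (j : ℤ) + 1 - latForm B δ' γ = 0), mul_zero,
          ite_self, mul_zero]
  rw [Finset.sum_congr rfl fun j _ => t1 j, Finset.sum_add_distrib, ← Finset.mul_sum,
    sum_ite_natCast_eq (fun _ => form B h (cplx γ) * vac γ' (vertexOp B ε δ (m + 1)
        (current B ε h' δ' n (vec 1 γ)))),
    sum_ite_natCast_eq (fun _ => if m + n + 2 = latForm B δ γ + latForm B δ' γ then
          (((n + 1 - latForm B δ' γ : ℤ) : ℂ)) * (s * S) else 0), if_pos (by omega), tp1]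
  by_cases h : m + n + 2 = latForm B δ γ + latForm B δ' γ
  · simp only [if_pos h]
    by_cases hx : 0 ≤ n + 1 - latForm B δ' γ
    · rw [if_pos (by omega : 0 ≤ n + 1 - latForm B δ' γ ∧ _), if_pos hx]
      split_ifs <;> ring
    · rw [if_neg (by omega : ¬(0 ≤ n + 1 - latForm B δ' γ ∧ _)), if_neg hx]
      split_ifs <;> ring
  · simp [if_neg h]

/-- `[:h(z) E^δ(z):, :h'(w) E^δ'(w):] = (h|h') E^δ(z) E^δ'(w) ∂_wδ(z, w)` when `δ`, `δ'` are
orthogonal to each other and to `h'`, `h` respectively. -/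
lemma comm_current_current (hL : IsSignedLattice B ε) (h h' : ι → ℂ) (δ δ' : ι → ℤ)
    (hδ : latForm B δ δ' = 0) (h1 : form B h (cplx δ') = 0) (h2 : form B h' (cplx δ) = 0)
    (hσ : ε δ' δ = ε δ δ') (m n : ℤ) (u : StateSpace ι) :
    current B ε h δ m (current B ε h' δ' n u) = current B ε h' δ' n (current B ε h δ m u) +
      (form B h h' * (((ε δ δ' : ℤˣ) : ℤ) : ℂ)) • anomaly B ε δ δ' m n u := by
  have hδ' : latForm B δ' δ = 0 := by rw [latForm_comm hL.symm, hδ]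
  have c1 : ∀ m n u, current B ε h' δ' n (vertexOp B ε δ m u) =
      vertexOp B ε δ m (current B ε h' δ' n u) := by
    intro m n u
    rw [comm_current_vertexOp hL h' δ' δ hδ' hσ.symm, h2, zero_mul, zero_smul, add_zero]
  have c2 : ∀ m n u, current B ε h δ m (vertexOp B ε δ' n u) =
      vertexOp B ε δ' n (current B ε h δ m u) := by
    intro m n u
    rw [comm_current_vertexOp hL h δ δ' hδ hσ, h1, zero_mul, zero_smul, add_zero]
  have := family_ext hL (fun m n => current B ε h δ m * current B ε h' δ' n)
    (fun m n => current B ε h' δ' n * current B ε h δ m +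
      (form B h h' * (((ε δ δ' : ℤˣ) : ℤ) : ℂ)) • anomaly B ε δ δ' m n)
    (fun k => form B k (cplx δ)) (fun k => form B k (cplx δ'))
    (fun h'' k m n u => ((k : ℂ) * form B h'' h) •
        vertexOp B ε δ (m - k + 1) (current B ε h' δ' n u) +
      ((k : ℂ) * form B h'' h') • vertexOp B ε δ' (n - k + 1) (current B ε h δ m u))
    ?_ ?_ ?_ m n
  · exact LinearMap.congr_fun this u
  · intro h'' k m n u
    simp only [Module.End.mul_apply, heis_current hL, map_add, map_smul, c2]
    module
  · intro h'' k m n u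
    simp only [LinearMap.add_apply, LinearMap.smul_apply, Module.End.mul_apply, heis_current hL,
      map_add, map_smul, c1, heis_anomaly hL]
    module
  · intro m n γ γ'
    rw [LinearMap.add_apply, Module.End.mul_apply, Module.End.mul_apply, LinearMap.smul_apply,
      map_add, map_smul, two_point_current hL h h' δ δ' hδ h1 h2,
      two_point_current hL h' h δ' δ hδ' h2 h1, vac_anomaly hL, hσ, add_comm δ' δ,
      form_comm hL.symm h' h]
    by_cases hT : m + n + 2 = latForm B δ γ + latForm B δ' γ
    · rw [if_pos hT, if_pos (by omega : n + m + 2 = latForm B δ' γ + latForm B δ γ), if_pos hT,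
        smul_eq_mul]
      have e1 : (if m + 1 = latForm B δ γ then form B h' (cplx γ) * form B h (cplx γ) else 0) =
          if n + 1 = latForm B δ' γ then form B h (cplx γ) * form B h' (cplx γ) else 0 := by
        rw [mul_comm]; congr 1; simp only [eq_iff_iff]; omega
      have e2 : m + 1 - latForm B δ γ = -(n + 1 - latForm B δ' γ) := by omega
      have e3 : (((n - latForm B δ' γ : ℤ) : ℂ)) + 1 = ((n + 1 - latForm B δ' γ : ℤ) : ℂ) := by
        push_cast; ring
      rw [e1, e2, e3]
      rcases lt_trichotomy (n + 1 - latForm B δ' γ) 0 with hx | hx | hx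
      · rw [if_neg (by omega : ¬0 ≤ n + 1 - latForm B δ' γ),
          if_pos (by omega : 0 ≤ -(n + 1 - latForm B δ' γ))]
        push_cast; ring
      · rw [hx]; simp
      · rw [if_pos hx.le, if_neg (by omega : ¬0 ≤ -(n + 1 - latForm B δ' γ))]
        push_cast; ring
    · rw [if_neg hT, if_neg (by omega : ¬n + m + 2 = latForm B δ' γ + latForm B δ γ), if_neg hT]
      simp

end CurrentCommutator

/-! ### Modes of vectors of low degree -/

section Modes

variable {ι : Type} [Fintype ι] [DecidableEq ι] (B : ι → ι → ℤ)
  (ε : (ι → ℤ) → (ι → ℤ) → ℤˣ)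

lemma stateField_monomial (α : ι → ℤ) (s : ι × ℕ →₀ ℕ) :
    stateField B ε (vec (MvPolynomial.monomial s 1) α) = monomialField B ε α s := by
  rw [stateField, vec, Finsupp.lsum_single]
  have h := (MvPolynomial.basisMonomials (ι × ℕ) ℂ).constr_basis ℂ (monomialField B ε α) s
  rwa [MvPolynomial.coe_basisMonomials] at h

lemma mode_one (α : ι → ℤ) (m : ℤ) : mode B ε (vec 1 α) m = vertexOp B ε α (-m - 1) := by
  have h := stateField_monomial B ε α 0
  rw [MvPolynomial.monomial_zero', map_one] at h
  rw [mode, h]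
  simp [monomialField]

lemma mode_neg (h : ι → ℂ) (α : ι → ℤ) (m : ℤ) :
    mode B ε (vec (neg h 0) α) m = current B ε h α (-m - 1) := by
  have e : vec (neg h 0) α =
      ∑ i, h i • vec (MvPolynomial.monomial (Finsupp.single (i, 0) 1) 1) α := by
    simp only [vec, neg, Finsupp.smul_single]
    rw [← Finsupp.single_finsetSum]
    exact congrArg _ (Finset.sum_congr rfl fun i _ => by
      rw [MvPolynomial.smul_eq_C_mul]; rfl)
  rw [mode, e, map_sum]
  simp only [map_smul, stateField_monomial, Finset.sum_apply, Pi.smul_apply, current]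
  refine Finset.sum_congr rfl fun i _ => ?_
  simp [monomialField]

/-- `:h(z) E^α(z):` as a linear function of `h`. -/
def currentₗ (α : ι → ℤ) (N : ℤ) :
    (ι → ℂ) →ₗ[ℂ] Op ι where
  toFun h := current B ε h α N
  map_add' h h' := by
    simp only [current, Pi.add_apply, add_smul, Finset.sum_add_distrib]
  map_smul' s h := by
    simp only [current, Pi.smul_apply, smul_assoc, Finset.smul_sum, RingHom.id_apply]

lemma currentₗ_apply (h : ι → ℂ) (α : ι → ℤ) (N : ℤ) :
    currentₗ B ε α N h = current B ε h α N := rfl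

end Modes

/-! ### The lattice `Γ` -/

section Bimult

variable {ι : Type} [Fintype ι] (c : ι → ι → ℤˣ)

lemma bimult_add_left (α β γ : ι → ℤ) : bimult c (α + β) γ = bimult c α γ * bimult c β γ := by
  simp only [bimult, Pi.add_apply, add_mul, zpow_add, Finset.prod_mul_distrib]

lemma bimult_add_right (α β γ : ι → ℤ) : bimult c α (β + γ) = bimult c α β * bimult c α γ := by
  simp only [bimult, Pi.add_apply, mul_add, zpow_add, Finset.prod_mul_distrib]

lemma bimult_sub_left (α β γ : ι → ℤ) : bimult c (α - β) γ = bimult c α γ * bimult c β γ := by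
  have h := bimult_add_left c (α - β) β γ
  rw [sub_add_cancel] at h
  rw [h, mul_assoc, Int.units_mul_self, mul_one]

lemma bimult_sub_right (α β γ : ι → ℤ) : bimult c α (β - γ) = bimult c α β * bimult c α γ := by
  have h := bimult_add_right c α (β - γ) γ
  rw [sub_add_cancel] at h
  rw [h, mul_assoc, Int.units_mul_self, mul_one]

lemma bimult_single [DecidableEq ι] (i j : ι) :
    bimult c (Pi.single i 1) (Pi.single j 1) = c i j := by
  rw [bimult, Finset.prod_eq_single i, Finset.prod_eq_single j]
  · simp
  · intro k _ hk; simp [Pi.single_eq_of_ne hk]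
  · simp
  · intro k _ hk; simp [Pi.single_eq_of_ne hk]
  · simp

lemma form_single [DecidableEq ι] (B : ι → ι → ℤ) (i j : ι) :
    form B (Pi.single i 1) (Pi.single j 1) = B i j := by
  simp [form, Pi.single_apply]

end Bimult

section Gamma

variable {ℓ r : ℕ}

lemma latForm_gram (α β : Idx ℓ r → ℤ) : latForm (gram ℓ r) α β =
    ∑ i, α (.inl i) * β (.inl i) + (∑ ν, α (.inr (.inl ν)) * β (.inr (.inr ν)) +
      ∑ ν, α (.inr (.inr ν)) * β (.inr (.inl ν))) := by
  simp [latForm, Fintype.sum_sum_type, gram, ite_mul]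

/-- The sign `ε` of `Γ`. -/
def sgnΓ (ℓ : ℕ) {r : ℕ} (c : Fin r → Fin r → ℤˣ) : (Idx ℓ r → ℤ) → (Idx ℓ r → ℤ) → ℤˣ :=
  bimult (signTable ℓ r c)

lemma isSignedLattice_gram (c : Fin r → Fin r → ℤˣ) :
    IsSignedLattice (gram ℓ r) (sgnΓ ℓ c) where
  symm i j := by
    rcases i with i | i | i <;> rcases j with j | j | j <;> simp [gram, eq_comm]
  dual i := by
    rcases i with i | i | i
    · refine ⟨Pi.single (.inl i) 1, fun j => ?_⟩
      rw [form_single]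
      rcases j with j | j | j <;> simp [gram, eq_comm]
    · refine ⟨Pi.single (.inr (.inr i)) 1, fun j => ?_⟩
      rw [form_single]
      rcases j with j | j | j <;> simp [gram, eq_comm]
    · refine ⟨Pi.single (.inr (.inl i)) 1, fun j => ?_⟩
      rw [form_single]
      rcases j with j | j | j <;> simp [gram, eq_comm]
  add_left := bimult_add_left _
  add_right := bimult_add_right _

@[simp] lemma dotTheta_inl (p : Fin r → ℤ) (i : Fin ℓ) : dotTheta ℓ p (.inl i) = 0 := by
  simp [dotTheta, theta]

@[simp] lemma dotTheta_inr_inl (p : Fin r → ℤ) (ν : Fin r) :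
    dotTheta ℓ p (.inr (.inl ν)) = p ν := by
  simp [dotTheta, theta, Pi.single_apply]

@[simp] lemma dotTheta_inr_inr (p : Fin r → ℤ) (ν : Fin r) :
    dotTheta ℓ p (.inr (.inr ν)) = 0 := by
  simp [dotTheta, theta]

lemma dotTheta_add (p q : Fin r → ℤ) : dotTheta ℓ (p + q) = dotTheta ℓ p + dotTheta ℓ q := by
  simp [dotTheta, add_smul, Finset.sum_add_distrib]

lemma cplx_dotTheta (p : Fin r → ℤ) :
    cplx (dotTheta ℓ p) = ∑ ν, (p ν : ℂ) • cplx (theta ℓ ν) := by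
  ext i
  simp [cplx, dotTheta, Finset.sum_apply]

/-- The lattice vector `v_k - v_l + p·θ`. -/
def root (k l : Fin ℓ) (p : Fin r → ℤ) : Idx ℓ r → ℤ := v r k - v r l + dotTheta ℓ p

lemma root_inl (k l : Fin ℓ) (p : Fin r → ℤ) (i : Fin ℓ) :
    root k l p (.inl i) = (Pi.single k 1 - Pi.single l 1 : Fin ℓ → ℤ) i := by
  simp [root, v, Pi.single_apply]

@[simp] lemma root_inr_inl (k l : Fin ℓ) (p : Fin r → ℤ) (ν : Fin r) :
    root k l p (.inr (.inl ν)) = p ν := by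
  simp [root, v]

@[simp] lemma root_inr_inr (k l : Fin ℓ) (p : Fin r → ℤ) (ν : Fin r) :
    root k l p (.inr (.inr ν)) = 0 := by
  simp [root, v]

lemma root_add (k l j : Fin ℓ) (p q : Fin r → ℤ) :
    root k l p + root l j q = root k j (p + q) := by
  simp only [root, dotTheta_add]; abel

lemma root_add_dotTheta (k l : Fin ℓ) (p q : Fin r → ℤ) :
    dotTheta ℓ p + root k l q = root k l (p + q) := by
  simp only [root, dotTheta_add]; abel

lemma root_self (k : Fin ℓ) (p : Fin r → ℤ) : root k k p = dotTheta ℓ p := by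
  simp [root]

lemma latForm_root (k l k' l' : Fin ℓ) (p q : Fin r → ℤ) :
    latForm (gram ℓ r) (root k l p) (root k' l' q) =
      (if k = k' then 1 else 0) - (if k = l' then 1 else 0) - (if l = k' then 1 else 0) +
        (if l = l' then 1 else 0) := by
  rw [latForm_gram]
  simp only [root_inl, root_inr_inl, root_inr_inr, mul_zero, zero_mul, Finset.sum_const_zero,
    add_zero, Pi.sub_apply, sub_mul, mul_sub, Finset.sum_sub_distrib]
  simp only [Pi.single_apply, mul_ite, mul_one, mul_zero, Finset.mem_univ,
    if_true, Finset.sum_ite_eq, eq_comm]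
  ring

lemma latForm_dotTheta_root (k l : Fin ℓ) (p q : Fin r → ℤ) :
    latForm (gram ℓ r) (dotTheta ℓ p) (root k l q) = 0 := by
  rw [← root_self k p, latForm_root]; ring

lemma latForm_dotTheta (p q : Fin r → ℤ) :
    latForm (gram ℓ r) (dotTheta ℓ p) (dotTheta ℓ q) = 0 := by
  rw [latForm_gram]; simp

lemma form_v_dotTheta (k : Fin ℓ) (p : Fin r → ℤ) :
    form (gram ℓ r) (cplx (v r k)) (cplx (dotTheta ℓ p)) = 0 := by
  rw [form_cplx, latForm_gram]; simp [v]

lemma form_v_root (i k l : Fin ℓ) (p : Fin r → ℤ) :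
    form (gram ℓ r) (cplx (v r i)) (cplx (root k l p)) =
      (if i = k then 1 else 0) - (if i = l then 1 else 0) := by
  rw [form_cplx, latForm_gram]
  simp [v, root_inl, Pi.single_apply, mul_sub, eq_comm]

lemma form_v_v (i k : Fin ℓ) :
    form (gram ℓ r) (cplx (v r i)) (cplx (v r k)) = if i = k then 1 else 0 := by
  rw [form_cplx, latForm_gram]
  simp [v, Pi.single_apply, eq_comm]

lemma form_theta_root (ν : Fin r) (k l : Fin ℓ) (p : Fin r → ℤ) :
    form (gram ℓ r) (cplx (theta ℓ ν)) (cplx (root k l p)) = 0 := by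
  rw [form_cplx, latForm_gram]; simp [theta]

lemma form_theta_dotTheta (ν : Fin r) (p : Fin r → ℤ) :
    form (gram ℓ r) (cplx (theta ℓ ν)) (cplx (dotTheta ℓ p)) = 0 := by
  rw [form_cplx, latForm_gram]; simp [theta]

lemma form_theta_v (ν : Fin r) (k : Fin ℓ) :
    form (gram ℓ r) (cplx (theta ℓ ν)) (cplx (v r k)) = 0 := by
  rw [form_cplx, latForm_gram]; simp [theta, v]

lemma form_theta_theta (ν μ : Fin r) :
    form (gram ℓ r) (cplx (theta ℓ ν)) (cplx (theta ℓ μ)) = 0 := by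
  rw [form_cplx, latForm_gram]; simp [theta]

variable (c : Fin r → Fin r → ℤˣ)

/-- On vectors without components along the `Θ_ν`, the sign `ε` only depends on the components along
the `v_i`. -/
lemma sgnΓ_eq (α β : Idx ℓ r → ℤ) (hα : ∀ ν, α (.inr (.inr ν)) = 0)
    (hβ : ∀ ν, β (.inr (.inr ν)) = 0) :
    sgnΓ ℓ c α β = bimult sgn (fun i => α (.inl i)) (fun i => β (.inl i)) := by
  simp [sgnΓ, bimult, Fintype.prod_sum_type, signTable, hα, hβ]

lemma sgnΓ_root (k l k' l' : Fin ℓ) (p q : Fin r → ℤ) :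
    sgnΓ ℓ c (root k l p) (root k' l' q) =
      sgn k k' * sgn k l' * (sgn l k' * sgn l l') := by
  rw [sgnΓ_eq c _ _ (root_inr_inr k l p) (root_inr_inr k' l' q),
    funext (root_inl k l p), funext (root_inl k' l' q)]
  simp only [bimult_sub_left, bimult_sub_right]
  rw [bimult_single, bimult_single, bimult_single, bimult_single]
  exact mul_mul_mul_comm _ _ _ _

lemma bimult_zero_left {ι : Type} [Fintype ι] (c : ι → ι → ℤˣ) (β : ι → ℤ) :
    bimult c (fun _ => 0) β = 1 := by
  simp [bimult]

lemma bimult_zero_right {ι : Type} [Fintype ι] (c : ι → ι → ℤˣ) (β : ι → ℤ) :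
    bimult c β (fun _ => 0) = 1 := by
  simp [bimult]

lemma sgnΓ_dotTheta_left (p : Fin r → ℤ) (β : Idx ℓ r → ℤ) (hβ : ∀ ν, β (.inr (.inr ν)) = 0) :
    sgnΓ ℓ c (dotTheta ℓ p) β = 1 := by
  rw [sgnΓ_eq c _ _ (dotTheta_inr_inr p) hβ]
  simp only [dotTheta_inl, bimult_zero_left]

lemma sgnΓ_dotTheta_right (p : Fin r → ℤ) (β : Idx ℓ r → ℤ) (hβ : ∀ ν, β (.inr (.inr ν)) = 0) :
    sgnΓ ℓ c β (dotTheta ℓ p) = 1 := by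
  rw [sgnΓ_eq c _ _ hβ (dotTheta_inr_inr p)]
  simp only [dotTheta_inl, bimult_zero_right]

lemma sgn_self (i : Fin ℓ) : sgn i i = -1 := by simp [sgn]

lemma sgn_swap {i j : Fin ℓ} (h : i ≠ j) : sgn j i = -sgn i j := by
  unfold sgn
  rcases lt_or_gt_of_ne h with h | h
  · rw [if_neg (by omega), if_pos h]
  · rw [if_pos h, if_neg (by omega), neg_neg]

/-! ### The operators attached to matrix units -/

/-- The operator attached to `E_{kl} ⊗ t^M` for a matrix unit `E_{kl}`. The diagonal matrix units
are included, although they do not belong to `sl_ℓ`. -/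
def unitOp (k l : Fin ℓ) (M : Fin (r + 1) → ℤ) : Op (Idx ℓ r) :=
  if k = l then current (gram ℓ r) (sgnΓ ℓ c) (cplx (v r k)) (dotTheta ℓ (Fin.tail M)) (-M 0 - 1)
  else (((sgn l k : ℤˣ) : ℤ) : ℂ) •
    vertexOp (gram ℓ r) (sgnΓ ℓ c) (root k l (Fin.tail M)) (-M 0 - 1)

/-- The operator attached to `t^M K_ν`. -/
def centreOp (ℓ : ℕ) {r : ℕ} (c : Fin r → Fin r → ℤˣ) (ν : Fin (r + 1)) (M : Fin (r + 1) → ℤ) :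
    Op (Idx ℓ r) :=
  Fin.cases (vertexOp (gram ℓ r) (sgnΓ ℓ c) (dotTheta ℓ (Fin.tail M)) (-M 0))
    (fun μ => current (gram ℓ r) (sgnΓ ℓ c) (cplx (theta ℓ μ)) (dotTheta ℓ (Fin.tail M))
      (-M 0 - 1)) ν

lemma centreOp_zero (M : Fin (r + 1) → ℤ) : centreOp ℓ c 0 M =
    vertexOp (gram ℓ r) (sgnΓ ℓ c) (dotTheta ℓ (Fin.tail M)) (-M 0) := rfl

lemma centreOp_succ (μ : Fin r) (M : Fin (r + 1) → ℤ) : centreOp ℓ c μ.succ M =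
    current (gram ℓ r) (sgnΓ ℓ c) (cplx (theta ℓ μ)) (dotTheta ℓ (Fin.tail M)) (-M 0 - 1) := rfl

lemma unitOp_self (k : Fin ℓ) (M : Fin (r + 1) → ℤ) : unitOp c k k M =
    current (gram ℓ r) (sgnΓ ℓ c) (cplx (v r k)) (dotTheta ℓ (Fin.tail M)) (-M 0 - 1) :=
  if_pos rfl

lemma unitOp_of_ne {k l : Fin ℓ} (h : k ≠ l) (M : Fin (r + 1) → ℤ) : unitOp c k l M =
    (((sgn l k : ℤˣ) : ℤ) : ℂ) •
      vertexOp (gram ℓ r) (sgnΓ ℓ c) (root k l (Fin.tail M)) (-M 0 - 1) :=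
  if_neg h

lemma tail_add (M N : Fin (r + 1) → ℤ) : Fin.tail (M + N) = Fin.tail M + Fin.tail N := rfl

/-- With `p`, `q` the tails of `M`, `N`, the element `∑_ν N_ν t^M K_ν` acts as `N_0` times a
coefficient of `E^{p·θ}(z)` plus a coefficient of `:(q·θ)(z) E^{p·θ}(z):`. -/
lemma sum_centreOp (M N : Fin (r + 1) → ℤ) (u : StateSpace (Idx ℓ r)) :
    ∑ ν, (N ν : ℂ) • centreOp ℓ c ν M u =
      (N 0 : ℂ) • vertexOp (gram ℓ r) (sgnΓ ℓ c) (dotTheta ℓ (Fin.tail M)) (-M 0) u +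
      current (gram ℓ r) (sgnΓ ℓ c) (cplx (dotTheta ℓ (Fin.tail N))) (dotTheta ℓ (Fin.tail M))
        (-M 0 - 1) u := by
  rw [Fin.sum_univ_succ, centreOp_zero, cplx_dotTheta,
    ← currentₗ_apply (gram ℓ r) (sgnΓ ℓ c) (∑ ν, _), map_sum, LinearMap.sum_apply]
  simp only [map_smul, LinearMap.smul_apply, currentₗ_apply, centreOp_succ, Fin.tail]

/-- The relations of `𝒦` hold because `∂_z E^{p·θ}(z) = :(p·θ)(z) E^{p·θ}(z):`. -/
lemma sum_centreOp_self (M : Fin (r + 1) → ℤ) (u : StateSpace (Idx ℓ r)) :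
    ∑ ν, (M ν : ℂ) • centreOp ℓ c ν M u = 0 := by
  rw [sum_centreOp, ← deriv_vertexOp (isSignedLattice_gram c), ← add_smul]
  simp

/-- The anomaly of `E^{p·θ}(z)` and `E^{q·θ}(w)` is the cocycle of the toroidal Lie algebra. -/
lemma anomaly_dotTheta (M N : Fin (r + 1) → ℤ) (u : StateSpace (Idx ℓ r)) :
    anomaly (gram ℓ r) (sgnΓ ℓ c) (dotTheta ℓ (Fin.tail M)) (dotTheta ℓ (Fin.tail N))
      (-M 0 - 1) (-N 0 - 1) u = ∑ ν, (M ν : ℂ) • centreOp ℓ c ν (M + N) u := by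
  have h := sum_centreOp_self c (M + N) u
  simp only [Pi.add_apply, Int.cast_add, add_smul, Finset.sum_add_distrib] at h
  rw [eq_neg_of_add_eq_zero_left h, sum_centreOp, anomaly, LinearMap.add_apply,
    LinearMap.smul_apply, LinearMap.smul_apply, tail_add, dotTheta_add, Pi.add_apply,
    show -M 0 - 1 + (-N 0 - 1) + 2 = -(M 0 + N 0) by ring,
    show -M 0 - 1 + (-N 0 - 1) + 1 = -(M 0 + N 0) - 1 by ring]
  push_cast
  module

end Gamma

/-! ### Commutation relations of the operators attached to matrix units -/

section Relations

variable {ℓ r : ℕ} (c : Fin r → Fin r → ℤˣ)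

/-- The sum `∑_ν M_ν t^{M+N} K_ν` as an operator. -/
def cocycleOp (ℓ : ℕ) {r : ℕ} (c : Fin r → Fin r → ℤˣ) (M N : Fin (r + 1) → ℤ) : Op (Idx ℓ r) :=
  ∑ ν, (M ν : ℂ) • centreOp ℓ c ν (M + N)

lemma cocycleOp_eq (M N : Fin (r + 1) → ℤ) (u : StateSpace (Idx ℓ r)) :
    cocycleOp ℓ c M N u = anomaly (gram ℓ r) (sgnΓ ℓ c) (dotTheta ℓ (Fin.tail M))
      (dotTheta ℓ (Fin.tail N)) (-M 0 - 1) (-N 0 - 1) u := by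
  rw [anomaly_dotTheta, cocycleOp, LinearMap.sum_apply]; rfl

lemma sgnΓ_dotTheta_comm (p : Fin r → ℤ) (k l : Fin ℓ) (q : Fin r → ℤ) :
    sgnΓ ℓ c (root k l q) (dotTheta ℓ p) = sgnΓ ℓ c (dotTheta ℓ p) (root k l q) := by
  rw [sgnΓ_dotTheta_left c p _ (root_inr_inr k l q), sgnΓ_dotTheta_right c p _ (root_inr_inr k l q)]

lemma index_add (m n : ℤ) : -m - 1 + (-n - 1) + 1 = -(m + n) - 1 := by ring

/-- `[E_{kk} ⊗ t^M, E_{k'l'} ⊗ t^N]` for `k' ≠ l'`. -/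
lemma unitOp_self_comm (k : Fin ℓ) {k' l' : Fin ℓ} (h : k' ≠ l') (M N : Fin (r + 1) → ℤ)
    (u : StateSpace (Idx ℓ r)) :
    unitOp c k k M (unitOp c k' l' N u) = unitOp c k' l' N (unitOp c k k M u) +
      ((if k = k' then 1 else 0) - (if k = l' then 1 else 0) : ℂ) • unitOp c k' l' (M + N) u := by
  rw [unitOp_self, unitOp_of_ne c h, unitOp_of_ne c h, LinearMap.smul_apply, map_smul,
    comm_current_vertexOp (isSignedLattice_gram c) _ _ _ (latForm_dotTheta_root _ _ _ _)
      (sgnΓ_dotTheta_comm c _ _ _ _), form_v_root, root_add_dotTheta, index_add,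
    sgnΓ_dotTheta_left c _ _ (root_inr_inr k' l' _), LinearMap.smul_apply, LinearMap.smul_apply,
    tail_add, Pi.add_apply]
  simp only [Units.val_one, Int.cast_one, mul_one]
  module

/-- `[E_{kk} ⊗ t^M, E_{ll} ⊗ t^N]`. -/
lemma unitOp_self_comm_self (k l : Fin ℓ) (M N : Fin (r + 1) → ℤ) (u : StateSpace (Idx ℓ r)) :
    unitOp c k k M (unitOp c l l N u) = unitOp c l l N (unitOp c k k M u) +
      (if k = l then 1 else 0 : ℂ) • cocycleOp ℓ c M N u := by
  rw [unitOp_self, unitOp_self, comm_current_current (isSignedLattice_gram c) _ _ _ _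
    (latForm_dotTheta _ _) (form_v_dotTheta _ _) (form_v_dotTheta _ _), form_v_v,
    sgnΓ_dotTheta_left c _ _ (dotTheta_inr_inr _), cocycleOp_eq]
  · simp only [Units.val_one, Int.cast_one, mul_one]
  · rw [sgnΓ_dotTheta_left c _ _ (dotTheta_inr_inr _),
      sgnΓ_dotTheta_left c _ _ (dotTheta_inr_inr _)]

/-- `[E_{kl} ⊗ t^M, E_{lj} ⊗ t^N]` for distinct `k`, `l`, `j`. -/
lemma unitOp_comm_of_ne {k l j : Fin ℓ} (hkl : k ≠ l) (hlj : l ≠ j) (hkj : k ≠ j)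
    (M N : Fin (r + 1) → ℤ) (u : StateSpace (Idx ℓ r)) :
    unitOp c k l M (unitOp c l j N u) = unitOp c l j N (unitOp c k l M u) +
      unitOp c k j (M + N) u := by
  -- the sign `ε(α, β)` of the two roots turns `ε_{lk} ε_{jl}` into `ε_{jk}`
  have hs : sgn l k * sgn j l * (sgn k l * sgn k j * (sgn l l * sgn l j)) = sgn j k := by
    rw [sgn_swap hkl, sgn_swap hlj, sgn_swap hkj, sgn_self]
    rcases Int.units_eq_one_or (sgn k l) with h1 | h1 <;>
    rcases Int.units_eq_one_or (sgn l j) with h2 | h2 <;> rw [h1, h2] <;> simp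
  have hσ : sgnΓ ℓ c (root l j (Fin.tail N)) (root k l (Fin.tail M)) =
      -sgnΓ ℓ c (root k l (Fin.tail M)) (root l j (Fin.tail N)) := by
    rw [sgnΓ_root, sgnΓ_root, sgn_swap hkl, sgn_swap hlj, sgn_swap hkj, sgn_self]
    rcases Int.units_eq_one_or (sgn k l) with h1 | h1 <;>
    rcases Int.units_eq_one_or (sgn l j) with h2 | h2 <;> rw [h1, h2] <;> simp
  have hs' : (((sgn l k : ℤˣ) : ℤ) : ℂ) * (((sgn j l : ℤˣ) : ℤ) : ℂ) *
      (((sgnΓ ℓ c (root k l (Fin.tail M)) (root l j (Fin.tail N)) : ℤˣ) : ℤ) : ℂ) =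
      (((sgn j k : ℤˣ) : ℤ) : ℂ) := by
    rw [sgnΓ_root, ← hs]; push_cast; ring
  rw [unitOp_of_ne c hkl, unitOp_of_ne c hlj, unitOp_of_ne c hkj]
  simp only [LinearMap.smul_apply, map_smul]
  rw [comm_vertexOp_neg_one (isSignedLattice_gram c) _ _ ?_ hσ, root_add, index_add, tail_add,
    Pi.add_apply, ← hs']
  · module
  · rw [latForm_root, if_neg hkl, if_neg hkj, if_pos rfl, if_neg hlj]; norm_num

/-- `[E_{kl} ⊗ t^M, E_{lk} ⊗ t^N]` for distinct `k`, `l`. -/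
lemma unitOp_comm_opposite {k l : Fin ℓ} (hkl : k ≠ l) (M N : Fin (r + 1) → ℤ)
    (u : StateSpace (Idx ℓ r)) :
    unitOp c k l M (unitOp c l k N u) + unitOp c l l (M + N) u =
      unitOp c l k N (unitOp c k l M u) + unitOp c k k (M + N) u + cocycleOp ℓ c M N u := by
  -- `ε_{lk} ε_{kl}` is cancelled by the sign `ε(α, β)` of the two roots
  have hs : sgn l k * sgn k l * (sgn k l * sgn k k * (sgn l l * sgn l k)) = 1 := by
    rw [sgn_swap hkl, sgn_self, sgn_self]
    rcases Int.units_eq_one_or (sgn k l) with h1 | h1 <;> rw [h1] <;> simp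
  have hσ : sgnΓ ℓ c (root l k (Fin.tail N)) (root k l (Fin.tail M)) =
      sgnΓ ℓ c (root k l (Fin.tail M)) (root l k (Fin.tail N)) := by
    rw [sgnΓ_root, sgnΓ_root, sgn_swap hkl, sgn_self, sgn_self]
    rcases Int.units_eq_one_or (sgn k l) with h1 | h1 <;> rw [h1] <;> simp
  have hs' : (((sgn l k : ℤˣ) : ℤ) : ℂ) * (((sgn k l : ℤˣ) : ℤ) : ℂ) *
      (((sgnΓ ℓ c (root k l (Fin.tail M)) (root l k (Fin.tail N)) : ℤˣ) : ℤ) : ℂ) = 1 := by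
    rw [sgnΓ_root]
    have h := congrArg (fun x : ℤˣ => ((x : ℤ) : ℂ)) hs
    push_cast at h ⊢
    exact h
  have hroot : cplx (root l k (Fin.tail N) : Idx ℓ r → ℤ) =
      cplx (v r l) - cplx (v r k) + cplx (dotTheta ℓ (Fin.tail N)) := by
    rw [root, cplx_add, cplx_sub]
  have ha : anomaly (gram ℓ r) (sgnΓ ℓ c) (root k l (Fin.tail M)) (root l k (Fin.tail N))
      (-M 0 - 1) (-N 0 - 1) u + unitOp c l l (M + N) u =
      unitOp c k k (M + N) u + cocycleOp ℓ c M N u := by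
    rw [cocycleOp_eq, anomaly, anomaly, hroot, root_add, root_self, unitOp_self, unitOp_self,
      ← dotTheta_add, ← tail_add, index_add, Pi.add_apply]
    simp only [← currentₗ_apply, map_add, map_sub, LinearMap.add_apply, LinearMap.sub_apply,
      LinearMap.smul_apply]
    module
  rw [add_assoc, ← ha, ← add_assoc]
  congr 1
  rw [unitOp_of_ne c hkl, unitOp_of_ne c hkl.symm]
  simp only [LinearMap.smul_apply, map_smul]
  have hA : ∀ w : StateSpace (Idx ℓ r), w = ((((sgn l k : ℤˣ) : ℤ) : ℂ) *
      (((sgn k l : ℤˣ) : ℤ) : ℂ) *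
      (((sgnΓ ℓ c (root k l (Fin.tail M)) (root l k (Fin.tail N)) : ℤˣ) : ℤ) : ℂ)) • w :=
    fun w => by rw [hs', one_smul]
  rw [comm_vertexOp_neg_two (isSignedLattice_gram c) _ _ ?_ hσ]
  · refine Eq.trans ?_ (congrArg (HAdd.hAdd _) (hA _).symm)
    module
  · rw [latForm_root, if_neg hkl, if_neg hkl.symm, if_pos rfl, if_pos rfl]; norm_num

/-- `[E_{kl} ⊗ t^M, E_{k'l'} ⊗ t^N] = 0` if `l ≠ k'` and `k ≠ l'`. -/
lemma unitOp_comm_zero {k l k' l' : Fin ℓ} (hkl : k ≠ l) (hkl' : k' ≠ l') (h1 : l ≠ k')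
    (h2 : k ≠ l') (M N : Fin (r + 1) → ℤ) (u : StateSpace (Idx ℓ r)) :
    unitOp c k l M (unitOp c k' l' N u) = unitOp c k' l' N (unitOp c k l M u) := by
  have ha := latForm_root k l k' l' (Fin.tail M) (Fin.tail N)
  have hσ : sgnΓ ℓ c (root k' l' (Fin.tail N)) (root k l (Fin.tail M)) =
      (if k = k' then 1 else -1) * (if l = l' then 1 else -1) *
      sgnΓ ℓ c (root k l (Fin.tail M)) (root k' l' (Fin.tail N)) := by
    have e : ∀ i j : Fin ℓ, sgn j i = (if i = j then 1 else -1) * sgn i j := by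
      intro i j
      split_ifs with h
      · rw [h, one_mul]
      · rw [sgn_swap h, neg_one_mul]
    rw [sgnΓ_root, sgnΓ_root, e k k', e l k', e k l', e l l', if_neg h1, if_neg h2]
    generalize (if k = k' then (1 : ℤˣ) else -1) = a
    generalize (if l = l' then (1 : ℤˣ) else -1) = b
    simp only [mul_neg, neg_mul, neg_neg, one_mul]
    simp only [mul_assoc, mul_left_comm]
  rw [if_neg h1, if_neg h2, sub_zero, sub_zero] at ha
  have key : ∀ (a b : ℤ), vertexOp (gram ℓ r) (sgnΓ ℓ c) (root k l (Fin.tail M)) a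
      (vertexOp (gram ℓ r) (sgnΓ ℓ c) (root k' l' (Fin.tail N)) b u) =
      vertexOp (gram ℓ r) (sgnΓ ℓ c) (root k' l' (Fin.tail N)) b
      (vertexOp (gram ℓ r) (sgnΓ ℓ c) (root k l (Fin.tail M)) a u) := by
    intro a b
    by_cases e1 : k = k' <;> by_cases e2 : l = l'
    · rw [if_pos e1, if_pos e2] at ha hσ
      exact comm_vertexOp_two (isSignedLattice_gram c) _ _ ha (by rw [hσ, one_mul, one_mul]) _ _ u
    · rw [if_pos e1, if_neg e2] at ha hσ
      exact comm_vertexOp_one (isSignedLattice_gram c) _ _ ha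
        (by rw [hσ, one_mul, neg_one_mul]) _ _ u
    · rw [if_neg e1, if_pos e2] at ha hσ
      exact comm_vertexOp_one (isSignedLattice_gram c) _ _ ha
        (by rw [hσ, mul_one, neg_one_mul]) _ _ u
    · rw [if_neg e1, if_neg e2] at ha hσ
      exact comm_vertexOp_zero (isSignedLattice_gram c) _ _ ha
        (by rw [hσ, neg_one_mul, neg_neg, one_mul]) _ _ u
  rw [unitOp_of_ne c hkl, unitOp_of_ne c hkl']
  simp only [LinearMap.smul_apply, map_smul]
  rw [key, smul_comm]

/-- The commutation relations of the operators attached to matrix units. -/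
lemma unitOp_comm (k l k' l' : Fin ℓ) (M N : Fin (r + 1) → ℤ) (u : StateSpace (Idx ℓ r)) :
    unitOp c k l M (unitOp c k' l' N u) + (if l' = k then 1 else 0 : ℂ) • unitOp c k' l (M + N) u =
      unitOp c k' l' N (unitOp c k l M u) +
      (if l = k' then 1 else 0 : ℂ) • unitOp c k l' (M + N) u +
      (if l = k' ∧ k = l' then 1 else 0 : ℂ) • cocycleOp ℓ c M N u := by
  by_cases hkl : k = l
  · subst hkl
    by_cases hkl' : k' = l'
    · subst hkl'
      rw [unitOp_self_comm_self]
      by_cases h : k = k'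
      · subst h
        simp only [if_true, and_self, one_smul]; abel
      · simp [h, Ne.symm h]
    · rw [unitOp_self_comm c k hkl']
      by_cases h1 : k = k'
      · subst h1
        simp [hkl', Ne.symm hkl']
      · by_cases h2 : k = l'
        · subst h2
          simp [h1]
        · simp [h1, h2, Ne.symm h2]
  · by_cases hkl' : k' = l'
    · subst hkl'
      have h := unitOp_self_comm c k' hkl N M u
      rw [h, add_comm N M]
      by_cases h1 : k = k'
      · subst h1
        simp [hkl, Ne.symm hkl]
      · by_cases h2 : l = k'
        · subst h2
          simp [hkl, Ne.symm hkl]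
        · simp [h1, h2, Ne.symm h2, Ne.symm h1]
    · by_cases h1 : l = k' <;> by_cases h2 : k = l'
      · subst h1 h2
        simpa using unitOp_comm_opposite c hkl M N u
      · subst h1
        rw [unitOp_comm_of_ne c hkl hkl' h2]
        simp [h2, Ne.symm h2]
      · subst h2
        rw [unitOp_comm_of_ne c hkl' hkl (Ne.symm h1), add_comm N M]
        simp [h1, add_comm]
      · rw [unitOp_comm_zero c hkl hkl' h1 h2]
        simp [h1, h2, Ne.symm h2]

lemma centreOp_comm_unitOp (ν : Fin (r + 1)) (k l : Fin ℓ) (M N : Fin (r + 1) → ℤ)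
    (u : StateSpace (Idx ℓ r)) :
    centreOp ℓ c ν M (unitOp c k l N u) = unitOp c k l N (centreOp ℓ c ν M u) := by
  have hσ : ∀ p q, sgnΓ ℓ c (dotTheta ℓ p) (dotTheta ℓ q) = 1 := fun p q =>
    sgnΓ_dotTheta_left c p _ (dotTheta_inr_inr q)
  cases ν using Fin.cases with
  | zero =>
    rw [centreOp_zero]
    by_cases h : k = l
    · subst h
      rw [unitOp_self, comm_current_vertexOp (isSignedLattice_gram c) _ _ _ (latForm_dotTheta _ _)
        (by rw [hσ, hσ]), form_v_dotTheta, zero_mul, zero_smul, add_zero]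
    · rw [unitOp_of_ne c h, LinearMap.smul_apply, LinearMap.smul_apply, map_smul,
        comm_vertexOp_zero (isSignedLattice_gram c) _ _ (latForm_dotTheta_root _ _ _ _)
          (sgnΓ_dotTheta_comm c _ _ _ _)]
  | succ μ =>
    rw [centreOp_succ]
    by_cases h : k = l
    · subst h
      rw [unitOp_self, comm_current_current (isSignedLattice_gram c) _ _ _ _ (latForm_dotTheta _ _)
        (form_theta_dotTheta _ _) (form_v_dotTheta _ _) (by rw [hσ, hσ]), form_theta_v, zero_mul,
        zero_smul, add_zero]
    · rw [unitOp_of_ne c h, LinearMap.smul_apply, LinearMap.smul_apply, map_smul,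
        comm_current_vertexOp (isSignedLattice_gram c) _ _ _ (latForm_dotTheta_root _ _ _ _)
          (sgnΓ_dotTheta_comm c _ _ _ _), form_theta_root, zero_mul, zero_smul, add_zero]

lemma centreOp_comm (ν μ : Fin (r + 1)) (M N : Fin (r + 1) → ℤ) (u : StateSpace (Idx ℓ r)) :
    centreOp ℓ c ν M (centreOp ℓ c μ N u) = centreOp ℓ c μ N (centreOp ℓ c ν M u) := by
  have hσ : ∀ p q, sgnΓ ℓ c (dotTheta ℓ p) (dotTheta ℓ q) = 1 := fun p q =>
    sgnΓ_dotTheta_left c p _ (dotTheta_inr_inr q)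
  have key : ∀ (ν : Fin r) (M N : Fin (r + 1) → ℤ) (u : StateSpace (Idx ℓ r)),
      centreOp ℓ c ν.succ M (centreOp ℓ c 0 N u) = centreOp ℓ c 0 N (centreOp ℓ c ν.succ M u) := by
    intro ν M N u
    rw [centreOp_succ, centreOp_zero, comm_current_vertexOp (isSignedLattice_gram c) _ _ _
      (latForm_dotTheta _ _) (by rw [hσ, hσ]), form_theta_dotTheta, zero_mul, zero_smul, add_zero]
  cases ν using Fin.cases with
  | zero =>
    cases μ using Fin.cases with
    | zero =>
      rw [centreOp_zero, centreOp_zero, comm_vertexOp_zero (isSignedLattice_gram c) _ _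
        (latForm_dotTheta _ _) (by rw [hσ, hσ])]
    | succ μ => rw [key]
  | succ ν =>
    cases μ using Fin.cases with
    | zero => rw [key]
    | succ μ =>
      rw [centreOp_succ, centreOp_succ, comm_current_current (isSignedLattice_gram c) _ _ _ _
        (latForm_dotTheta _ _) (form_theta_dotTheta _ _) (form_theta_dotTheta _ _)
        (by rw [hσ, hσ]), form_theta_theta, zero_mul, zero_smul, add_zero]

end Relations

/-! ### The representation of the toroidal Lie algebra -/

section Representation

variable {ℓ r : ℕ} (c : Fin r → Fin r → ℤˣ)

/-- The operators attached to the elements `X ⊗ t^M` for `X ∈ gl_ℓ`. -/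
def glMap (M : Fin (r + 1) → ℤ) : Matrix (Fin ℓ) (Fin ℓ) ℂ →ₗ[ℂ] Op (Idx ℓ r) where
  toFun X := ∑ k, ∑ l, X k l • unitOp c k l M
  map_add' X Y := by
    simp only [Matrix.add_apply, add_smul, Finset.sum_add_distrib]
  map_smul' s X := by
    simp only [Matrix.smul_apply, smul_assoc, Finset.smul_sum, RingHom.id_apply]

lemma glMap_apply (M : Fin (r + 1) → ℤ) (X : Matrix (Fin ℓ) (Fin ℓ) ℂ) :
    glMap c M X = ∑ k, ∑ l, X k l • unitOp c k l M := rfl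

lemma glMap_single (M : Fin (r + 1) → ℤ) (k l : Fin ℓ) (s : ℂ) :
    glMap c M (Matrix.single k l s) = s • unitOp c k l M := by
  rw [glMap_apply, Finset.sum_eq_single k, Finset.sum_eq_single l]
  · simp
  · intro j _ hj; rw [Matrix.single_apply_of_col_ne _ _ (Ne.symm hj), zero_smul]
  · simp
  · intro j _ hj
    exact Finset.sum_eq_zero fun i _ => by
      rw [Matrix.single_apply_of_row_ne (Ne.symm hj), zero_smul]
  · simp

/-- The bracket `[X ⊗ t^M, Y ⊗ t^N]` in terms of operators. -/
lemma glMap_comm (M N : Fin (r + 1) → ℤ) (X Y : Matrix (Fin ℓ) (Fin ℓ) ℂ)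
    (u : StateSpace (Idx ℓ r)) :
    glMap c M X (glMap c N Y u) + glMap c (M + N) (Y * X) u =
      glMap c N Y (glMap c M X u) + glMap c (M + N) (X * Y) u +
        Matrix.trace (X * Y) • cocycleOp ℓ c M N u := by
  induction X using Matrix.induction_on' with
  | h_zero => simp
  | h_add X X' h h' =>
    simp only [map_add, mul_add, add_mul, Matrix.trace_add, add_smul, LinearMap.add_apply]
    rw [add_add_add_comm, h, h']
    abel
  | h_std_basis k l s =>
    induction Y using Matrix.induction_on' with
    | h_zero => simp
    | h_add Y Y' h h' =>
      simp only [map_add, mul_add, add_mul, Matrix.trace_add, add_smul, LinearMap.add_apply]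
      rw [add_add_add_comm, h, h']
      abel
    | h_std_basis k' l' s' =>
      have e1 : Matrix.single k' l' s' * Matrix.single k l s =
          (s * s') • (if l' = k then 1 else 0 : ℂ) • Matrix.single k' l (1 : ℂ) := by
        split_ifs with h
        · subst h; simp [Matrix.single_mul_single_same, mul_comm]
        · rw [Matrix.single_mul_single_of_ne _ _ _ _ h, zero_smul, smul_zero]
      have e2 : Matrix.single k l s * Matrix.single k' l' s' =
          (s * s') • (if l = k' then 1 else 0 : ℂ) • Matrix.single k l' (1 : ℂ) := by
        split_ifs with h
        · subst h; simp [Matrix.single_mul_single_same]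
        · rw [Matrix.single_mul_single_of_ne _ _ _ _ h, zero_smul, smul_zero]
      have e3 : Matrix.trace (Matrix.single k l s * Matrix.single k' l' s') =
          (s * s') * (if l = k' ∧ k = l' then 1 else 0 : ℂ) := by
        rw [e2, Matrix.trace_smul, Matrix.trace_smul]
        by_cases h : l = k' <;> by_cases h' : k = l'
        · subst h'; simp [h, Matrix.trace_single_eq_same]
        · simp [h, h', Matrix.trace_single_eq_of_ne _ _ _ h']
        · simp [h]
        · simp [h]
      rw [e3, e1, e2]
      simp only [map_smul, glMap_single, LinearMap.smul_apply]
      have h := congrArg (fun w : StateSpace (Idx ℓ r) => (s * s') • w)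
        (unitOp_comm c k l k' l' M N u)
      simp only [smul_add] at h
      simp only [one_smul, ← mul_smul, mul_comm s' s] at h ⊢
      exact h

/-- The operators attached to the elements of `sl_ℓ ⊗ R`. -/
def loopMap : Laurent r ⊗[ℂ] LieAlgebra.SpecialLinear.sl (Fin ℓ) ℂ →ₗ[ℂ] Op (Idx ℓ r) :=
  TensorProduct.lift ((AddMonoidAlgebra.basis (Fin (r + 1) → ℤ) ℂ).constr ℂ fun M =>
    glMap c M ∘ₗ (LieAlgebra.SpecialLinear.sl (Fin ℓ) ℂ).toSubmodule.subtype)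

lemma loopMap_tPow (M : Fin (r + 1) → ℤ) (X : LieAlgebra.SpecialLinear.sl (Fin ℓ) ℂ) :
    loopMap c (tPow M ⊗ₜ X) = glMap c M X.val := by
  rw [loopMap, TensorProduct.lift.tmul]
  have h := (AddMonoidAlgebra.basis (Fin (r + 1) → ℤ) ℂ).constr_basis ℂ (fun M =>
    glMap c M ∘ₗ (LieAlgebra.SpecialLinear.sl (Fin ℓ) ℂ).toSubmodule.subtype) M
  rw [AddMonoidAlgebra.basis_apply] at h
  exact LinearMap.congr_fun h X

/-- The operators attached to the elements of `⨁_ν R K_ν`. -/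
def preCentreMap (ℓ : ℕ) {r : ℕ} (c : Fin r → Fin r → ℤˣ) :
    (Fin (r + 1) → Laurent r) →ₗ[ℂ] Op (Idx ℓ r) :=
  ∑ ν, (AddMonoidAlgebra.basis (Fin (r + 1) → ℤ) ℂ).constr ℂ (centreOp ℓ c ν) ∘ₗ LinearMap.proj ν

lemma constr_tPow (f : (Fin (r + 1) → ℤ) → Op (Idx ℓ r)) (M : Fin (r + 1) → ℤ) :
    (AddMonoidAlgebra.basis (Fin (r + 1) → ℤ) ℂ).constr ℂ f (tPow M) = f M := by
  have h := (AddMonoidAlgebra.basis (Fin (r + 1) → ℤ) ℂ).constr_basis ℂ f M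
  rwa [AddMonoidAlgebra.basis_apply] at h

lemma relations_le_ker : relations r ≤ LinearMap.ker (preCentreMap ℓ c) := by
  rw [relations, Submodule.span_le]
  rintro _ ⟨M, rfl⟩
  refine LinearMap.mem_ker.2 (LinearMap.ext fun u => ?_)
  rw [preCentreMap, LinearMap.sum_apply, LinearMap.sum_apply, LinearMap.zero_apply,
    ← sum_centreOp_self c M u]
  refine Finset.sum_congr rfl fun ν _ => ?_
  rw [LinearMap.comp_apply, LinearMap.proj_apply, map_smul, constr_tPow, LinearMap.smul_apply]

/-- The linear map from a quotient space to the endomorphisms of a vector space that is induced by a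
linear map vanishing on the subspace. -/
def quotientToEnd {V M : Type} [AddCommGroup V] [Module ℂ V] [AddCommGroup M] [Module ℂ M]
    (p : Submodule ℂ M) (f : M →ₗ[ℂ] Module.End ℂ V) (h : p ≤ LinearMap.ker f) :
    M ⧸ p →ₗ[ℂ] Module.End ℂ V :=
  p.liftQ f h

lemma quotientToEnd_mkQ {V M : Type} [AddCommGroup V] [Module ℂ V] [AddCommGroup M] [Module ℂ M]
    (p : Submodule ℂ M) (f : M →ₗ[ℂ] Module.End ℂ V) (h : p ≤ LinearMap.ker f) (x : M) :
    quotientToEnd p f h (p.mkQ x) = f x :=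
  rfl

/-- The operators attached to the elements of `𝒦`. -/
def centreMap (ℓ : ℕ) {r : ℕ} (c : Fin r → Fin r → ℤˣ) : Centre r →ₗ[ℂ] Op (Idx ℓ r) :=
  quotientToEnd (relations r) (preCentreMap ℓ c) (relations_le_ker c)

lemma centreMap_mkQ (y : Fin (r + 1) → Laurent r) :
    centreMap ℓ c ((relations r).mkQ y) = preCentreMap ℓ c y :=
  quotientToEnd_mkQ (relations r) (preCentreMap ℓ c) (relations_le_ker c) y

lemma preCentreMap_single (ν : Fin (r + 1)) (M : Fin (r + 1) → ℤ) :
    preCentreMap ℓ c (Pi.single ν (tPow M)) = centreOp ℓ c ν M := by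
  refine LinearMap.ext fun u => ?_
  rw [preCentreMap, LinearMap.sum_apply, LinearMap.sum_apply, Finset.sum_eq_single ν]
  · rw [LinearMap.comp_apply, LinearMap.proj_apply, Pi.single_eq_same, constr_tPow]
  · intro μ _ h
    rw [LinearMap.comp_apply, LinearMap.proj_apply, Pi.single_eq_of_ne h, map_zero,
      LinearMap.zero_apply]
  · simp

lemma centreMap_kClass (ν : Fin (r + 1)) (M : Fin (r + 1) → ℤ) :
    centreMap ℓ c (kClass ν M) = centreOp ℓ c ν M := by
  rw [kClass, centreMap_mkQ, preCentreMap_single]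

lemma centreMap_omega (M N : Fin (r + 1) → ℤ) :
    centreMap ℓ c (omega r (tPow M) (tPow N)) = cocycleOp ℓ c M N := by
  simp only [omega_tPow, map_sum, map_smul, centreMap_kClass, cocycleOp]

lemma single_eq_smul_tPow (M : Fin (r + 1) → ℤ) (s : ℂ) :
    (AddMonoidAlgebra.single M s : Laurent r) = s • tPow M := by
  simp [tPow]

/-- Induction along the spanning set `t^M ⊗ X` of `R ⊗ g`. -/
lemma loop_induction {g : Type} [AddCommGroup g] [Module ℂ g] {P : Laurent r ⊗[ℂ] g → Prop}
    (zero : P 0) (add : ∀ x y, P x → P y → P (x + y)) (tmul : ∀ M X, P (tPow M ⊗ₜ X))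
    (x : Laurent r ⊗[ℂ] g) : P x := by
  induction x using TensorProduct.induction_on with
  | zero => exact zero
  | add x y hx hy => exact add x y hx hy
  | tmul a X =>
    induction a using AddMonoidAlgebra.induction_linear with
    | zero => rwa [TensorProduct.zero_tmul]
    | add f g hf hg => rw [TensorProduct.add_tmul]; exact add _ _ hf hg
    | single M s =>
      rw [single_eq_smul_tPow, TensorProduct.smul_tmul]
      exact tmul M (s • X)

/-- `𝒦` is spanned by the classes of the elements `t^M K_ν`. -/
lemma centre_induction {P : Centre r → Prop} (zero : P 0) (add : ∀ x y, P x → P y → P (x + y))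
    (smul : ∀ (s : ℂ) x, P x → P (s • x)) (of : ∀ ν M, P (kClass ν M)) (x : Centre r) : P x := by
  obtain ⟨y, rfl⟩ := (relations r).mkQ_surjective x
  have hy : y = ∑ ν, Pi.single ν (y ν) := (Finset.univ_sum_single y).symm
  rw [hy, map_sum]
  refine Finset.sum_induction _ P add zero fun ν _ => ?_
  generalize y ν = f
  induction f using AddMonoidAlgebra.induction_linear with
  | zero => rwa [Pi.single_zero, map_zero]
  | add f g hf hg => rw [Pi.single_add, map_add]; exact add _ _ hf hg
  | single M s =>
    rw [single_eq_smul_tPow, Pi.single_smul, map_smul]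
    exact smul s _ (of ν M)

lemma loopMap_comm (x y : Laurent r ⊗[ℂ] LieAlgebra.SpecialLinear.sl (Fin ℓ) ℂ)
    (u : StateSpace (Idx ℓ r)) :
    loopMap c x (loopMap c y u) = loopMap c y (loopMap c x u) + loopMap c ⁅x, y⁆ u +
      centreMap ℓ c (cocycle (slForm ℓ) r x y) u := by
  induction x using loop_induction with
  | zero => simp [loop_zero_lie]
  | add x x' hx hx' =>
    simp only [map_add, loop_add_lie, LinearMap.add_apply, hx, hx']
    abel
  | tmul M X =>
    induction y using loop_induction with
    | zero => simp [loop_lie_zero]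
    | add y y' hy hy' =>
      simp only [map_add, loop_lie_add, LinearMap.add_apply, hy, hy']
      abel
    | tmul N Y =>
      rw [LieAlgebra.ExtendScalars.bracket_tmul, tPow_mul, cocycle_tmul, map_smul, centreMap_omega,
        loopMap_tPow, loopMap_tPow, loopMap_tPow, LinearMap.smul_apply,
        LieAlgebra.SpecialLinear.sl_bracket]
      have h := glMap_comm c M N X.val Y.val u
      have e : (slForm ℓ).toForm X Y = Matrix.trace (X.val * Y.val) := rfl
      rw [map_sub, LinearMap.sub_apply, e, eq_sub_of_add_eq h]
      abel

lemma centreMap_comm_loopMap (x : Centre r)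
    (y : Laurent r ⊗[ℂ] LieAlgebra.SpecialLinear.sl (Fin ℓ) ℂ) (u : StateSpace (Idx ℓ r)) :
    centreMap ℓ c x (loopMap c y u) = loopMap c y (centreMap ℓ c x u) := by
  induction x using centre_induction with
  | zero => simp
  | add x x' hx hx' => simp only [map_add, LinearMap.add_apply, hx, hx']
  | smul s x hx => simp only [map_smul, LinearMap.smul_apply, hx]
  | of ν M =>
    induction y using loop_induction with
    | zero => simp
    | add y y' hy hy' => simp only [map_add, LinearMap.add_apply, hy, hy']
    | tmul N Y =>
      rw [loopMap_tPow, centreMap_kClass, glMap_apply]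
      simp only [LinearMap.sum_apply, LinearMap.smul_apply, map_sum, map_smul,
        centreOp_comm_unitOp]

lemma centreMap_comm (x y : Centre r) (u : StateSpace (Idx ℓ r)) :
    centreMap ℓ c x (centreMap ℓ c y u) = centreMap ℓ c y (centreMap ℓ c x u) := by
  induction x using centre_induction with
  | zero => simp
  | add x x' hx hx' => simp only [map_add, LinearMap.add_apply, hx, hx']
  | smul s x hx => simp only [map_smul, LinearMap.smul_apply, hx]
  | of ν M =>
    induction y using centre_induction with
    | zero => simp
    | add y y' hy hy' => simp only [map_add, LinearMap.add_apply, hy, hy']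
    | smul s y hy => simp only [map_smul, LinearMap.smul_apply, hy]
    | of μ N => rw [centreMap_kClass, centreMap_kClass, centreOp_comm]

/-- The representation of the toroidal Lie algebra on the state space. -/
def toroidalRep (ℓ : ℕ) {r : ℕ} (c : Fin r → Fin r → ℤˣ) :
    Toroidal (slForm ℓ) r →ₗ⁅ℂ⁆ Op (Idx ℓ r) where
  toFun x := loopMap c x.loop + centreMap ℓ c x.centre
  map_add' x y := by
    rw [Toroidal.loop_add, Toroidal.centre_add, map_add, map_add, add_add_add_comm]
  map_smul' s x := by
    rw [Toroidal.loop_smul, Toroidal.centre_smul, map_smul, map_smul, RingHom.id_apply, smul_add]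
  map_lie' {x y} := by
    refine LinearMap.ext fun u => ?_
    rw [LieRing.of_associative_ring_bracket, LinearMap.sub_apply, Module.End.mul_apply,
      Module.End.mul_apply]
    simp only [LinearMap.add_apply, map_add, Toroidal.loop_lie, Toroidal.centre_lie]
    rw [loopMap_comm c x.loop y.loop, centreMap_comm_loopMap c x.centre y.loop,
      centreMap_comm_loopMap c y.centre x.loop, centreMap_comm c x.centre y.centre]
    abel

lemma toroidalRep_apply (x : Toroidal (slForm ℓ) r) :
    toroidalRep ℓ c x = loopMap c x.loop + centreMap ℓ c x.centre := rfl

lemma toroidalRep_ofLoop (X : LieAlgebra.SpecialLinear.sl (Fin ℓ) ℂ) (M : Fin (r + 1) → ℤ) :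
    toroidalRep ℓ c (Toroidal.ofLoop (slForm ℓ) X M) = glMap c M X.val := by
  rw [toroidalRep_apply, Toroidal.ofLoop, loopMap_tPow, map_zero, add_zero]

lemma toroidalRep_ofCentre (ν : Fin (r + 1)) (M : Fin (r + 1) → ℤ) :
    toroidalRep ℓ c (Toroidal.ofCentre (slForm ℓ) ν M) = centreOp ℓ c ν M := by
  rw [toroidalRep_apply, Toroidal.ofCentre, centreMap_kClass, map_zero, zero_add]

lemma toroidalRep_h (i j : Fin ℓ) (m : ℤ) (p : Fin r → ℤ) :
    toroidalRep ℓ c (Toroidal.ofLoop (slForm ℓ)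
      (LieAlgebra.SpecialLinear.singleSubSingle i j (1 : ℂ)) (Fin.cons m p)) =
      hMode c i j m p := by
  rw [toroidalRep_ofLoop, LieAlgebra.SpecialLinear.val_singleSubSingle, map_sub, glMap_single,
    glMap_single, one_smul, one_smul, unitOp_self, unitOp_self, hMode, modeΓ, mode_neg, cplx_sub,
    Fin.tail_cons, Fin.cons_zero, ← currentₗ_apply, ← currentₗ_apply, ← currentₗ_apply, map_sub]
  rfl

lemma toroidalRep_e (k l : Fin ℓ) (hkl : k ≠ l) (m : ℤ) (p : Fin r → ℤ) :
    toroidalRep ℓ c (Toroidal.ofLoop (slForm ℓ)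
      (LieAlgebra.SpecialLinear.single k l hkl (1 : ℂ)) (Fin.cons m p)) = eMode c k l m p := by
  rw [toroidalRep_ofLoop, LieAlgebra.SpecialLinear.val_single, glMap_single, one_smul,
    unitOp_of_ne c hkl, eMode, modeΓ, mode_one, Fin.tail_cons, Fin.cons_zero]
  rfl

lemma toroidalRep_k (ν : Fin (r + 1)) (m : ℤ) (p : Fin r → ℤ) :
    toroidalRep ℓ c (Toroidal.ofCentre (slForm ℓ) ν (Fin.cons m p)) = kMode ℓ c ν m p := by
  rw [toroidalRep_ofCentre]
  cases ν using Fin.cases with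
  | zero =>
    rw [centreOp_zero, kMode, Fin.cases_zero, modeΓ, mode_one, Fin.tail_cons, Fin.cons_zero,
      show -(m - 1) - 1 = -m by ring]
    rfl
  | succ μ =>
    rw [centreOp_succ, kMode, Fin.cases_succ, modeΓ, mode_neg, Fin.tail_cons, Fin.cons_zero]
    rfl

end Representation

/-! ### The image of the representation -/

section Range

variable {ℓ r : ℕ} (c : Fin r → Fin r → ℤˣ)

/-- A subspace of matrices contains `sl_ℓ` if it contains its standard generators. -/
lemma mem_of_trace_eq_zero (T : Submodule ℂ (Matrix (Fin ℓ) (Fin ℓ) ℂ))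
    (h : ∀ i j : Fin ℓ, (i : ℕ) + 1 = j → Matrix.single i i 1 - Matrix.single j j 1 ∈ T)
    (e : ∀ k l : Fin ℓ, k ≠ l → Matrix.single k l 1 ∈ T) (X : Matrix (Fin ℓ) (Fin ℓ) ℂ)
    (hX : X.trace = 0) : X ∈ T := by
  cases ℓ with
  | zero => rw [Subsingleton.elim X 0]; exact T.zero_mem
  | succ n =>
    -- telescoping
    have hd : ∀ i : Fin (n + 1), Matrix.single i i 1 - Matrix.single 0 0 1 ∈ T := by
      intro i
      induction i using Fin.induction with
      | zero => rw [sub_self]; exact T.zero_mem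
      | succ i hi =>
        have := T.sub_mem hi (h i.castSucc i.succ (by simp))
        rwa [sub_sub_sub_cancel_left] at this
    -- subtracting the trace, which is zero, at the position `(0, 0)`
    have hX' : X = ∑ k, ∑ l, (X k l • Matrix.single k l (1 : ℂ) -
        if k = l then X k k • Matrix.single 0 0 (1 : ℂ) else 0) := by
      simp only [Finset.sum_sub_distrib, Finset.sum_ite_eq, Finset.mem_univ, if_true]
      rw [← Finset.sum_smul, show ∑ k, X k k = 0 from hX, zero_smul, sub_zero]
      conv_lhs => rw [Matrix.matrix_eq_sum_single X]
      simp
    rw [hX']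
    refine T.sum_mem fun k _ => T.sum_mem fun l _ => ?_
    split_ifs with hkl
    · subst hkl
      rw [← smul_sub]
      exact T.smul_mem _ (hd k)
    · rw [sub_zero]
      exact T.smul_mem _ (e k l hkl)

lemma centreOp_mem_gTor (ν : Fin (r + 1)) (M : Fin (r + 1) → ℤ) :
    centreOp ℓ c ν M ∈ gTor ℓ r c := by
  rw [← toroidalRep_ofCentre, ← Fin.cons_self_tail M, toroidalRep_k]
  exact (kElt ℓ c ν (M 0) (Fin.tail M)).2

lemma glMap_mem_gTor (M : Fin (r + 1) → ℤ) (X : Matrix (Fin ℓ) (Fin ℓ) ℂ) (hX : X.trace = 0) :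
    glMap c M X ∈ gTor ℓ r c := by
  refine mem_of_trace_eq_zero ((gTor ℓ r c).toSubmodule.comap (glMap c M)) ?_ ?_ X hX
  · intro i j hij
    have h := toroidalRep_h c i j (M 0) (Fin.tail M)
    rw [Fin.cons_self_tail, toroidalRep_ofLoop, LieAlgebra.SpecialLinear.val_singleSubSingle] at h
    change glMap c M _ ∈ gTor ℓ r c
    rw [h]
    exact (hElt c i j hij (M 0) (Fin.tail M)).2
  · intro k l hkl
    have h := toroidalRep_e c k l hkl (M 0) (Fin.tail M)
    rw [Fin.cons_self_tail, toroidalRep_ofLoop, LieAlgebra.SpecialLinear.val_single] at h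
    change glMap c M _ ∈ gTor ℓ r c
    rw [h]
    exact (eElt c k l hkl (M 0) (Fin.tail M)).2

lemma toroidalRep_mem_gTor (x : Toroidal (slForm ℓ) r) : toroidalRep ℓ c x ∈ gTor ℓ r c := by
  have h1 : ∀ y, loopMap c y ∈ gTor ℓ r c := fun y => by
    induction y using loop_induction with
    | zero => rw [map_zero]; exact (gTor ℓ r c).zero_mem
    | add y y' hy hy' => rw [map_add]; exact (gTor ℓ r c).add_mem hy hy'
    | tmul M X =>
      rw [loopMap_tPow]
      exact glMap_mem_gTor c M _ X.2
  have h2 : ∀ y, centreMap ℓ c y ∈ gTor ℓ r c := fun y => by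
    induction y using centre_induction with
    | zero => rw [map_zero]; exact (gTor ℓ r c).zero_mem
    | add y y' hy hy' => rw [map_add]; exact (gTor ℓ r c).add_mem hy hy'
    | smul s y hy => rw [map_smul]; exact (gTor ℓ r c).smul_mem s hy
    | of ν M => rw [centreMap_kClass]; exact centreOp_mem_gTor c ν M
  rw [toroidalRep_apply]
  exact (gTor ℓ r c).add_mem (h1 _) (h2 _)

lemma range_toroidalRep : (toroidalRep ℓ c).range = gTor ℓ r c := by
  refine le_antisymm ?_ (LieSubalgebra.lieSpan_le.2 ?_)
  · rintro _ ⟨x, rfl⟩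
    exact toroidalRep_mem_gTor c x
  · rintro _ ((⟨i, j, -, m, p, rfl⟩ | ⟨k, l, hkl, m, p, rfl⟩) | ⟨ν, m, p, rfl⟩)
    · exact ⟨_, toroidalRep_h c i j m p⟩
    · exact ⟨_, toroidalRep_e c k l hkl m p⟩
    · exact ⟨_, toroidalRep_k c ν m p⟩

end Range

/-! ### Matrix coefficients and injectivity -/

section Coefficients

variable {ι : Type} [Fintype ι] [DecidableEq ι] (B : ι → ι → ℤ)
  {ε : (ι → ℤ) → (ι → ℤ) → ℤˣ}

/-- The coefficient of `1 ⊗ e^γ'` in the image of `1 ⊗ e^γ`. -/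
def coefVac {ι : Type} (γ γ' : ι → ℤ) : Op ι →ₗ[ℂ] ℂ where
  toFun A := vac γ' (A (vec 1 γ))
  map_add' A A' := by rw [LinearMap.add_apply, map_add]
  map_smul' s A := by rw [LinearMap.smul_apply, map_smul, RingHom.id_apply]

/-- The coefficient of `1 ⊗ e^γ'` in the image of `1 ⊗ e^γ` under the commutator with `h_{(k)}`. -/
def commVac (h : ι → ℂ) (k : ℤ) (γ γ' : ι → ℤ) : Op ι →ₗ[ℂ] ℂ where
  toFun A := vac γ' (heis B h k (A (vec 1 γ))) - vac γ' (A (heis B h k (vec 1 γ)))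
  map_add' A A' := by
    simp only [LinearMap.add_apply, map_add]; ring
  map_smul' s A := by
    simp only [LinearMap.smul_apply, map_smul, RingHom.id_apply, smul_eq_mul]; ring

variable {B}

lemma coefVac_vertexOp (hL : IsSignedLattice B ε) (α : ι → ℤ) (N : ℤ) (γ γ' : ι → ℤ) :
    coefVac γ γ' (vertexOp B ε α N) = if N = latForm B α γ then sgnVac ε α γ γ' else 0 :=
  vac_vertexOp hL γ' α N γ

lemma coefVac_current (hL : IsSignedLattice B ε) (h : ι → ℂ) (α : ι → ℤ) (N : ℤ)
    (γ γ' : ι → ℤ) : coefVac γ γ' (current B ε h α N) =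
      if N + 1 = latForm B α γ then form B h (cplx γ) * sgnVac ε α γ γ' else 0 :=
  vac_current_vacuum hL h α N γ γ'

lemma commVac_vertexOp (hL : IsSignedLattice B ε) (h : ι → ℂ) (k : ℤ) (α : ι → ℤ) (N : ℤ)
    (γ γ' : ι → ℤ) : commVac B h k γ γ' (vertexOp B ε α N) =
      if N = latForm B α γ + k then form B h (cplx α) * sgnVac ε α γ γ' else 0 := by
  change vac γ' (heis B h k (vertexOp B ε α N (vec 1 γ))) - _ = _
  rw [heis_vertexOp hL, map_add, map_smul, vac_vertexOp hL, add_sub_cancel_left, smul_eq_mul,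
    mul_ite, mul_zero]
  exact if_congr (by omega) rfl rfl

lemma commVac_current (hL : IsSignedLattice B ε) (h : ι → ℂ) (k : ℤ) (h' : ι → ℂ) (α : ι → ℤ)
    (N : ℤ) (γ γ' : ι → ℤ) : commVac B h k γ γ' (current B ε h' α N) =
      if N + 1 = latForm B α γ + k then
        (form B h (cplx α) * form B h' (cplx γ) + k * form B h h') * sgnVac ε α γ γ' else 0 := by
  change vac γ' (heis B h k (current B ε h' α N (vec 1 γ))) - _ = _
  rw [heis_current hL, map_add, map_add, map_smul, map_smul, vac_vertexOp hL,
    vac_current_vacuum hL, add_assoc, add_sub_cancel_left, smul_eq_mul, smul_eq_mul]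
  by_cases hN : N + 1 = latForm B α γ + k
  · rw [if_pos (by omega), if_pos (by omega), if_pos hN]; ring
  · rw [if_neg (by omega), if_neg (by omega), if_neg hN]; ring

end Coefficients

section Injectivity

variable {ℓ r : ℕ} (c : Fin r → Fin r → ℤˣ)

/-- The operator attached to `X ⊗ t^M + ∑_ν a_ν t^M K_ν` for `X ∈ gl_ℓ`. -/
def weightOp (M : Fin (r + 1) → ℤ) (X : Matrix (Fin ℓ) (Fin ℓ) ℂ) (a : Fin (r + 1) → ℂ) :
    Op (Idx ℓ r) :=
  glMap c M X + ∑ ν, a ν • centreOp ℓ c ν M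

lemma map_weightOp (T : Op (Idx ℓ r) →ₗ[ℂ] ℂ) (M : Fin (r + 1) → ℤ)
    (X : Matrix (Fin ℓ) (Fin ℓ) ℂ) (a : Fin (r + 1) → ℂ) : T (weightOp c M X a) =
      ∑ k, ∑ l, X k l * T (unitOp c k l M) +
        (a 0 * T (centreOp ℓ c 0 M) + ∑ μ : Fin r, a μ.succ * T (centreOp ℓ c μ.succ M)) := by
  rw [weightOp, glMap_apply, map_add, map_sum, map_sum, Fin.sum_univ_succ]
  simp only [map_sum, map_smul, smul_eq_mul]

lemma dotTheta_injective : Function.Injective (dotTheta ℓ : (Fin r → ℤ) → Idx ℓ r → ℤ) := by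
  intro p q h
  funext ν
  simpa using congrFun h (.inr (.inl ν))

lemma root_eq_root {k l k' l' : Fin ℓ} (hkl : k ≠ l) {p q : Fin r → ℤ}
    (h : root k' l' q = root k l p) : k' = k ∧ l' = l ∧ q = p := by
  have hp : q = p := by
    funext ν
    simpa using congrFun h (.inr (.inl ν))
  have hk := congrFun h (.inl k)
  have hl := congrFun h (.inl l)
  rw [root_inl, root_inl] at hk hl
  simp only [Pi.sub_apply, Pi.single_apply] at hk hl
  refine ⟨?_, ?_, hp⟩
  · by_contra hne
    rw [if_neg (Ne.symm hne)] at hk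
    simp only [if_true, if_neg hkl] at hk
    split_ifs at hk <;> omega
  · by_contra hne
    rw [if_neg (Ne.symm hne)] at hl
    simp only [if_true, if_neg (Ne.symm hkl)] at hl
    split_ifs at hl <;> omega

lemma root_ne_dotTheta {k l : Fin ℓ} (hkl : k ≠ l) (p q : Fin r → ℤ) :
    dotTheta ℓ q ≠ root k l p := by
  intro h
  rw [← root_self k q] at h
  exact hkl (root_eq_root hkl h).2.1

lemma sgnVac_of_ne {ι : Type} [Fintype ι] (ε : (ι → ℤ) → (ι → ℤ) → ℤˣ) {α β : ι → ℤ} (h : α ≠ β)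
    (γ : ι → ℤ) : sgnVac ε α γ (β + γ) = 0 :=
  if_neg fun h' => h (add_right_cancel h')

lemma sgnVac_self_ne_zero {ι : Type} [Fintype ι] (ε : (ι → ℤ) → (ι → ℤ) → ℤˣ) (α γ : ι → ℤ) :
    sgnVac ε α γ (α + γ) ≠ 0 := by
  rw [sgnVac, if_pos rfl]
  simp

/-- The off-diagonal entries of `X M` are determined by the action, being matrix coefficients up to
sign. -/
lemma offDiag_eq_zero (F : Finset (Fin (r + 1) → ℤ))
    (X : (Fin (r + 1) → ℤ) → Matrix (Fin ℓ) (Fin ℓ) ℂ) (a : (Fin (r + 1) → ℤ) → Fin (r + 1) → ℂ)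
    (h0 : ∑ M ∈ F, weightOp c M (X M) (a M) = 0) {M : Fin (r + 1) → ℤ} (hM : M ∈ F)
    {k l : Fin ℓ} (hkl : k ≠ l) : X M k l = 0 := by
  have hL := isSignedLattice_gram (ℓ := ℓ) c
  set α : Idx ℓ r → ℤ := root k l (Fin.tail M) with hα
  -- a lattice vector with `(α|γ) = -M_0 - 1`, so that the leading coefficient of `E^α` is seen
  set γ : Idx ℓ r → ℤ := Pi.single (.inl k) (-M 0 - 1) with hγ
  have hform : latForm (gram ℓ r) α γ = -M 0 - 1 := by
    rw [latForm_gram]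
    simp [hα, hγ, root_inl, Pi.single_apply, hkl, mul_ite]
  have hcentre : ∀ M' ν, coefVac γ (α + γ) (centreOp ℓ c ν M') = 0 := by
    intro M' ν
    have hs := sgnVac_of_ne (sgnΓ ℓ c) (root_ne_dotTheta hkl (Fin.tail M) (Fin.tail M')) γ
    cases ν using Fin.cases with
    | zero => rw [centreOp_zero, coefVac_vertexOp hL, hs, ite_self]
    | succ μ => rw [centreOp_succ, coefVac_current hL, hs, mul_zero, ite_self]
  have hunit : ∀ M' k' l', ¬ (M' = M ∧ k' = k ∧ l' = l) →
      coefVac γ (α + γ) (unitOp c k' l' M') = 0 := by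
    intro M' k' l' hne
    by_cases hkl' : k' = l'
    · subst hkl'
      rw [unitOp_self, coefVac_current hL,
        sgnVac_of_ne (sgnΓ ℓ c) (root_ne_dotTheta hkl (Fin.tail M) (Fin.tail M')) γ, mul_zero,
        ite_self]
    · rw [unitOp_of_ne c hkl', map_smul, coefVac_vertexOp hL]
      by_cases hr : root k' l' (Fin.tail M') = α
      · obtain ⟨h1, h2, h3⟩ := root_eq_root hkl hr
        rw [if_neg, smul_zero]
        rw [hr, hform]
        intro h4
        refine hne ⟨?_, h1, h2⟩
        rw [← Fin.cons_self_tail M', ← Fin.cons_self_tail M, h3, show M' 0 = M 0 by omega]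
      · rw [sgnVac_of_ne (sgnΓ ℓ c) hr γ, ite_self, smul_zero]
  have hval : coefVac γ (α + γ) (unitOp c k l M) ≠ 0 := by
    rw [unitOp_of_ne c hkl, map_smul, coefVac_vertexOp hL, if_pos hform.symm]
    exact smul_ne_zero (by simp) (sgnVac_self_ne_zero _ _ _)
  have h := congrArg (coefVac γ (α + γ)) h0
  rw [map_sum, map_zero, Finset.sum_eq_single M] at h
  · rw [map_weightOp, Finset.sum_eq_single k, Finset.sum_eq_single l] at h
    · simpa [hcentre, hval] using h
    · intro l' _ hl'
      rw [hunit _ _ _ fun e => hl' e.2.2, mul_zero]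
    · simp
    · intro k' _ hk'
      exact Finset.sum_eq_zero fun l' _ => by rw [hunit _ _ _ fun e => hk' e.2.1, mul_zero]
    · simp
  · intro M' _ hM'
    rw [map_weightOp]
    simp only [hcentre, mul_zero, Finset.sum_const_zero, add_zero]
    exact Finset.sum_eq_zero fun k' _ => Finset.sum_eq_zero fun l' _ => by
      rw [hunit _ _ _ fun e => hM' e.1, mul_zero]
  · intro h'; exact absurd hM h'

/-- A linear equation for the diagonal entries and the central coefficients, from a functional that
behaves on vertex operators and currents like a matrix coefficient between `1 ⊗ e^γ` and
`1 ⊗ e^{p·θ+γ}`. -/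
lemma diag_equation (F : Finset (Fin (r + 1) → ℤ))
    (X : (Fin (r + 1) → ℤ) → Matrix (Fin ℓ) (Fin ℓ) ℂ) (a : (Fin (r + 1) → ℤ) → Fin (r + 1) → ℂ)
    (h0 : ∑ M ∈ F, weightOp c M (X M) (a M) = 0) {M : Fin (r + 1) → ℤ} (hM : M ∈ F)
    (γ : Idx ℓ r → ℤ) (k : ℤ) (hk : -M 0 = latForm (gram ℓ r) (dotTheta ℓ (Fin.tail M)) γ + k)
    (T : Op (Idx ℓ r) →ₗ[ℂ] ℂ) (x : (Idx ℓ r → ℤ) → ℂ) (y : (Idx ℓ r → ℂ) → ℂ)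
    (hE : ∀ α N, T (vertexOp (gram ℓ r) (sgnΓ ℓ c) α N) =
      if N = latForm (gram ℓ r) α γ + k then
        x α * sgnVac (sgnΓ ℓ c) α γ (dotTheta ℓ (Fin.tail M) + γ) else 0)
    (hF : ∀ h α N, T (current (gram ℓ r) (sgnΓ ℓ c) h α N) =
      if N + 1 = latForm (gram ℓ r) α γ + k then
        (x α * form (gram ℓ r) h (cplx γ) + y h) *
          sgnVac (sgnΓ ℓ c) α γ (dotTheta ℓ (Fin.tail M) + γ) else 0) :
    ∑ i, X M i i * (x (dotTheta ℓ (Fin.tail M)) * form (gram ℓ r) (cplx (v r i)) (cplx γ) +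
        y (cplx (v r i))) +
      (a M 0 * x (dotTheta ℓ (Fin.tail M)) + ∑ μ : Fin r, a M μ.succ *
        (x (dotTheta ℓ (Fin.tail M)) * form (gram ℓ r) (cplx (theta ℓ μ)) (cplx γ) +
          y (cplx (theta ℓ μ)))) = 0 := by
  have hoff : ∀ M' k' l', k' ≠ l' → T (unitOp c k' l' M') = 0 := by
    intro M' k' l' hkl'
    rw [unitOp_of_ne c hkl', map_smul, hE,
      sgnVac_of_ne _ (root_ne_dotTheta hkl' (Fin.tail M') (Fin.tail M)).symm, mul_zero, ite_self,
      smul_zero]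
  have hne : ∀ M', M' ≠ M → ∀ z : ℂ, (if -M' 0 = latForm (gram ℓ r) (dotTheta ℓ (Fin.tail M')) γ + k
      then z * sgnVac (sgnΓ ℓ c) (dotTheta ℓ (Fin.tail M')) γ (dotTheta ℓ (Fin.tail M) + γ)
      else 0) = 0 := by
    intro M' hM' z
    by_cases ht : Fin.tail M' = Fin.tail M
    · rw [if_neg]
      rw [ht, ← hk]
      intro h
      exact hM' (by rw [← Fin.cons_self_tail M', ← Fin.cons_self_tail M, ht,
        show M' 0 = M 0 by omega])
    · rw [sgnVac_of_ne _ fun h => ht (dotTheta_injective h), mul_zero, ite_self]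
  have hidx : ∀ M' : Fin (r + 1) → ℤ, -M' 0 - 1 + 1 = -M' 0 := fun M' => by ring
  have h := congrArg T h0
  rw [map_sum, map_zero, Finset.sum_eq_single M] at h
  · rw [map_weightOp, Finset.sum_congr rfl fun i _ => Finset.sum_eq_single i
      (fun l _ hl => by rw [hoff _ _ _ (Ne.symm hl), mul_zero]) (by simp)] at h
    simp only [unitOp_self, centreOp_zero, centreOp_succ, hE, hF, hidx, if_pos hk] at h
    refine (mul_eq_zero.1 ?_).resolve_right
      (sgnVac_self_ne_zero (sgnΓ ℓ c) (dotTheta ℓ (Fin.tail M)) γ)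
    rw [add_mul, add_mul, Finset.sum_mul, Finset.sum_mul]
    simpa only [mul_assoc] using h
  · intro M' _ hM'
    rw [map_weightOp, Finset.sum_congr rfl fun i _ => Finset.sum_eq_single i
      (fun l _ hl => by rw [hoff _ _ _ (Ne.symm hl), mul_zero]) (by simp)]
    simp only [unitOp_self, centreOp_zero, centreOp_succ, hE, hF, hidx, hne M' hM']
    simp
  · intro h'; exact absurd hM h'

/-- The lattice vector `Θ_ν`. -/
def bigTheta (ℓ : ℕ) {r : ℕ} (ν : Fin r) : Idx ℓ r → ℤ := Pi.single (.inr (.inr ν)) 1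

lemma latForm_dotTheta_bigTheta (p : Fin r → ℤ) (ν : Fin r) :
    latForm (gram ℓ r) (dotTheta ℓ p) (bigTheta ℓ ν) = p ν := by
  rw [latForm_gram]; simp [bigTheta, Pi.single_apply]

lemma form_theta_bigTheta (μ ν : Fin r) :
    form (gram ℓ r) (cplx (theta ℓ μ)) (cplx (bigTheta ℓ ν)) = if μ = ν then 1 else 0 := by
  rw [form_cplx, latForm_gram]; simp [bigTheta, theta, Pi.single_apply, eq_comm]

lemma form_bigTheta_theta (ν μ : Fin r) :
    form (gram ℓ r) (cplx (bigTheta ℓ ν)) (cplx (theta ℓ μ)) = if ν = μ then 1 else 0 := by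
  rw [form_cplx, latForm_gram]; simp [bigTheta, theta, Pi.single_apply, eq_comm]

lemma form_bigTheta_dotTheta (ν : Fin r) (p : Fin r → ℤ) :
    form (gram ℓ r) (cplx (bigTheta ℓ ν)) (cplx (dotTheta ℓ p)) = p ν := by
  rw [form_cplx, latForm_gram]; simp [bigTheta, Pi.single_apply]

lemma form_zero_right {ι : Type} [Fintype ι] (B : ι → ι → ℤ) (h : ι → ℂ) :
    form B h (cplx 0) = 0 := by
  simp [form, cplx]

lemma latForm_zero_right {ι : Type} [Fintype ι] (B : ι → ι → ℤ) (α : ι → ℤ) :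
    latForm B α 0 = 0 := by
  simp [latForm]

/-- The linear equation for the coefficients at `t^M` from the matrix coefficients of the operators
themselves. -/
lemma diag_equation_coefVac (F : Finset (Fin (r + 1) → ℤ))
    (X : (Fin (r + 1) → ℤ) → Matrix (Fin ℓ) (Fin ℓ) ℂ) (a : (Fin (r + 1) → ℤ) → Fin (r + 1) → ℂ)
    (h0 : ∑ M ∈ F, weightOp c M (X M) (a M) = 0) {M : Fin (r + 1) → ℤ} (hM : M ∈ F)
    (γ : Idx ℓ r → ℤ) (hγ : -M 0 = latForm (gram ℓ r) (dotTheta ℓ (Fin.tail M)) γ) :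
    ∑ i, X M i i * form (gram ℓ r) (cplx (v r i)) (cplx γ) +
      (a M 0 + ∑ μ : Fin r, a M μ.succ * form (gram ℓ r) (cplx (theta ℓ μ)) (cplx γ)) = 0 := by
  have h := diag_equation c F X a h0 hM γ 0 (by rw [hγ, add_zero])
    (coefVac γ (dotTheta ℓ (Fin.tail M) + γ)) (fun _ => 1) (fun _ => 0)
    (fun α N => by
      rw [coefVac_vertexOp (isSignedLattice_gram c), one_mul, add_zero])
    (fun h α N => by
      rw [coefVac_current (isSignedLattice_gram c), one_mul, add_zero, add_zero])
  simpa using h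

/-- The linear equation for the coefficients at `t^M` from the matrix coefficients of the
commutators with `h_{(k)}`. -/
lemma diag_equation_commVac (F : Finset (Fin (r + 1) → ℤ))
    (X : (Fin (r + 1) → ℤ) → Matrix (Fin ℓ) (Fin ℓ) ℂ) (a : (Fin (r + 1) → ℤ) → Fin (r + 1) → ℂ)
    (h0 : ∑ M ∈ F, weightOp c M (X M) (a M) = 0) {M : Fin (r + 1) → ℤ} (hM : M ∈ F)
    (γ : Idx ℓ r → ℤ) (k : ℤ) (hk : -M 0 = latForm (gram ℓ r) (dotTheta ℓ (Fin.tail M)) γ + k)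
    (h : Idx ℓ r → ℂ) :
    ∑ i, X M i i * (form (gram ℓ r) h (cplx (dotTheta ℓ (Fin.tail M))) *
        form (gram ℓ r) (cplx (v r i)) (cplx γ) + k * form (gram ℓ r) h (cplx (v r i))) +
      (a M 0 * form (gram ℓ r) h (cplx (dotTheta ℓ (Fin.tail M))) + ∑ μ : Fin r, a M μ.succ *
        (form (gram ℓ r) h (cplx (dotTheta ℓ (Fin.tail M))) *
          form (gram ℓ r) (cplx (theta ℓ μ)) (cplx γ) +
          k * form (gram ℓ r) h (cplx (theta ℓ μ)))) = 0 :=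
  diag_equation c F X a h0 hM γ k hk (commVac (gram ℓ r) h k γ (dotTheta ℓ (Fin.tail M) + γ))
    (fun α => form (gram ℓ r) h (cplx α)) (fun h' => k * form (gram ℓ r) h h')
    (fun α N => commVac_vertexOp (isSignedLattice_gram c) h k α N γ _)
    (fun h' α N => commVac_current (isSignedLattice_gram c) h k h' α N γ _)

/-- The diagonal entries of `X M` are determined by the action. -/
lemma diag_eq_zero (F : Finset (Fin (r + 1) → ℤ))
    (X : (Fin (r + 1) → ℤ) → Matrix (Fin ℓ) (Fin ℓ) ℂ) (a : (Fin (r + 1) → ℤ) → Fin (r + 1) → ℂ)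
    (h0 : ∑ M ∈ F, weightOp c M (X M) (a M) = 0) {M : Fin (r + 1) → ℤ} (hM : M ∈ F)
    (j : Fin ℓ) : X M j j = 0 := by
  have key : ∀ (γ : Idx ℓ r → ℤ) (k : ℤ),
      -M 0 = latForm (gram ℓ r) (dotTheta ℓ (Fin.tail M)) γ + k → k ≠ 0 → X M j j = 0 := by
    intro γ k hk hk0
    have h := diag_equation_commVac c F X a h0 hM γ k hk (cplx (v r j))
    simp only [form_v_dotTheta, form_v_v,
      form_comm (isSignedLattice_gram c).symm _ (cplx (theta ℓ _)), form_theta_v,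
      zero_mul, mul_zero, zero_add, Finset.sum_const_zero, add_zero, mul_ite, mul_one,
      Finset.sum_ite_eq, Finset.mem_univ, if_true] at h
    exact (mul_eq_zero.1 h).resolve_right (Int.cast_ne_zero.2 hk0)
  by_cases h1 : M 0 = 0
  · by_cases h2 : Fin.tail M = 0
    · -- for `M = 0` the diagonal and central terms are zero modes, which commute with all
      -- `h_{(k)}`, but their own matrix coefficients are available for all `γ`
      have h3 : ∀ γ : Idx ℓ r → ℤ, -M 0 = latForm (gram ℓ r) (dotTheta ℓ (Fin.tail M)) γ := by
        intro γ
        rw [h1, h2, latForm_gram]; simp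
      have e1 := diag_equation_coefVac c F X a h0 hM 0 (h3 0)
      have e2 := diag_equation_coefVac c F X a h0 hM (v r j) (h3 _)
      simp only [form_zero_right, mul_zero, Finset.sum_const_zero, zero_add, add_zero] at e1
      simp only [form_v_v, form_theta_v, e1, mul_zero, Finset.sum_const_zero, add_zero, mul_ite,
        mul_one, Finset.sum_ite_eq', Finset.mem_univ, if_true] at e2
      exact e2
    · obtain ⟨ν, hν⟩ := Function.ne_iff.1 h2
      refine key (bigTheta ℓ ν) (-Fin.tail M ν) ?_ (neg_ne_zero.2 hν)
      rw [h1, latForm_dotTheta_bigTheta]; ring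
  · exact key 0 (-M 0) (by rw [latForm_zero_right, zero_add]) (neg_ne_zero.2 h1)

/-- The central coefficients `a_ν` at the monomial `t^M` are proportional to `M`. -/
lemma centre_proportional (F : Finset (Fin (r + 1) → ℤ))
    (X : (Fin (r + 1) → ℤ) → Matrix (Fin ℓ) (Fin ℓ) ℂ) (a : (Fin (r + 1) → ℤ) → Fin (r + 1) → ℂ)
    (h0 : ∑ M ∈ F, weightOp c M (X M) (a M) = 0) {M : Fin (r + 1) → ℤ} (hM : M ∈ F) :
    ∃ s : ℂ, ∀ ν, a M ν = s * M ν := by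
  have hd := diag_eq_zero c F X a h0 hM
  -- the commutator with `Θ_μ` for `γ = 0`
  have key0 : ∀ μ : Fin r, (M 0 : ℂ) * a M μ.succ = M μ.succ * a M 0 := by
    intro μ
    have h := diag_equation_commVac c F X a h0 hM 0 (-M 0)
      (by rw [latForm_zero_right, zero_add]) (cplx (bigTheta ℓ μ))
    simp only [hd, form_zero_right, form_bigTheta_theta, form_bigTheta_dotTheta, zero_mul, mul_zero,
      zero_add, Finset.sum_const_zero, mul_ite, mul_one, Finset.sum_ite_eq, Finset.mem_univ,
      if_true, Int.cast_neg, Fin.tail] at h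
    linear_combination -h
  -- the commutator with `Θ_μ` for `γ = Θ_ν`
  have key : ∀ μ ν : Fin r, (M ν.succ : ℂ) * a M μ.succ = M μ.succ * a M ν.succ := by
    intro μ ν
    have h := diag_equation_commVac c F X a h0 hM (bigTheta ℓ ν) (-M 0 - M ν.succ)
      (by rw [latForm_dotTheta_bigTheta, Fin.tail]; ring) (cplx (bigTheta ℓ μ))
    simp only [hd, form_theta_bigTheta, form_bigTheta_theta, form_bigTheta_dotTheta, zero_mul,
      zero_add, Finset.sum_const_zero, mul_ite, mul_one, mul_zero, mul_add, Finset.sum_add_distrib,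
      Finset.sum_ite_eq, Finset.sum_ite_eq', Finset.mem_univ, if_true, Int.cast_neg, Int.cast_sub,
      Fin.tail] at h
    linear_combination -h - key0 μ
  by_cases hz : M = 0
  · have h3 : ∀ γ : Idx ℓ r → ℤ, -M 0 = latForm (gram ℓ r) (dotTheta ℓ (Fin.tail M)) γ := by
      intro γ
      rw [hz, latForm_gram]; simp [Fin.tail]
    have e1 := diag_equation_coefVac c F X a h0 hM 0 (h3 0)
    simp only [form_zero_right, mul_zero, Finset.sum_const_zero, zero_add, add_zero] at e1
    refine ⟨0, fun ν => ?_⟩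
    rw [zero_mul]
    cases ν using Fin.cases with
    | zero => exact e1
    | succ μ =>
      have e2 := diag_equation_coefVac c F X a h0 hM (bigTheta ℓ μ) (h3 _)
      simpa only [hd, e1, form_theta_bigTheta, zero_mul, zero_add, Finset.sum_const_zero, mul_ite,
        mul_one, mul_zero, Finset.sum_ite_eq', Finset.mem_univ, if_true] using e2
  · obtain ⟨j, hj⟩ := Function.ne_iff.1 hz
    have hj' : (M j : ℂ) ≠ 0 := Int.cast_ne_zero.2 hj
    have hall : ∀ ν, (M j : ℂ) * a M ν = M ν * a M j := by
      intro ν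
      cases j using Fin.cases with
      | zero =>
        cases ν using Fin.cases with
        | zero => rfl
        | succ μ => exact key0 μ
      | succ i =>
        cases ν using Fin.cases with
        | zero => exact (key0 i).symm
        | succ μ => exact key μ i
    refine ⟨a M j / M j, fun ν => ?_⟩
    rw [div_mul_eq_mul_div, eq_div_iff hj', mul_comm, hall ν, mul_comm]

lemma exists_loop_sum {g : Type} [AddCommGroup g] [Module ℂ g] (x : Laurent r ⊗[ℂ] g) :
    ∃ f : (Fin (r + 1) → ℤ) →₀ g, x = f.sum fun M X => tPow M ⊗ₜ[ℂ] X := by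
  induction x using loop_induction with
  | zero => exact ⟨0, Finsupp.sum_zero_index.symm⟩
  | add x y hx hy =>
    obtain ⟨f, rfl⟩ := hx
    obtain ⟨f', rfl⟩ := hy
    exact ⟨f + f', (Finsupp.sum_add_index' (fun M => TensorProduct.tmul_zero _ _)
      fun M X Y => TensorProduct.tmul_add _ _ _).symm⟩
  | tmul M X =>
    refine ⟨Finsupp.single M X, ?_⟩
    rw [Finsupp.sum_single_index]
    exact TensorProduct.tmul_zero _ _

lemma exists_centre_sum (x : Centre r) :
    ∃ f : (Fin (r + 1) → ℤ) →₀ (Fin (r + 1) → ℂ),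
      x = f.sum fun M a => ∑ ν, a ν • kClass ν M := by
  induction x using centre_induction with
  | zero => exact ⟨0, Finsupp.sum_zero_index.symm⟩
  | add x y hx hy =>
    obtain ⟨f, rfl⟩ := hx
    obtain ⟨f', rfl⟩ := hy
    exact ⟨f + f', (Finsupp.sum_add_index' (fun M => by simp) fun M a b => by
      simp [add_smul, Finset.sum_add_distrib]).symm⟩
  | smul s x hx =>
    obtain ⟨f, rfl⟩ := hx
    refine ⟨s • f, ?_⟩
    rw [Finsupp.sum_smul_index' fun M => by simp, Finsupp.smul_sum]
    simp [Finset.smul_sum, mul_smul]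
  | of ν M =>
    refine ⟨Finsupp.single M (Pi.single ν 1), ?_⟩
    rw [Finsupp.sum_single_index (by simp), Finset.sum_eq_single ν]
    · simp
    · intro μ _ h; simp [Pi.single_eq_of_ne h]
    · simp

lemma sum_smul_kClass (M : Fin (r + 1) → ℤ) : ∑ ν, (M ν : ℂ) • kClass ν M = 0 := by
  have h := mk_euler (tPow M)
  rw [euler_tPow] at h
  rw [← h]
  simp only [kClass, ← map_smul, ← map_sum]
  refine congrArg _ ?_
  funext μ
  simp [Finset.sum_apply, Pi.single_apply]

lemma toroidalRep_injective : Function.Injective (toroidalRep ℓ c) := by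
  refine (injective_iff_map_eq_zero (toroidalRep ℓ c)).2 fun x hx => ?_
  classical
  obtain ⟨f, hf⟩ := exists_loop_sum x.loop
  obtain ⟨g, hg⟩ := exists_centre_sum x.centre
  set F := f.support ∪ g.support
  rw [Finsupp.sum_of_support_subset f (Finset.subset_union_left : f.support ⊆ F) _
    fun M _ => TensorProduct.tmul_zero _ _] at hf
  rw [Finsupp.sum_of_support_subset g (Finset.subset_union_right : g.support ⊆ F) _
    fun M _ => by simp] at hg
  have h0 : ∑ M ∈ F, weightOp c M (f M).val (g M) = 0 := by
    rw [toroidalRep_apply, hf, hg, map_sum, map_sum, ← Finset.sum_add_distrib] at hx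
    rw [← hx]
    refine Finset.sum_congr rfl fun M _ => ?_
    simp only [weightOp, loopMap_tPow, map_sum, map_smul, centreMap_kClass]
  ext1
  · rw [hf, Toroidal.loop_zero]
    refine Finset.sum_eq_zero fun M hM => ?_
    have : f M = 0 := by
      ext k l
      by_cases hkl : k = l
      · subst hkl
        exact diag_eq_zero c F _ _ h0 hM k
      · exact offDiag_eq_zero c F _ _ h0 hM hkl
    rw [this, TensorProduct.tmul_zero]
  · rw [hg, Toroidal.centre_zero]
    refine Finset.sum_eq_zero fun M hM => ?_
    obtain ⟨s, hs⟩ := centre_proportional c F _ _ h0 hM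
    simp only [hs, mul_smul, ← Finset.smul_sum, sum_smul_kClass, smul_zero]

end Injectivity

/-- The isomorphism of the toroidal Lie algebra with `𝔤^tor`. -/
def toroidalEquiv (ℓ r : ℕ) (c : Fin r → Fin r → ℤˣ) :
    Toroidal (slForm ℓ) r ≃ₗ⁅ℂ⁆ gTor ℓ r c :=
  (LieEquiv.ofInjective (toroidalRep ℓ c) (toroidalRep_injective c)).trans
    (LieEquiv.ofEq _ _ (congrArg SetLike.coe (range_toroidalRep c)))

end

end ToroidalRealization

theorem mainTheorem4 (ℓ r : ℕ) (c : Fin r → Fin r → ℤˣ) :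
    ∃ Ψ : ToroidalRealization.gTor ℓ r c ≃ₗ⁅ℂ⁆
        ToroidalRealization.Toroidal (ToroidalRealization.slForm ℓ) r,
      (∀ (i j : Fin ℓ) (hij : (i : ℕ) + 1 = j) (m : ℤ) (p : Fin r → ℤ),
        Ψ (ToroidalRealization.hElt c i j hij m p) =
          ToroidalRealization.Toroidal.ofLoop (ToroidalRealization.slForm ℓ)
            (LieAlgebra.SpecialLinear.singleSubSingle i j (1 : ℂ)) (Fin.cons m p)) ∧
      (∀ (k l : Fin ℓ) (hkl : k ≠ l) (m : ℤ) (p : Fin r → ℤ),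
        Ψ (ToroidalRealization.eElt c k l hkl m p) =
          ToroidalRealization.Toroidal.ofLoop (ToroidalRealization.slForm ℓ)
            (LieAlgebra.SpecialLinear.single k l hkl (1 : ℂ)) (Fin.cons m p)) ∧
      (∀ (ν : Fin (r + 1)) (m : ℤ) (p : Fin r → ℤ),
        Ψ (ToroidalRealization.kElt ℓ c ν m p) =
          ToroidalRealization.Toroidal.ofCentre (ToroidalRealization.slForm ℓ) ν
            (Fin.cons m p)) := by
  have key : ∀ (y : ToroidalRealization.gTor ℓ r c)
      (x : ToroidalRealization.Toroidal (ToroidalRealization.slForm ℓ) r),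
      ToroidalRealization.toroidalRep ℓ c x = y →
        (ToroidalRealization.toroidalEquiv ℓ r c).symm y = x := fun y x h => by
    rw [← (ToroidalRealization.toroidalEquiv ℓ r c).symm_apply_apply x]
    exact congrArg _ (Subtype.ext h.symm)
  exact ⟨(ToroidalRealization.toroidalEquiv ℓ r c).symm,
    fun i j _ m p => key _ _ (ToroidalRealization.toroidalRep_h c i j m p),
    fun k l hkl m p => key _ _ (ToroidalRealization.toroidalRep_e c k l hkl m p),
    fun ν m p => key _ _ (ToroidalRealization.toroidalRep_k c ν m p)⟩
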